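/- **Setting.** Let $\mathcal G$ be a finite planar bicolored graph drawn with straight, non-crossing edges in a disk. Its boundary vertices $b_1,\dots,b_n$ are labelled clockwise along a common straight interval of the boundary of the disk, and each has degree one; every other (internal) vertex lies inside the disk, has degree $2$ or $3$ and is white or black. Let $\mathcal O$ be a perfect orientation: each white vertex has exactly one incoming edge, each black vertex exactly one outgoing edge, and there are no internal sources or sinks. Let $I\subset[n]$ be the set of $i$ for which $b_i$ is a source and $\bar I=[n]\setminus I$. Let $\mathfrak l$ be a gauge ray direction: the rays in direction $\mathfrak l$ from the boundary vertices point inside the disk, no internal edge has the direction $\mathfrak l$, and no ray from a boundary vertex contains an internal vertex. (Every PBDTP graph, i.e. planar bicolored directed trivalent perfect graph in the disk, with its orientation and a gauge ray direction is of this kind.) For vectors $a,b$ let $s(a,b)\in\{1,0,-1\}$ be the sign of $\det(a,b)$. For edges $e,f$ (as vectors) let $\mathrm{wind}(e,f)=\pm1$ if $s(e,f)=s(e,\mathfrak l)=s(\mathfrak l,f)=\pm1$, and $\mathrm{wind}(e,f)=0$ otherwise. Let $\mathrm{int}(e)$ be the number of open rays in direction $\mathfrak l$ starting at the boundary sources that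 meet $e$. For a directed walk $P=(e_1,\dots,e_m)$ let $\mathrm{wind}(P)=\sum_{k<m}\mathrm{wind}(e_k,e_{k+1})$, $\mathrm{int}(P)=\sum_k\mathrm{int}(e_k)$, $w(P)=\prod_k w_{e_k}$. Let $w_e>0$ be arbitrary weights of the oriented edges. The *edge vector relations* for vectors $X_e\in\mathbb R^n$ are: $X_e=(-1)^{\mathrm{int}(e)+\mathrm{wind}(e,f)}w_eX_f$ at every bivalent or trivalent black vertex, for each incoming $e$ and the outgoing $f$; $X_e=(-1)^{\mathrm{int}(e)}w_e\big((-1)^{\mathrm{wind}(e,f)}X_f+(-1)^{\mathrm{wind}(e,g)}X_g\big)$ at every trivalent white vertex with incoming $e$ and outgoing $f\neq g$. Given boundary data $F_j\in\mathbb R^n$, $j\in\bar I$, the boundary conditions are $X_e=(-1)^{\mathrm{int}(e)}w_eF_j$ for the edge $e$ ending at $b_j$. The *half-edge relations* for vectors $z_{U,e}\in\mathbb R^n$ ($U$ an end vertex of $e$) are: 1. $z_{U,e}=(-1)^{\epsilon_{U,V}}w_e\,z_{V,e}$ for every edge $e=(U,V)$, where * if $U$ is a boundary source: $\epsilon_{U,V}=\mathrm{int}(e)$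 for $V$ white, and $\epsilon_{U,V}=\mathrm{int}(e)+\mathrm{wind}(e,e')$ for $V$ black with outgoing edge $e'$; * if $U,V$ are internal: $\epsilon_{U,V}=\mathrm{int}(e)$ for $U$ black, $V$ white; $1+\mathrm{int}(e)+\mathrm{wind}(e'',e)$ for $U,V$ white; $1+\mathrm{int}(e)+\mathrm{wind}(e'',e)+\mathrm{wind}(e,e')$ for $U$ white, $V$ black; $\mathrm{int}(e)+\mathrm{wind}(e,e')$ for $U,V$ black; here $e''$ is the edge coming in at the white vertex $U$ and $e'$ the edge going out at the black vertex $V$; * if $V$ is a boundary sink: $\epsilon_{U,V}=0$ for $U$ black, and $\epsilon_{U,V}=1+\mathrm{wind}(e'',e)$ for $U$ white with incoming edge $e''$. 2. At each black vertex $V$ all $z_{V,e}$ are equal. 3. At each white vertex $V$, $\sum_{e\ni V}z_{V,e}=0$. The boundary conditions are $z_{b_j,e}=(-1)^{\mathrm{int}(e)}F_j$ for the edge $e$ ending at $b_j$, $j\in\bar I$. **Theorem.** For every choice of positive weights: (a) The edge vector relations and the half-edge relations are equivalent. The map $X\mapsto z$ given, at an internal vertex $U$, by $z_{U,e}=X_e$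 ($U$ black, $e$ outgoing), $z_{U,e}=(-1)^{\mathrm{int}(e)+\mathrm{wind}(e,e')}w_e^{-1}X_e$ ($U$ black, $e$ incoming, $e'$ outgoing), $z_{U,e}=(-1)^{1+\mathrm{wind}(e'',e)}X_e$ ($U$ white, $e$ outgoing, $e''$ incoming), $z_{U,e}=(-1)^{\mathrm{int}(e)}w_e^{-1}X_e$ ($U$ white, $e$ incoming), and by $z_{b_i,e}=X_e$ at sources, $z_{b_j,e}=w_e^{-1}X_e$ at sinks, is a bijection from the solutions of the edge vector relations onto the solutions of the half-edge relations, and it matches the two boundary conditions for all boundary data $F$. (b) The half-edge relations have full rank: the space of their scalar solutions has dimension $|\bar I|$, and for all boundary data $(F_j)_{j\in\bar I}$ there is exactly one solution. (c) Let $z$ be the solution for $F_j=E_j$, the $j$-th vector of the canonical basis. Then $z_{b_i,e}=A[i]-E_i$ for each $i\in I$ and the edge $e$ starting at $b_i$, where $A[i]$ is the row of index $i$ of the boundary measurement matrix $A$ of the network with respect to $I$: $A_I$ is the identity, and $A^i_j=(-1)^{\sigma(i,j)}M_{ij}$ for $j\in\bar I$, where $\sigma(i,j)$ is the number of elements of $I$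 strictly between $i$ and $j$, and $M_{ij}$ is the value at $w$ of the subtraction-free rational function to which the formal power series $\sum_{P:b_i\to b_j}(-1)^{\mathrm{wind}_{\rm top}(P)}w(P)$ sums up (the sum is over all directed walks $P$ from $b_i$ to $b_j$, and $\mathrm{wind}_{\rm top}$ is the topological winding index). (d) The solution $z$ in (c) is the image, under the map in (a), of the edge vectors $X_e$ with $(X_e)_j=0$ for $j\in I$ and $$(X_e)_j=\frac{\sum_{(P,C)}(-1)^{\mathrm{wind}(P)+\mathrm{int}(P)}w(P)\prod_{f\in C}w_f}{\sum_{C}\prod_{f\in C}w_f}\qquad(j\in\bar I).$$ In the denominator $C$ runs over the conservative flows: sets of edges not incident to the boundary such that at each internal vertex as many edges of $C$ come in as go out. In the numerator $(P,C)$ runs over the pairs of a directed walk $P$ with first edge $e$ that ends at $b_j$ and uses no edge twice, and a conservative flow $C$ having no edge in common with $P$. -/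

import Mathlib

open scoped BigOperators

/-- A finite planar bicolored graph in the disk with a perfect orientation, drawn with straight
edges.  Coordinates in the plane `ℂ` are chosen so that the common interval of the boundary of the
disk carrying the boundary vertices is on the real axis and the disk lies above it.  A finite
drawing in the closed upper half-plane lies in a large half-disk, and the clockwise order of the
boundary vertices is then the order from right to left.

`Fin n` indexes the boundary vertices, `V` the internal vertices (white if `White` holds, black
otherwise), `E` the edges, each oriented from `src` to `tgt`. -/
structure PlanarPerfectGraph (n : ℕ) (V E : Type*) where
  src : E → Fin n ⊕ V
  tgt : E → Fin n ⊕ V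
  White : V → Prop
  pos : Fin n ⊕ V → ℂ
  pos_injective : Function.Injective pos
  boundary_im : ∀ i : Fin n, (pos (Sum.inl i)).im = 0
  boundary_clockwise : StrictAnti fun i : Fin n => (pos (Sum.inl i)).re
  internal_im : ∀ v : V, 0 < (pos (Sum.inr v)).im
  src_ne_tgt : ∀ e, src e ≠ tgt e
  /-- edges run inside the disk -/
  edge_inside : ∀ e, ∀ p ∈ openSegment ℝ (pos (src e)) (pos (tgt e)), 0 < p.im
  /-- no edge passes through a vertex -/
  edge_vertex : ∀ e x, pos x ∉ openSegment ℝ (pos (src e)) (pos (tgt e))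
  /-- distinct edges do not cross -/
  edge_edge : ∀ e f, e ≠ f → Disjoint (openSegment ℝ (pos (src e)) (pos (tgt e)))
    (openSegment ℝ (pos (src f)) (pos (tgt f)))
  boundary_univalent : ∀ i : Fin n, ∃! e, src e = Sum.inl i ∨ tgt e = Sum.inl i
  internal_valency : ∀ v : V, {e | src e = Sum.inr v ∨ tgt e = Sum.inr v}.ncard = 2 ∨
    {e | src e = Sum.inr v ∨ tgt e = Sum.inr v}.ncard = 3
  /-- exactly one edge comes in at a white vertex -/
  white_in : ∀ v, White v → ∃! e, tgt e = Sum.inr v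
  /-- exactly one edge goes out at a black vertex -/
  black_out : ∀ v, ¬ White v → ∃! e, src e = Sum.inr v

namespace PlanarPerfectGraph

noncomputable section

variable {n : ℕ} {V E : Type*} (G : PlanarPerfectGraph n V E)

/-- The boundary vertex `b_i` is a source; the base `I` is the set of these `i`. -/
def IsSource (i : Fin n) : Prop := ∃ e, G.src e = Sum.inl i

/-- The number of edges at an internal vertex. -/
def valency (v : V) : ℕ := {e | G.src e = Sum.inr v ∨ G.tgt e = Sum.inr v}.ncard

/-- The edge that comes in at a white vertex. -/
def inEdge (v : V) (hv : G.White v) : E := (G.white_in v hv).choose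

/-- The edge that goes out at a black vertex. -/
def outEdge (v : V) (hv : ¬ G.White v) : E := (G.black_out v hv).choose

/-- The vector of an oriented edge. -/
def dir (e : E) : ℂ := G.pos (G.tgt e) - G.pos (G.src e)

/-! ### Gauge ray, local winding number, intersection number -/

/-- `l` is (a vector in) a gauge ray direction. -/
structure IsGaugeRay (l : ℂ) : Prop where
  /-- rays from boundary vertices point inside the disk -/
  inside : 0 < l.im
  /-- no internal edge is parallel to `l` -/
  not_parallel : ∀ e u v, G.src e = Sum.inr u → G.tgt e = Sum.inr v →
    ∀ c : ℝ, 0 < c → G.dir e ≠ c * l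
  /-- no ray from a boundary vertex contains an internal vertex -/
  avoids : ∀ (i : Fin n) (v : V) (t : ℝ), 0 < t →
    G.pos (Sum.inr v) ≠ G.pos (Sum.inl i) + t * l

/-- `+1` if the ordered pair of vectors is positively oriented, `-1` if it is negatively oriented,
`0` if the vectors are collinear. -/
def orient (a b : ℂ) : ℤ := SignType.sign (a.re * b.im - a.im * b.re)

open Classical in
/-- The local winding number of an ordered pair of edges.  (Consecutive edges of a plane graph
with straight edges are never antiparallel.) -/
def wind (l : ℂ) (e f : E) : ℤ :=
  if orient (G.dir e) (G.dir f) = 1 ∧ orient (G.dir e) l = 1 ∧ orient l (G.dir f) = 1 then 1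
  else if orient (G.dir e) (G.dir f) = -1 ∧ orient (G.dir e) l = -1 ∧ orient l (G.dir f) = -1
  then -1 else 0

/-- The number of gauge rays starting at boundary sources that intersect the edge `e`
(the starting point itself is not an intersection). -/
def intNum (l : ℂ) (e : E) : ℕ :=
  {i : Fin n | G.IsSource i ∧ ∃ t : ℝ, 0 < t ∧
    G.pos (Sum.inl i) + t * l ∈ segment ℝ (G.pos (G.src e)) (G.pos (G.tgt e))}.ncard

/-! ### The linear relations for edge vectors -/

section Systems

variable {W : Type*} [AddCommGroup W] [Module ℝ W]

/-- The linear relations for edge vectors at the internal vertices. -/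
structure IsEdgeSystem (l : ℂ) (w : E → ℝ) (X : E → W) : Prop where
  bivalent : ∀ v, G.valency v = 2 → ∀ e f, G.tgt e = Sum.inr v → G.src f = Sum.inr v →
    X e = ((-1 : ℝ) ^ ((G.intNum l e : ℤ) + G.wind l e f) * w e) • X f
  black : ∀ v, G.valency v = 3 → ¬ G.White v → ∀ e f, G.tgt e = Sum.inr v → G.src f = Sum.inr v →
    X e = ((-1 : ℝ) ^ ((G.intNum l e : ℤ) + G.wind l e f) * w e) • X f
  white : ∀ v, G.valency v = 3 → G.White v → ∀ e f g, G.tgt e = Sum.inr v →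
    G.src f = Sum.inr v → G.src g = Sum.inr v → f ≠ g →
    X e = ((-1 : ℝ) ^ ((G.intNum l e : ℤ) + G.wind l e f) * w e) • X f
      + ((-1 : ℝ) ^ ((G.intNum l e : ℤ) + G.wind l e g) * w e) • X g

/-- The edge vectors have the boundary values `F j` at the boundary sinks `b_j`. -/
def EdgeBoundary (l : ℂ) (w : E → ℝ) (F : Fin n → W) (X : E → W) : Prop :=
  ∀ e j, G.tgt e = Sum.inl j → X e = ((-1 : ℝ) ^ G.intNum l e * w e) • F j

/-! ### Half-edges and the relations for half-edge vectors -/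

/-- Half-edges `(U, e)`: an edge `e` with one of its end vertices `U`. -/
def HalfEdge : Type _ := {h : (Fin n ⊕ V) × E // G.src h.2 = h.1 ∨ G.tgt h.2 = h.1}

open Classical in
instance [Fintype V] [Fintype E] : Fintype G.HalfEdge :=
  inferInstanceAs (Fintype {h : (Fin n ⊕ V) × E // G.src h.2 = h.1 ∨ G.tgt h.2 = h.1})

/-- The vertex of a half-edge. -/
def HalfEdge.vertex {G : PlanarPerfectGraph n V E} (h : G.HalfEdge) : Fin n ⊕ V := h.1.1

/-- The edge of a half-edge. -/
def HalfEdge.edge {G : PlanarPerfectGraph n V E} (h : G.HalfEdge) : E := h.1.2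

/-- The half-edge of `e` at the initial vertex of `e`. -/
def srcHalf (e : E) : G.HalfEdge := ⟨(G.src e, e), Or.inl rfl⟩

/-- The half-edge of `e` at the final vertex of `e`. -/
def tgtHalf (e : E) : G.HalfEdge := ⟨(G.tgt e, e), Or.inr rfl⟩

open Classical in
/-- The exponent `ε_{U,V}` of the geometric signature at the edge `e = (U, V)`. -/
def signature (l : ℂ) (e : E) : ℤ :=
  match G.src e, G.tgt e with
  | Sum.inl _, Sum.inr v =>
      if hv : G.White v then G.intNum l e
      else G.intNum l e + G.wind l e (G.outEdge v hv)
  | Sum.inr u, Sum.inr v =>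
      if hu : G.White u then
        if hv : G.White v then 1 + G.intNum l e + G.wind l (G.inEdge u hu) e
        else 1 + G.intNum l e + G.wind l (G.inEdge u hu) e + G.wind l e (G.outEdge v hv)
      else
        if hv : G.White v then G.intNum l e
        else G.intNum l e + G.wind l e (G.outEdge v hv)
  | Sum.inr u, Sum.inl _ =>
      if hu : G.White u then 1 + G.wind l (G.inEdge u hu) e else 0
  | Sum.inl _, Sum.inl _ => 0

open Classical in
/-- The relations for half-edge vectors with the geometric signature. -/
structure IsHalfEdgeSystem [Fintype V] [Fintype E] (l : ℂ) (w : E → ℝ) (z : G.HalfEdge → W) :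
    Prop where
  edge : ∀ e, z (G.srcHalf e) = ((-1 : ℝ) ^ G.signature l e * w e) • z (G.tgtHalf e)
  black : ∀ v, ¬ G.White v → ∀ h h' : G.HalfEdge, h.vertex = Sum.inr v → h'.vertex = Sum.inr v →
    z h = z h'
  white : ∀ v, G.White v → ∑ h : G.HalfEdge with h.vertex = Sum.inr v, z h = 0

/-- The half-edge vectors have the boundary values `F j` at the boundary sinks `b_j`. -/
def HalfEdgeBoundary (l : ℂ) (F : Fin n → W) (z : G.HalfEdge → W) : Prop :=
  ∀ e j, G.tgt e = Sum.inl j → z (G.tgtHalf e) = ((-1 : ℝ) ^ G.intNum l e) • F j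

open Classical in
/-- The correspondence from edge vectors to half-edge vectors. -/
def toHalfEdge (l : ℂ) (w : E → ℝ) (X : E → W) (h : G.HalfEdge) : W :=
  if G.src h.edge = h.vertex then
    match h.vertex with
    | Sum.inl _ => X h.edge
    | Sum.inr u =>
        if hu : G.White u then
          ((-1 : ℝ) ^ (1 + G.wind l (G.inEdge u hu) h.edge)) • X h.edge
        else X h.edge
  else
    match h.vertex with
    | Sum.inl _ => (w h.edge)⁻¹ • X h.edge
    | Sum.inr v =>
        if hv : G.White v then
          ((-1 : ℝ) ^ (G.intNum l h.edge : ℤ) * (w h.edge)⁻¹) • X h.edge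
        else
          ((-1 : ℝ) ^ ((G.intNum l h.edge : ℤ) + G.wind l h.edge (G.outEdge v hv))
            * (w h.edge)⁻¹) • X h.edge

end Systems

/-- The space of scalar solutions of the half-edge relations (no boundary values prescribed).
Its dimension is the number of unknowns minus the rank of the system. -/
def solutionSpace [Fintype V] [Fintype E] (l : ℂ) (w : E → ℝ) : Submodule ℝ (G.HalfEdge → ℝ) where
  carrier := {z | G.IsHalfEdgeSystem l w z}
  zero_mem' := ⟨fun e => by simp, fun v _ h h' _ _ => rfl, fun v _ => by simp⟩
  add_mem' := by
    intro a b ha hb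
    refine ⟨fun e => ?_, fun v hv h h' e e' => ?_, fun v hv => ?_⟩
    · simp only [Pi.add_apply, smul_add, ha.edge e, hb.edge e]
    · simp only [Pi.add_apply, ha.black v hv h h' e e', hb.black v hv h h' e e']
    · simp only [Pi.add_apply, Finset.sum_add_distrib, ha.white v hv, hb.white v hv, add_zero]
  smul_mem' := by
    intro c a ha
    refine ⟨fun e => ?_, fun v hv h h' e e' => ?_, fun v hv => ?_⟩
    · simp only [Pi.smul_apply, ha.edge e, smul_comm c]
    · simp only [Pi.smul_apply, ha.black v hv h h' e e']
    · simp only [Pi.smul_apply, ← Finset.smul_sum, ha.white v hv, smul_zero]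

/-! ### Walks, flows, and the flow expression of edge vectors -/

/-- `P` is a directed walk whose first edge is `e` and which ends at `b_j`. -/
def IsWalk (e : E) (j : Fin n) (P : List E) : Prop :=
  P.head? = some e ∧ P.IsChain (fun a b => G.tgt a = G.src b) ∧
    ∃ f, P.getLast? = some f ∧ G.tgt f = Sum.inl j

/-- The generalized winding number of a walk. -/
def walkWind (l : ℂ) : List E → ℤ
  | [] => 0
  | [_] => 0
  | e :: f :: P => G.wind l e f + walkWind l (f :: P)

/-- The intersection number of a walk. -/
def walkInt (l : ℂ) (P : List E) : ℕ := (P.map (G.intNum l)).sum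

open Classical in
/-- Conservative flows. -/
def IsConservativeFlow (C : Finset E) : Prop :=
  (∀ v : V, (C.filter fun e => G.tgt e = Sum.inr v).card =
    (C.filter fun e => G.src e = Sum.inr v).card) ∧
  ∀ e ∈ C, ∀ i : Fin n, G.src e ≠ Sum.inl i ∧ G.tgt e ≠ Sum.inl i

open Classical in
/-- The sum of the weights of all conservative flows. -/
def flowDenominator [Fintype E] (w : E → ℝ) : ℝ :=
  ∑ C : Finset E with G.IsConservativeFlow C, ∏ e ∈ C, w e

open Classical in
/-- The signed sum of the weights of all edge flows from `e` to `b_j`.  An edge flow is the union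
of an edge loop-erased walk `P` (a walk that uses no edge twice) from `e` to `b_j` and a
conservative flow `C` without common edges with `P`; its winding and intersection numbers are
those of `P`. -/
def flowNumerator [Fintype E] (l : ℂ) (w : E → ℝ) (e : E) (j : Fin n) : ℝ :=
  ∑ P : {P : List E // P.Nodup} with G.IsWalk e j P.1,
    ∑ C : Finset E with G.IsConservativeFlow C ∧ ∀ f ∈ C, f ∉ P.1,
      (-1 : ℝ) ^ (G.walkWind l P.1 + (G.walkInt l P.1 : ℤ)) * ((P.1.map w).prod * ∏ f ∈ C, w f)

open Classical in
/-- The flow expression of the edge vectors. -/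
def flowVector [Fintype E] (l : ℂ) (w : E → ℝ) (e : E) : Fin n → ℝ := fun j =>
  if G.IsSource j then 0 else G.flowNumerator l w e j / G.flowDenominator w

/-! ### The boundary measurement matrix -/

/-- The total angle by which a polygonal line turns, from the list of its successive directions;
counterclockwise turns are positive. -/
def turning : List ℂ → ℝ
  | [] => 0
  | [_] => 0
  | a :: b :: L => Complex.arg (b / a) + turning (b :: L)

/-- The topological winding index of a walk `P` from `b_i` to `b_j`: the signed number of full
counterclockwise turns of the tangent vector, where near `b_i` and `b_j` the walk is bent so that
its initial and its final tangent vectors have the same direction, from `b_i` towards `b_j`.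
(The quotient that is rounded is an integer.) -/
def windingIndex (i j : Fin n) (P : List E) : ℤ :=
  round (turning ((G.pos (Sum.inl j) - G.pos (Sum.inl i)) :: P.map G.dir ++
    [G.pos (Sum.inl j) - G.pos (Sum.inl i)]) / (2 * Real.pi))

open Classical in
/-- The formal boundary measurement `∑ (-1) ^ wind(P) w(P)`, summed over all directed walks from
`b_i` to `b_j`, as a formal power series in the edge weights: the coefficient of the monomial with
exponents `d` collects the walks that pass each edge `e` exactly `d e` times. -/
def formalMeasurement (i j : Fin n) : MvPowerSeries E ℝ := fun d =>
  ∑ P ∈ (Finsupp.toMultiset d).lists.toFinset with ∃ e, G.src e = Sum.inl i ∧ G.IsWalk e j P,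
    (-1 : ℝ) ^ G.windingIndex i j P

/-- `m` is the boundary measurement `M_ij` at the weights `w`: the formal boundary measurement sums
up to a subtraction-free rational expression `p / q`, and `m` is its value at `w`. -/
def IsBoundaryMeasurement (w : E → ℝ) (i j : Fin n) (m : ℝ) : Prop :=
  ∃ p q : MvPolynomial E ℝ, (∀ d, 0 ≤ p.coeff d) ∧ (∀ d, 0 ≤ q.coeff d) ∧ q ≠ 0 ∧
    (q : MvPowerSeries E ℝ) * G.formalMeasurement i j = (p : MvPowerSeries E ℝ) ∧
    m = MvPolynomial.eval w p / MvPolynomial.eval w q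

/-- The number of boundary sources strictly between `i` and `j`. -/
def sourcesBetween (i j : Fin n) : ℕ := {s | G.IsSource s ∧ min i j < s ∧ s < max i j}.ncard

open Classical in
/-- `A` is the boundary measurement matrix of the network with respect to the base `I`; its rows
are indexed by `I`, in increasing order. -/
def IsBoundaryMeasurementMatrix (w : E → ℝ) (A : Matrix {i : Fin n // G.IsSource i} (Fin n) ℝ) :
    Prop :=
  (∀ r (i : Fin n), G.IsSource i → A r i = if r.1 = i then 1 else 0) ∧
  ∀ r (j : Fin n), ¬ G.IsSource j →
    ∃ m, G.IsBoundaryMeasurement w r.1 j m ∧ A r j = (-1) ^ G.sourcesBetween r.1 j * m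

end

end PlanarPerfectGraph

namespace PlanarPerfectGraph

/-! ### Expansion of the inverse of `1 - N` over paths without repetition -/

section PathExpansion

variable {E R : Type*} [CommRing R]

/-! The edge vector relations together with the boundary conditions form one linear system `x = N x
+ b`, where `N` is `flowMatrix`, indexed by edges. Passing to half-edge vectors multiplies each `X
e` by one nonzero scalar at either end of `e`; the signature is the quotient of these scalars
(`srcCoeff_eq`), so equivalence, rank and uniqueness all reduce to `1 - N`.

In the Leibniz expansion of `det (1 - N)` only permutations that move edges to consecutive edges
survive. Perfectness makes their cycles simple closed polygons. Such a polygon has odd winding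
number (`IsFlowPerm.sum_wind_of_isCycle`) and meets the rays evenly (`IsFlowPerm.sum_intNum`), which
exactly cancels the sign of the cycle. Hence the determinant, also after deleting rows of `N`, is
the unsigned sum over conservative flows (`det_one_sub_zeroRows`): it is positive, and the solution
is unique. A Cramer-type expansion (`det_mul_solution`) writes the solution as a sum over
edge-simple walks times these smaller determinants, which is the flow expression.

For the boundary measurements the same system is solved over power series with the variables as
weights; its solution is the generating function of all walks (`formalSolution_eq`). Two parity
facts finish the proof. For any walk from source to sink, `wind + int` is congruent to the
topological winding index plus the number of sources in between (`walk_parity`); for an edge-simple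
walk the topological index drops out (`walk_parity_of_nodup`). So the formal series is a quotient of
unsigned flow sums.

The planar input is a mod 2 version of Hopf's proof of the Umlaufsatz. After a rotation taking `l`
to the vertical, `wind` counts crossings of the upward ray by the direction of the walk. The
directions are deformed through secants of the polygonal line to secants with a fixed end
(`crossing_arc`); a half-plane argument evaluates the latter. -/

/-- The weight of a list of indices: the product of the entries of `N` at consecutive indices, times
the entry of `b` at the last one. -/
def pathWeight (N : Matrix E E R) (b : E → R) : List E → R
  | [] => 0
  | [e] => b e
  | e :: f :: P => N e f * pathWeight N b (f :: P)

theorem sum_head_option [Fintype E] [DecidableEq E] {M : Type*} [AddCommMonoid M]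
    (T : Finset (List E)) (φ : List E → M) :
    ∑ P ∈ T, φ P = (if [] ∈ T then φ [] else 0) + ∑ g, ∑ P ∈ T with P.head? = some g, φ P := by
  rw [← Finset.sum_fiberwise T (fun P => P.head?) φ, Fintype.sum_option]
  congr 1
  have : (T.filter fun P => P.head? = none) = T.filter fun P => [] = P := by
    refine Finset.filter_congr fun P _ => ?_
    rw [List.head?_eq_none_iff, eq_comm]
  rw [this, Finset.sum_filter, Finset.sum_ite_eq]

open Classical in
/-- The lists without repetition that avoid `S`. -/
noncomputable def nodupLists [Fintype E] (S : Finset E) : Finset (List E) :=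
  ((Finset.univ : Finset {P : List E // P.Nodup}).image Subtype.val).filter fun P => ∀ f ∈ P, f ∉ S

open Classical in
theorem mem_nodupLists [Fintype E] {S : Finset E} {P : List E} :
    P ∈ nodupLists S ↔ P.Nodup ∧ ∀ f ∈ P, f ∉ S := by
  simp [nodupLists]

open Classical in
-- Removing the first entry `e` turns it into a forbidden index for the rest; this drives the
-- induction on the complement of `S`.
theorem sum_nodupLists_head [Fintype E] {M : Type*} [AddCommMonoid M] {S : Finset E} {e : E}
    (he : e ∉ S) (φ : List E → M) :
    ∑ P ∈ nodupLists S with P.head? = some e, φ P = ∑ P ∈ nodupLists (insert e S), φ (e :: P) := by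
  have : (nodupLists S).filter (fun P => P.head? = some e) =
      (nodupLists (insert e S)).image (List.cons e) := by
    ext P
    simp only [Finset.mem_filter, mem_nodupLists, Finset.mem_image]
    constructor
    · rintro ⟨⟨h1, h2⟩, h3⟩
      obtain ⟨P', rfl⟩ := List.head?_eq_some_iff.1 h3
      refine ⟨P', ⟨(List.nodup_cons.1 h1).2, fun f hf hfS => ?_⟩, rfl⟩
      rcases Finset.mem_insert.1 hfS with rfl | h
      · exact (List.nodup_cons.1 h1).1 hf
      · exact h2 f (List.mem_cons_of_mem _ hf) h
    · rintro ⟨P', ⟨h1, h2⟩, rfl⟩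
      refine ⟨⟨List.nodup_cons.2 ⟨fun h => h2 e h (Finset.mem_insert_self _ _), h1⟩, ?_⟩, rfl⟩
      intro f hf
      rcases List.mem_cons.1 hf with rfl | h
      · exact he
      · exact fun hS => h2 f h (Finset.mem_insert_of_mem hS)
  rw [this, Finset.sum_image fun _ _ _ _ h => (List.cons.inj h).2]

/-- The matrix `N` with the rows in `S` replaced by zero. -/
def zeroRows [DecidableEq E] (N : Matrix E E R) (S : Finset E) : Matrix E E R :=
  Matrix.of fun e f => if e ∈ S then 0 else N e f

theorem zeroRows_empty [DecidableEq E] (N : Matrix E E R) : zeroRows N ∅ = N := by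
  ext; simp [zeroRows]

theorem one_sub_zeroRows_mulVec [Fintype E] [DecidableEq E] (N : Matrix E E R) (S : Finset E)
    (x : E → R) (e : E) : ((1 - zeroRows N S).mulVec x) e =
      x e - if e ∈ S then 0 else ∑ g, N e g * x g := by
  rw [Matrix.sub_mulVec, Matrix.one_mulVec, Pi.sub_apply]
  congr 1
  by_cases h : e ∈ S <;> simp [Matrix.mulVec, dotProduct, zeroRows, h]

open Classical in
-- Forbidding `e` as well gives a smaller system with solution `x'`. Expanding the determinant along
-- row `e` expresses `x e` through `x'`, and the induction hypothesis for `x'` appends `e` in front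
-- of the lists. Invertibility for every `S` is what makes `x'` available.
theorem det_mul_solution_avoiding [Fintype E] (N : Matrix E E R) (b : E → R)
    (hD : ∀ S : Finset E, IsUnit (1 - zeroRows N S).det) (k : ℕ) :
    ∀ (S : Finset E), Sᶜ.card = k → ∀ x : E → R, (∀ e ∈ S, x e = 0) →
      (∀ e ∉ S, x e = ∑ g, N e g * x g + b e) → ∀ e ∉ S,
      (1 - zeroRows N S).det * x e = ∑ P ∈ nodupLists S with P.head? = some e,
        pathWeight N b P * (1 - zeroRows N (S ∪ P.toFinset)).det := by
  induction k with
  | zero =>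
    intro S hS x _ _ e he
    rw [Finset.card_eq_zero] at hS
    exact absurd (Finset.mem_compl.2 he) (by simp [hS])
  | succ k ih =>
    intro S hS x hx0 hx e he
    set S' := insert e S with hS'
    have hS'c : S'ᶜ.card = k := by
      have : Sᶜ.card = S'ᶜ.card + 1 := by
        rw [hS', Finset.compl_insert, Finset.card_erase_add_one (Finset.mem_compl.2 he)]
      omega
    set B := 1 - zeroRows N S' with hB
    set A := 1 - zeroRows N S with hA
    let c : E → R := fun g => if g ∈ S' then 0 else b g
    set x' : E → R := B⁻¹.mulVec c with hx'
    have hBx' : B.mulVec x' = c := by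
      rw [hx', Matrix.mulVec_mulVec, Matrix.mul_nonsing_inv _ (hD S'), Matrix.one_mulVec]
    have hx'0 : ∀ g ∈ S', x' g = 0 := by
      intro g hg
      have := congrFun hBx' g
      rw [hB, one_sub_zeroRows_mulVec] at this
      simpa [hg, c] using this
    have hx'1 : ∀ g ∉ S', x' g = ∑ h, N g h * x' h + b g := by
      intro g hg
      have := congrFun hBx' g
      rw [hB, one_sub_zeroRows_mulVec] at this
      simp only [hg, if_false, c] at this
      rw [← this]; ring
    have hIH := ih S' hS'c x' hx'0 hx'1
    -- Row `e` of `B` is a row of the identity, and in all other rows `x` and `x'` satisfy the same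
    -- equation.
    have hdiff : B.mulVec (x - x') = Pi.single e (x e) := by
      ext g
      rw [hB, one_sub_zeroRows_mulVec]
      by_cases hge : g = e
      · subst hge
        simp [hS', hx'0 g (Finset.mem_insert_self _ _)]
      · by_cases hgS : g ∈ S
        · have : g ∈ S' := Finset.mem_insert_of_mem hgS
          simp [this, hge, hx0 g hgS, hx'0 g this]
        · have hg' : g ∉ S' := by simp [hS', hge, hgS]
          simp only [hg', if_false, Pi.sub_apply, mul_sub, Finset.sum_sub_distrib, Pi.single_apply,
            hge]
          rw [hx g hgS, hx'1 g hg']; ring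
    have hadj : ∀ g, B.det * (x - x') g = x e * B.adjugate g e := by
      intro g
      have := congrArg B.adjugate.mulVec hdiff
      rw [Matrix.mulVec_mulVec, Matrix.adjugate_mul, Matrix.smul_mulVec, Matrix.one_mulVec] at this
      have h2 := congrFun this g
      rw [Matrix.mulVec_single] at h2
      simpa [mul_comm] using h2
    -- `A` and `B` differ only in row `e`, which these cofactors do not see.
    have hadjAB : ∀ g, A.adjugate g e = B.adjugate g e := by
      intro g
      rw [Matrix.adjugate_apply, Matrix.adjugate_apply]
      congr 1
      ext r s
      by_cases hr : r = e
      · subst hr; simp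
      · simp [hr, hA, hB, zeroRows, hS']
    have hdet : A.det * x e = B.det * (∑ g, N e g * x' g + b e) := by
      rw [Matrix.det_eq_sum_mul_adjugate_row A e, Finset.sum_mul]
      have h1 : ∀ g, A e g * A.adjugate g e * x e = B.det * (A e g * (x - x') g) := by
        intro g
        rw [hadjAB]
        linear_combination (-A e g) * hadj g
      rw [Finset.sum_congr rfl fun g _ => h1 g, ← Finset.mul_sum]
      congr 1
      have h2 := one_sub_zeroRows_mulVec N S (x - x') e
      simp only [he, if_false] at h2
      change A.mulVec (x - x') e = _
      rw [h2]
      simp only [Pi.sub_apply, mul_sub, Finset.sum_sub_distrib,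
        hx'0 e (Finset.mem_insert_self _ _)]
      rw [hx e he]; ring
    rw [hdet, sum_nodupLists_head he, ← hS',
      sum_head_option, if_pos (mem_nodupLists.2 ⟨List.nodup_nil, by simp⟩), mul_add, add_comm]
    congr 1
    · simp only [pathWeight, List.toFinset_cons, List.toFinset_nil]
      rw [mul_comm, hB, hS']
      congr 4
      ext; simp
    · rw [Finset.mul_sum]
      refine Finset.sum_congr rfl fun g _ => ?_
      by_cases hg : g ∈ S'
      · rw [hx'0 g hg, Finset.sum_eq_zero]
        · ring
        · intro P hP
          rw [Finset.mem_filter, mem_nodupLists] at hP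
          exact absurd hg (hP.1.2 g (List.mem_of_mem_head? hP.2))
      · have h3 := hIH g hg
        rw [show B.det * (N e g * x' g) = N e g * (B.det * x' g) by ring, hB, h3, Finset.mul_sum]
        refine Finset.sum_congr rfl fun P hP => ?_
        obtain ⟨P', rfl⟩ := List.head?_eq_some_iff.1 (Finset.mem_filter.1 hP).2
        rw [pathWeight, ← mul_assoc]
        congr 4
        ext f; simp [hS']; tauto

open Classical in
/-- The solution of `x = N x + b` is a sum over the lists without repetition. -/
theorem det_mul_solution [Fintype E] (N : Matrix E E R) (b : E → R)
    (hD : ∀ S : Finset E, IsUnit (1 - zeroRows N S).det) (x : E → R)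
    (hx : ∀ e, x e = ∑ g, N e g * x g + b e) (e : E) :
    (1 - zeroRows N ∅).det * x e = ∑ P : {P : List E // P.Nodup} with P.1.head? = some e,
        pathWeight N b P.1 * (1 - zeroRows N P.1.toFinset).det := by
  rw [det_mul_solution_avoiding N b hD _ ∅ rfl x (by simp) (fun e _ => hx e) e (by simp),
    Finset.sum_filter, Finset.sum_filter]
  simp only [nodupLists, Finset.notMem_empty, not_false_eq_true, implies_true, Finset.filter_true,
    Finset.empty_union]
  rw [Finset.sum_image fun _ _ _ _ h => Subtype.ext h]

end PathExpansion

end PlanarPerfectGraph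

namespace PlanarPerfectGraph

/-! ### Crossings of the vertical ray by a sequence of vectors -/

section Crossing

/-- The vector `v` points to the right (vertical vectors: if it points upwards). -/
def Rightward (v : ℂ) : Prop := 0 < v.re ∨ v.re = 0 ∧ 0 < v.im

/-- The determinant of two plane vectors. -/
def cross (a b : ℂ) : ℝ := a.re * b.im - a.im * b.re

open Classical in
/-- The parity of the crossings of the upward vertical ray when turning from `a` to `b`. -/
noncomputable def crossing (a b : ℂ) : ZMod 2 :=
  if (Rightward a ↔ Rightward b) then 0
  else if Rightward a then (if 0 < cross a b then 1 else 0) else (if cross a b < 0 then 1 else 0)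

open Classical in
/-- Whether two vectors point to different sides. -/
noncomputable def sideChange (a b : ℂ) : ZMod 2 := if (Rightward a ↔ Rightward b) then 0 else 1

theorem Rightward.add {a b : ℂ} (ha : Rightward a) (hb : Rightward b) : Rightward (a + b) := by
  unfold Rightward at *
  simp only [Complex.add_re, Complex.add_im]
  rcases ha with ha | ⟨ha, ha'⟩ <;> rcases hb with hb | ⟨hb, hb'⟩
  · left; linarith
  · left; linarith
  · left; linarith
  · right; constructor <;> linarith

theorem not_rightward_iff {a : ℂ} : ¬ Rightward a ↔ a.re < 0 ∨ a.re = 0 ∧ a.im ≤ 0 := by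
  unfold Rightward
  push Not
  constructor
  · rintro ⟨h1, h2⟩
    rcases h1.lt_or_eq with h | h
    · exact Or.inl h
    · exact Or.inr ⟨h, h2 h⟩
  · rintro (h | ⟨h, h'⟩)
    · exact ⟨h.le, fun h' => absurd h' h.ne⟩
    · exact ⟨h.le, fun _ => h'⟩

theorem not_rightward_add {a b : ℂ} (ha : ¬ Rightward a) (hb : ¬ Rightward b) :
    ¬ Rightward (a + b) := by
  rw [not_rightward_iff] at *
  simp only [Complex.add_re, Complex.add_im]
  rcases ha with ha | ⟨ha, ha'⟩ <;> rcases hb with hb | ⟨hb, hb'⟩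
  · left; linarith
  · left; linarith
  · left; linarith
  · right; constructor <;> linarith

theorem rightward_neg {a : ℂ} (ha : a ≠ 0) : Rightward (-a) ↔ ¬ Rightward a := by
  rw [not_rightward_iff]
  unfold Rightward
  simp only [Complex.neg_re, Complex.neg_im]
  constructor
  · rintro (h | ⟨h, h'⟩)
    · left; linarith
    · right; constructor <;> linarith
  · rintro (h | ⟨h, h'⟩)
    · left; linarith
    · right
      refine ⟨by linarith, ?_⟩
      rcases h'.lt_or_eq with h' | h'
      · linarith
      · exact absurd (Complex.ext h h') ha

theorem zmod_two_add_self (x : ZMod 2) : x + x = 0 := CharTwo.add_self_eq_zero x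

/-- The three determinants coincide. If `a` and `b` are on different sides, exactly one of the two
partial turns changes side and is tested by the same sign; otherwise `a + b` stays on their common
side. -/
theorem crossing_triangle (a b : ℂ) :
    crossing a b = crossing a (a + b) + crossing (a + b) b := by
  have h1 : cross a (a + b) = cross a b := by simp [cross]; ring
  have h2 : cross (a + b) b = cross a b := by simp [cross]; ring
  unfold crossing
  rw [h1, h2]
  by_cases ha : Rightward a <;> by_cases hb : Rightward b
  · simp [ha, hb, ha.add hb]
  · by_cases hc : Rightward (a + b) <;> simp [ha, hb, hc]
  · by_cases hc : Rightward (a + b) <;> simp [ha, hb, hc]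
  · simp [ha, hb, not_rightward_add ha hb]

theorem sideChange_trans (a b c : ℂ) : sideChange a c = sideChange a b + sideChange b c := by
  unfold sideChange
  by_cases ha : Rightward a <;> by_cases hb : Rightward b <;> by_cases hc : Rightward c <;>
    simp [ha, hb, hc, zmod_two_add_self]

theorem sideChange_comm (a b : ℂ) : sideChange a b = sideChange b a := by
  by_cases ha : Rightward a <;> by_cases hb : Rightward b <;> simp [sideChange, ha, hb]

/-- With `u`, `v` the values of the functional at `a`, `b`, one has `β * cross a b = a.re * v - b.re
* u`. Here `b.re < 0`: a nonzero `b` on the vertical that is not rightward points down, where the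
functional is negative. -/
theorem cross_pos_of_upper {α β : ℝ} (hβ : 0 < β) {a b : ℂ} (ha : 0 ≤ α * a.re + β * a.im)
    (hb : 0 ≤ α * b.re + β * b.im) (hab : 0 < (α * a.re + β * a.im) + (α * b.re + β * b.im))
    (hb0 : b ≠ 0) (hRa : Rightward a) (hRb : ¬ Rightward b) : 0 < cross a b := by
  rw [not_rightward_iff] at hRb
  unfold Rightward at hRa
  have hb1 : b.re < 0 := by
    rcases hRb with h | ⟨h, h'⟩
    · exact h
    · exfalso
      rw [h] at hb
      have : b.im = 0 := by nlinarith
      exact hb0 (Complex.ext h this)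
  set u := α * a.re + β * a.im with hu
  set v := α * b.re + β * b.im with hv
  have key : β * cross a b = a.re * v - b.re * u := by simp only [cross, hu, hv]; ring
  have : 0 < β * cross a b := by
    rw [key]
    rcases hRa with h1 | ⟨h1, h1'⟩
    · rcases ha.lt_or_eq with h | h
      · nlinarith [mul_pos_of_neg_of_neg hb1 (neg_lt_zero.2 h), mul_nonneg h1.le hb]
      · have : 0 < v := by linarith
        rw [← h]; nlinarith [mul_pos h1 this]
    · have : 0 < u := by rw [hu, h1]; nlinarith [mul_pos hβ h1']
      rw [h1]; nlinarith [mul_pos_of_neg_of_neg hb1 (neg_lt_zero.2 this)]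
  exact (mul_pos_iff_of_pos_left hβ).1 this

theorem cross_swap (a b : ℂ) : cross b a = -cross a b := by simp [cross]; ring

theorem cross_neg_neg (a b : ℂ) : cross (-a) (-b) = cross a b := by simp [cross]

/-- In a half-plane that contains the upward vertical ray, crossings are changes of side. -/
theorem crossing_of_upper {α β : ℝ} (hβ : 0 < β) {a b : ℂ} (ha : 0 ≤ α * a.re + β * a.im)
    (hb : 0 ≤ α * b.re + β * b.im) (hab : 0 < (α * a.re + β * a.im) + (α * b.re + β * b.im))
    (ha0 : a ≠ 0) (hb0 : b ≠ 0) : crossing a b = sideChange a b := by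
  unfold crossing sideChange
  by_cases hRa : Rightward a <;> by_cases hRb : Rightward b
  · simp [hRa, hRb]
  · simp [hRa, hRb, cross_pos_of_upper hβ ha hb hab hb0 hRa hRb]
  · have := cross_pos_of_upper hβ hb ha (by linarith) ha0 hRb hRa
    rw [cross_swap] at this
    simp [hRa, hRb, neg_pos.1 this]
  · simp [hRa, hRb]

/-- In a half-plane that contains the downward vertical ray, there are no crossings. -/
theorem crossing_of_lower {α β : ℝ} (hβ : β < 0) {a b : ℂ} (ha : 0 ≤ α * a.re + β * a.im)
    (hb : 0 ≤ α * b.re + β * b.im) (hab : 0 < (α * a.re + β * a.im) + (α * b.re + β * b.im))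
    (ha0 : a ≠ 0) (hb0 : b ≠ 0) : crossing a b = 0 := by
  have h (c : ℂ) : -α * (-c).re + -β * (-c).im = α * c.re + β * c.im := by simp
  have hβ' : 0 < -β := by linarith
  unfold crossing
  by_cases hRa : Rightward a <;> by_cases hRb : Rightward b
  · simp [hRa, hRb]
  · have := cross_pos_of_upper (a := -b) (b := -a) hβ' (by rwa [h]) (by rwa [h])
      (by rw [h, h]; linarith) (neg_ne_zero.2 ha0) ((rightward_neg hb0).2 hRb)
      (fun h => (rightward_neg ha0).1 h hRa)
    rw [cross_neg_neg, cross_swap] at this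
    simp [hRa, hRb, (neg_pos.1 this).le]
  · have := cross_pos_of_upper (a := -a) (b := -b) hβ' (by rwa [h]) (by rwa [h])
      (by rwa [h, h]) (neg_ne_zero.2 hb0) ((rightward_neg ha0).2 hRa)
      (fun h => (rightward_neg hb0).1 h hRb)
    rw [cross_neg_neg] at this
    simp [hRa, hRb, this.le]
  · simp [hRa, hRb]

/-- Crossings within an open half-plane depend only on the sides. -/
theorem exists_crossing_eq_mul_sideChange (α β : ℝ) : ∃ κ : ZMod 2, ∀ a b : ℂ,
    0 < α * a.re + β * a.im → 0 < α * b.re + β * b.im → crossing a b = κ * sideChange a b := by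
  have hne : ∀ a : ℂ, 0 < α * a.re + β * a.im → a ≠ 0 := by
    rintro a h rfl; simp at h
  -- The factor is 1 if the half-plane contains the upward ray and 0 if it contains the downward
  -- one. For `β = 0` the half-plane lies on one side, and any factor would do.
  rcases lt_trichotomy β 0 with hβ | hβ | hβ
  · refine ⟨0, fun a b ha hb => ?_⟩
    rw [crossing_of_lower hβ ha.le hb.le (by linarith) (hne a ha) (hne b hb), zero_mul]
  · refine ⟨0, fun a b ha hb => ?_⟩
    rw [zero_mul]
    subst hβ
    simp only [zero_mul, add_zero] at ha hb
    have : Rightward a ↔ Rightward b := by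
      unfold Rightward
      rcases lt_trichotomy α 0 with h | h | h
      · have h1 : a.re < 0 := by nlinarith
        have h2 : b.re < 0 := by nlinarith
        simp [h1.not_gt, h1.ne, h2.not_gt, h2.ne]
      · simp [h] at ha
      · simp [(mul_pos_iff_of_pos_left h).1 ha, (mul_pos_iff_of_pos_left h).1 hb]
    simp [crossing, this]
  · refine ⟨1, fun a b ha hb => ?_⟩
    rw [crossing_of_upper hβ ha.le hb.le (by linarith) (hne a ha) (hne b hb), one_mul]

/-- No crossings are counted around the parallelogram of the differences of two disjoint
segments. -/
theorem crossing_parallelogram {p p' q q' : ℂ} (h : Disjoint (segment ℝ p p') (segment ℝ q q')) :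
    crossing (q - p) (q - p') + crossing (q - p') (q' - p') =
      crossing (q - p) (q' - p) + crossing (q' - p) (q' - p') := by
  have hc (x y : ℂ) : IsCompact (segment ℝ x y) := by
    rw [segment_eq_image_lineMap]
    exact isCompact_Icc.image AffineMap.lineMap_continuous
  obtain ⟨f, u, v, hu, huv, hv⟩ := geometric_hahn_banach_compact_closed (convex_segment p p')
    (hc _ _) (convex_segment q q') (hc _ _).isClosed h
  have hf (z : ℂ) : f z = f 1 * z.re + f Complex.I * z.im := by
    conv_lhs => rw [show z = z.re • (1 : ℂ) + z.im • Complex.I by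
      simp [Complex.re_add_im]]
    rw [map_add, map_smul, map_smul, smul_eq_mul, smul_eq_mul]; ring
  obtain ⟨κ, hκ⟩ := exists_crossing_eq_mul_sideChange (f 1) (f Complex.I)
  have hpos (x y : ℂ) (hx : x ∈ segment ℝ p p') (hy : y ∈ segment ℝ q q') :
      0 < f 1 * (y - x).re + f Complex.I * (y - x).im := by
    rw [← hf, map_sub]; linarith [hu x hx, hv y hy]
  have h1 := hpos p q (left_mem_segment _ _ _) (left_mem_segment _ _ _)
  have h2 := hpos p' q (right_mem_segment _ _ _) (left_mem_segment _ _ _)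
  have h3 := hpos p' q' (right_mem_segment _ _ _) (right_mem_segment _ _ _)
  have h4 := hpos p q' (left_mem_segment _ _ _) (right_mem_segment _ _ _)
  rw [hκ _ _ h1 h2, hκ _ _ h2 h3, hκ _ _ h1 h4, hκ _ _ h4 h3, ← mul_add, ← mul_add,
    ← sideChange_trans, ← sideChange_trans]

/-! ### The secant map of a polygonal line -/

variable (p : ℕ → ℂ)

/-- On the grid of secants, indexed by tail and head, this adds the parallelogram identities of one
row of cells, with the head moving from `j` to `j + 1`; inner edges cancel. The row stops at tail `j
- 1`, because the next segment shares the point `p j` with the segment `j`. -/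
theorem crossing_strip {i j : ℕ} (hij : i < j)
    (h : ∀ s, i ≤ s → s + 1 < j →
      Disjoint (segment ℝ (p s) (p (s + 1))) (segment ℝ (p j) (p (j + 1)))) :
    ∑ s ∈ Finset.Ico i (j - 1), crossing (p j - p s) (p j - p (s + 1)) +
        crossing (p j - p (j - 1)) (p (j + 1) - p (j - 1)) =
      crossing (p j - p i) (p (j + 1) - p i) +
        ∑ s ∈ Finset.Ico i (j - 1), crossing (p (j + 1) - p s) (p (j + 1) - p (s + 1)) := by
  obtain ⟨k, rfl⟩ : ∃ k, j = i + 1 + k := ⟨j - (i + 1), by omega⟩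
  have key : ∀ t ≤ k, ∑ s ∈ Finset.Ico i (i + t),
        crossing (p (i + 1 + k) - p s) (p (i + 1 + k) - p (s + 1)) +
        crossing (p (i + 1 + k) - p (i + t)) (p (i + 1 + k + 1) - p (i + t)) =
      crossing (p (i + 1 + k) - p i) (p (i + 1 + k + 1) - p i) +
        ∑ s ∈ Finset.Ico i (i + t),
          crossing (p (i + 1 + k + 1) - p s) (p (i + 1 + k + 1) - p (s + 1)) := by
    intro t
    induction t with
    | zero => simp
    | succ t ih =>
      intro ht
      have h1 := ih (by omega)
      have h2 := crossing_parallelogram (h (i + t) (by omega) (by omega))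
      rw [← add_assoc i t 1, Finset.sum_Ico_succ_top (by omega), Finset.sum_Ico_succ_top (by omega)]
      linear_combination h1 + h2
  have := key k le_rfl
  rwa [show i + k = i + 1 + k - 1 by omega] at this

/-- The crossings of the directions of a simple polygonal line, in terms of the secants from its
initial point and to its final point. -/
theorem crossing_arc (m : ℕ)
    (h : ∀ i j, i + 1 < j → j ≤ m →
      Disjoint (segment ℝ (p i) (p (i + 1))) (segment ℝ (p j) (p (j + 1)))) :
    ∑ k ∈ Finset.range m, crossing (p (k + 1) - p k) (p (k + 2) - p (k + 1)) =
      ∑ t ∈ Finset.Ico 1 (m + 1), crossing (p t - p 0) (p (t + 1) - p 0) +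
        ∑ s ∈ Finset.range m, crossing (p (m + 1) - p s) (p (m + 1) - p (s + 1)) := by
  induction m with
  | zero => simp
  | succ m ih =>
    have h1 := ih fun i j hij hj => h i j hij (by omega)
    -- One more row is added to the triangle of secants; the triangle identity `h3` handles the cell
    -- at the diagonal, where two consecutive directions add up to a secant.
    have h2 := crossing_strip p (i := 0) (j := m + 1) (by omega)
      fun s _ hs => h s (m + 1) hs le_rfl
    have h3 := crossing_triangle (p (m + 1) - p m) (p (m + 2) - p (m + 1))
    rw [show p (m + 1) - p m + (p (m + 2) - p (m + 1)) = p (m + 2) - p m by ring] at h3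
    rw [Finset.sum_range_succ, h1, Finset.sum_Ico_succ_top (show 1 ≤ m + 1 by omega),
      Finset.sum_range_succ _ m, h3]
    rw [Nat.Ico_zero_eq_range] at h2
    simp only [Nat.add_sub_cancel] at h2
    linear_combination h2

theorem sum_sideChange (d : ℕ → ℂ) {a b : ℕ} (hab : a ≤ b) :
    ∑ t ∈ Finset.Ico a b, sideChange (d t) (d (t + 1)) = sideChange (d a) (d b) := by
  induction b, hab using Nat.le_induction with
  | base => simp [sideChange]
  | succ b hb ih => rw [Finset.sum_Ico_succ_top hb, ih, ← sideChange_trans]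

/-- The crossings along a simple polygonal line in a half-plane, with both ends on the boundary of
the half-plane. -/
theorem crossing_arc_upper {α β : ℝ} (hβ : 0 < β) (m : ℕ)
    (h : ∀ i j, i + 1 < j → j ≤ m →
      Disjoint (segment ℝ (p i) (p (i + 1))) (segment ℝ (p j) (p (j + 1))))
    (hu : ∀ k, 0 < k → k < m + 1 → 0 < α * (p k - p 0).re + β * (p k - p 0).im)
    (hend : α * (p (m + 1) - p 0).re + β * (p (m + 1) - p 0).im = 0) (hne : p (m + 1) ≠ p 0) :
    ∑ k ∈ Finset.range m, crossing (p (k + 1) - p k) (p (k + 2) - p (k + 1)) =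
      sideChange (p 1 - p 0) (p (m + 1) - p 0) := by
  have hne0 : ∀ k, 0 < k → k < m + 1 → p k - p 0 ≠ 0 := fun k hk hk' h0 => by
    have := hu k hk hk'
    simp [h0] at this
  have hu' : ∀ k, 0 < k → k < m + 1 →
      0 < -α * (p (m + 1) - p k).re + -β * (p (m + 1) - p k).im := fun k hk hk' => by
    have := hu k hk hk'
    simp only [Complex.sub_re, Complex.sub_im] at this hend ⊢
    linarith
  have hne1 : ∀ k, 0 < k → k < m + 1 → p (m + 1) - p k ≠ 0 := fun k hk hk' h0 => by
    have := hu' k hk hk'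
    simp [h0] at this
  have hend' : -α * (p (m + 1) - p 0).re + -β * (p (m + 1) - p 0).im = 0 := by linarith
  -- Secants from the initial point stay in the upper half-plane, where crossings are side changes
  -- and telescope. Secants to the final point stay in the opposite half-plane and contribute
  -- nothing.
  rw [crossing_arc p m h, ← sum_sideChange (fun t => p t - p 0) (show 1 ≤ m + 1 by omega),
    Finset.sum_eq_zero (s := Finset.range m), add_zero]
  · refine Finset.sum_congr rfl fun t ht => ?_
    rw [Finset.mem_Ico] at ht
    have h1 := hu t (by omega) (by omega)
    have h0 := hne0 t (by omega) (by omega)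
    rcases (show t + 1 ≤ m + 1 by omega).lt_or_eq with h2 | h2
    · have h3 := hu (t + 1) (by omega) h2
      exact crossing_of_upper hβ h1.le h3.le (by linarith) h0 (hne0 _ (by omega) h2)
    · rw [h2]
      exact crossing_of_upper hβ h1.le hend.ge (by linarith) h0 (sub_ne_zero.2 hne)
  · intro s hs
    rw [Finset.mem_range] at hs
    have h1 := hu' (s + 1) (by omega) (by omega)
    have h0 := hne1 (s + 1) (by omega) (by omega)
    rcases s.eq_zero_or_pos with rfl | h2
    · exact crossing_of_lower (neg_lt_zero.2 hβ) hend'.ge h1.le (by linarith)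
        (sub_ne_zero.2 hne) h0
    · have h3 := hu' s h2 (by omega)
      exact crossing_of_lower (neg_lt_zero.2 hβ) h3.le h1.le (by linarith)
        (hne1 s h2 (by omega)) h0

/-! ### Closed polygons based at a lowest vertex -/

/-- The vector `v` points upwards (horizontal vectors: if it points to the right). -/
def Upward (v : ℂ) : Prop := 0 < v.im ∨ v.im = 0 ∧ 0 < v.re

theorem Upward.ne_zero {a : ℂ} (ha : Upward a) : a ≠ 0 := by
  rintro rfl
  simp [Upward] at ha

/-- The half-open half-plane is needed because a polygon may have several lowest vertices; relative
to the leftmost of them all others are `Upward`. -/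
theorem cross_pos_of_upward {a b : ℂ} (ha : Upward a) (hb : Upward b) (hRa : Rightward a)
    (hRb : ¬ Rightward b) : 0 < cross a b := by
  rw [not_rightward_iff] at hRb
  unfold Upward at ha hb
  unfold Rightward at hRa
  have hb1 : b.re < 0 := by
    rcases hRb with h | ⟨h, h'⟩
    · exact h
    · rcases hb with h1 | ⟨h1, h1'⟩ <;> linarith
  have hb2 : 0 < b.im := by
    rcases hb with h | ⟨h, h'⟩ <;> linarith
  unfold cross
  rcases hRa with h | ⟨h, h'⟩
  · have : 0 ≤ a.im := by rcases ha with h1 | ⟨h1, _⟩ <;> linarith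
    nlinarith [mul_pos h hb2]
  · rw [h]; nlinarith

theorem crossing_of_upward {a b : ℂ} (ha : Upward a) (hb : Upward b) :
    crossing a b = sideChange a b := by
  unfold crossing sideChange
  by_cases hRa : Rightward a <;> by_cases hRb : Rightward b
  · simp [hRa, hRb]
  · simp [hRa, hRb, cross_pos_of_upward ha hb hRa hRb]
  · have := cross_pos_of_upward hb ha hRb hRa
    rw [cross_swap] at this
    simp [hRa, hRb, neg_pos.1 this]
  · simp [hRa, hRb]

theorem crossing_neg_of_upward {a b : ℂ} (ha : Upward a) (hb : Upward b) :
    crossing (-a) (-b) = 0 := by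
  unfold crossing
  rw [rightward_neg ha.ne_zero, rightward_neg hb.ne_zero, cross_neg_neg]
  by_cases hRa : Rightward a <;> by_cases hRb : Rightward b
  · simp [hRa, hRb]
  · simp [hRa, hRb, (cross_pos_of_upward ha hb hRa hRb).le]
  · have := cross_pos_of_upward hb ha hRb hRa
    rw [cross_swap] at this
    simp [hRa, hRb, (neg_pos.1 this).le]
  · simp [hRa, hRb]

/-- For `a`, `b` on the same side, both pairs change side, in opposite directions but with equal
determinants, so exactly one is counted. On different sides only the first term survives. -/
theorem sideChange_add_crossing_neg {a b : ℂ} (ha : a ≠ 0) (hb : b ≠ 0) (hab : cross a b ≠ 0) :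
    sideChange a b + crossing a (-b) + crossing (-a) b = 1 := by
  have h1 : cross a (-b) = -cross a b := by simp [cross]; ring
  have h2 : cross (-a) b = -cross a b := by simp [cross]; ring
  unfold crossing sideChange
  rw [rightward_neg ha, rightward_neg hb, h1, h2]
  rcases lt_or_gt_of_ne hab with h | h <;> by_cases hRa : Rightward a <;>
    by_cases hRb : Rightward b <;> simp [hRa, hRb, h, h.le]

/-- The directions of a simple polygon cross the upward vertical ray an odd number of times. -/
theorem crossing_polygon (m : ℕ)
    (h : ∀ i j, i + 1 < j → j < m + 3 → ¬ (i = 0 ∧ j = m + 2) →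
      Disjoint (segment ℝ (p i) (p (i + 1))) (segment ℝ (p j) (p (j + 1))))
    (hper : p (m + 3) = p 0) (hper' : p (m + 4) = p 1)
    (hup : ∀ k, 0 < k → k < m + 3 → Upward (p k - p 0))
    (hcross : cross (p (m + 2) - p 0) (p 1 - p 0) ≠ 0) :
    ∑ k ∈ Finset.range (m + 3), crossing (p (k + 1) - p k) (p (k + 2) - p (k + 1)) = 1 := by
  -- The first and last sides share `p 0`. So the arc without the last side is deformed first, and
  -- the strip of the last side starts at tail 1.
  have h1 := crossing_arc p (m + 1) fun i j hij hj => h i j hij (by omega) (by omega)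
  have h2 := crossing_strip p (i := 1) (j := m + 2) (by omega)
    fun s hs hs' => h s (m + 2) hs' (by omega) (by omega)
  have h3 := crossing_triangle (p (m + 2) - p (m + 1)) (p (m + 3) - p (m + 2))
  have h4 := crossing_triangle (p (m + 2) - p 0) (-(p 1 - p 0))
  have h5 : ∑ s ∈ Finset.Ico 1 (m + 2), crossing (p (m + 3) - p s) (p (m + 3) - p (s + 1)) = 0 := by
    refine Finset.sum_eq_zero fun s hs => ?_
    rw [Finset.mem_Ico] at hs
    rw [hper, ← neg_sub (p s), ← neg_sub (p (s + 1))]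
    exact crossing_neg_of_upward (hup s (by omega) (by omega)) (hup (s + 1) (by omega) (by omega))
  have h6 : ∑ t ∈ Finset.Ico 1 (m + 2), crossing (p t - p 0) (p (t + 1) - p 0) =
      sideChange (p 1 - p 0) (p (m + 2) - p 0) := by
    rw [← sum_sideChange (fun t => p t - p 0) (show 1 ≤ m + 2 by omega)]
    refine Finset.sum_congr rfl fun t ht => ?_
    rw [Finset.mem_Ico] at ht
    exact crossing_of_upward (hup t (by omega) (by omega)) (hup (t + 1) (by omega) (by omega))
  -- This is the source of the odd total: the fan of secants from `p 0` gives the side change, and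
  -- the closing turns give the other two terms.
  have h7 := sideChange_add_crossing_neg (hup (m + 2) (by omega) (by omega)).ne_zero
    (hup 1 (by omega) (by omega)).ne_zero hcross
  rw [Finset.sum_Ico_succ_top (show 1 ≤ m + 1 by omega)] at h5
  rw [Finset.range_eq_Ico, Finset.sum_eq_sum_Ico_succ_bot (show 0 < m + 1 by omega)
    (fun s => crossing (p (m + 1 + 1) - p s) (p (m + 1 + 1) - p (s + 1))),
    ← Finset.range_eq_Ico, h6] at h1
  rw [Finset.sum_range_succ, Finset.sum_range_succ, h1]
  simp only [show m + 2 - 1 = m + 1 by omega, show m + 1 + 1 = m + 2 by omega,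
    show m + 2 + 1 = m + 3 by omega, show m + 2 + 2 = m + 4 by omega, zero_add] at *
  rw [show p (m + 2) - p (m + 1) + (p (m + 3) - p (m + 2)) = p (m + 3) - p (m + 1) by ring] at h3
  rw [show p (m + 2) - p 0 + -(p 1 - p 0) = p (m + 2) - p 1 by ring] at h4
  rw [h3, sideChange_comm, hper']
  rw [show p 1 - p (m + 3) = p 1 - p 0 by rw [hper],
    show p (m + 3) - p (m + 2) = -(p (m + 2) - p 0) by rw [hper]; ring]
  rw [show p (m + 3) - p 1 = -(p 1 - p 0) by rw [hper]; ring] at h2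
  rw [show p (m + 3) - p (m + 2) = -(p (m + 2) - p 0) by rw [hper]; ring] at h5
  linear_combination h2 + h7 + h5 - h4

end Crossing
end PlanarPerfectGraph

namespace PlanarPerfectGraph

/-! ### Local winding numbers of vectors -/

section Winding

open Classical in
/-- The local winding number of a pair of vectors. -/
noncomputable def vecWind (l a b : ℂ) : ℤ :=
  if orient a b = 1 ∧ orient a l = 1 ∧ orient l b = 1 then 1
  else if orient a b = -1 ∧ orient a l = -1 ∧ orient l b = -1 then -1 else 0

theorem orient_eq_one {a b : ℂ} : orient a b = 1 ↔ 0 < cross a b := by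
  unfold orient cross
  rcases lt_trichotomy (a.re * b.im - a.im * b.re) 0 with h | h | h
  · simp only [sign_neg h, h.not_gt]; decide
  · simp [h]
  · simp [h]

theorem orient_eq_neg_one {a b : ℂ} : orient a b = -1 ↔ cross a b < 0 := by
  unfold orient cross
  rcases lt_trichotomy (a.re * b.im - a.im * b.re) 0 with h | h | h
  · simp [h]
  · simp [h]
  · simp only [sign_pos h, h.not_gt]; decide

/-- `v` is not a positive multiple of `l`. -/
def NotAlong (l v : ℂ) : Prop := ∀ c : ℝ, 0 < c → v ≠ c * l

theorem exists_eq_mul_of_cross_eq_zero {l v : ℂ} (hl : l ≠ 0) (h : cross v l = 0) :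
    ∃ t : ℝ, v = t * l := by
  have hn : Complex.normSq l ≠ 0 := by simpa using hl
  refine ⟨(v.re * l.re + v.im * l.im) / Complex.normSq l, ?_⟩
  unfold cross at h
  apply Complex.ext
  · simp only [Complex.mul_re, Complex.ofReal_re, Complex.ofReal_im]
    field_simp
    rw [Complex.normSq_apply]
    linear_combination l.im * h
  · simp only [Complex.mul_im, Complex.ofReal_re, Complex.ofReal_im]
    field_simp
    rw [Complex.normSq_apply]
    linear_combination (-l.re) * h

theorem NotAlong.exists_of_cross_eq_zero {l v : ℂ} (hl : l ≠ 0) (hv : NotAlong l v)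
    (h : cross v l = 0) : ∃ t : ℝ, t ≤ 0 ∧ v = t * l := by
  obtain ⟨t, rfl⟩ := exists_eq_mul_of_cross_eq_zero hl h
  exact ⟨t, not_lt.1 fun ht => hv t ht rfl, rfl⟩

/-! ### Turning the gauge direction into the vertical; angles -/

/-- The linear map that turns `l` into the upward vertical direction. -/
noncomputable def turnUp (l v : ℂ) : ℂ := Complex.I * v / l

theorem turnUp_re (l v : ℂ) : (turnUp l v).re = cross v l / Complex.normSq l := by
  simp [turnUp, Complex.div_re, cross]; ring

theorem turnUp_im (l v : ℂ) :
    (turnUp l v).im = (v.re * l.re + v.im * l.im) / Complex.normSq l := by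
  simp [turnUp, Complex.div_im]; ring

theorem turnUp_sub (l v u : ℂ) : turnUp l (v - u) = turnUp l v - turnUp l u := by
  simp only [turnUp]; ring

theorem turnUp_ne_zero {l v : ℂ} (hl : l ≠ 0) (hv : v ≠ 0) : turnUp l v ≠ 0 := by
  simp [turnUp, hl, hv]

theorem cross_turnUp {l : ℂ} (hl : l ≠ 0) (a b : ℂ) :
    cross (turnUp l a) (turnUp l b) = cross a b / Complex.normSq l := by
  have hn : Complex.normSq l ≠ 0 := by simpa using hl
  rw [cross, turnUp_re, turnUp_re, turnUp_im, turnUp_im]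
  field_simp
  rw [Complex.normSq_apply]
  simp only [cross]
  ring

/-- A vertical vector is rightward only if it points up, that is, if `v` is along `l`, which is
excluded. -/
theorem rightward_turnUp {l v : ℂ} (hl : l ≠ 0) (hv : NotAlong l v) :
    Rightward (turnUp l v) ↔ 0 < cross v l := by
  have hn : 0 < Complex.normSq l := by simpa using hl
  unfold Rightward
  rw [turnUp_re, turnUp_im, div_pos_iff_of_pos_right hn]
  refine ⟨?_, Or.inl⟩
  rintro (h | ⟨h, h'⟩)
  · exact h
  · exfalso
    obtain ⟨t, ht, rfl⟩ := hv.exists_of_cross_eq_zero hl (by simpa [hl] using h)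
    rw [div_pos_iff_of_pos_right hn] at h'
    simp only [Complex.mul_re, Complex.mul_im, Complex.ofReal_re, Complex.ofReal_im] at h'
    rw [Complex.normSq_apply] at hn
    nlinarith

theorem cross_mul_left (t : ℝ) (a b : ℂ) : cross (t * a) b = t * cross a b := by
  simp [cross]; ring

theorem cross_mul_right (t : ℝ) (a b : ℂ) : cross a (t * b) = t * cross a b := by
  simp [cross]; ring

/-- A local winding number `±1` means that the turn from `a` to `b` sweeps over `l`. If `a` or `b`
is opposite to `l`, the sign of `cross a b` is constrained (`hza`, `hzb`) so that neither side
counts anything. -/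
theorem crossing_turnUp {l a b : ℂ} (hl : l ≠ 0) (ha : NotAlong l a) (hb : NotAlong l b) :
    crossing (turnUp l a) (turnUp l b) = (vecWind l a b : ZMod 2) := by
  have hn : 0 < Complex.normSq l := by simpa using hl
  have hneg (x : ℝ) : x / Complex.normSq l < 0 ↔ x < 0 := by rw [div_lt_iff₀ hn, zero_mul]
  unfold crossing vecWind
  simp only [orient_eq_one, orient_eq_neg_one, rightward_turnUp hl ha, rightward_turnUp hl hb,
    cross_turnUp hl, div_pos_iff_of_pos_right hn, hneg, cross_swap b l]
  have hza : cross a l = 0 → 0 < cross b l → 0 ≤ cross a b := fun h h' => by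
    obtain ⟨t, ht, rfl⟩ := ha.exists_of_cross_eq_zero hl h
    rw [cross_mul_left, cross_swap b l]; nlinarith
  have hzb : cross b l = 0 → 0 < cross a l → cross a b ≤ 0 := fun h h' => by
    obtain ⟨t, ht, rfl⟩ := hb.exists_of_cross_eq_zero hl h
    rw [cross_mul_right]; nlinarith
  rcases lt_trichotomy (cross a l) 0 with h1 | h1 | h1 <;>
    rcases lt_trichotomy (cross b l) 0 with h2 | h2 | h2
  · simp [h1.not_gt, h2.not_gt]
  · simp [h1.not_gt, h2]
  · by_cases h : cross a b < 0 <;> simp [h1, h1.not_gt, h2, h]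
  · simp [h1, h2.not_gt]
  · simp [h1, h2]
  · simp [h1, h2, hza h1 h2]
  · by_cases h : 0 < cross a b <;> simp [h1, h1.not_gt, h2, h2.not_gt, h]
  · simp [h1, h1.not_gt, h2, hzb h2 h1]
  · simp [h1, h1.not_gt, h2, h2.le]

theorem arg_pos_iff_of_lt_pi {z : ℂ} (hz : Complex.arg z < Real.pi) :
    0 < Complex.arg z ↔ 0 < z.im := by
  constructor
  · intro h
    refine lt_of_le_of_ne (Complex.arg_nonneg_iff.1 h.le) fun h0 => ?_
    rcases le_or_gt 0 z.re with h1 | h1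
    · exact h.ne' (Complex.arg_eq_zero_iff.2 ⟨h1, h0.symm⟩)
    · exact hz.ne (Complex.arg_eq_pi_iff.2 ⟨h1, h0.symm⟩)
  · intro h
    refine lt_of_le_of_ne (Complex.arg_nonneg_iff.2 h.le) fun h0 => ?_
    exact h.ne' (Complex.arg_eq_zero_iff.1 h0.symm).2

theorem div_im_eq_cross (a b : ℂ) : (b / a).im = cross a b / Complex.normSq a := by
  simp [Complex.div_im, cross]; ring

/-- The angle from the direction opposite to `l`. -/
noncomputable def angleFrom (l v : ℂ) : ℝ := Complex.arg (-v / l)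

/-- Angles measured from `-l` jump only at `l`, so the turning angle is their difference plus a full
turn each time `l` is passed. The three arguments lie strictly between `-π` and `π`, which leaves
`-1, 0, 1` as multiples of `2π`; their signs are the three orientations in `vecWind` and select the
multiple. -/
theorem arg_div_eq {l a b : ℂ} (hl : l ≠ 0) (ha0 : a ≠ 0) (hb0 : b ≠ 0) (ha : NotAlong l a)
    (hb : NotAlong l b) (hab : NotAlong (-a) b) :
    Complex.arg (b / a) = angleFrom l b - angleFrom l a + 2 * Real.pi * vecWind l a b := by
  have hpi := Real.pi_pos
  have hne : ∀ {l v : ℂ}, l ≠ 0 → v ≠ 0 → NotAlong l v → angleFrom l v < Real.pi := by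
    intro l v hl hv0 hv
    refine lt_of_le_of_ne (Complex.arg_le_pi _) fun h => ?_
    obtain ⟨h1, h2⟩ := Complex.arg_eq_pi_iff.1 h
    refine hv (-(-v / l).re) (by linarith) ?_
    have : ((-v / l).re : ℂ) = -v / l := Complex.ext rfl h2.symm
    rw [Complex.ofReal_neg, this]
    field_simp
  have h1 := hne hl ha0 ha
  have h2 := hne hl hb0 hb
  have h3 : Complex.arg (b / a) < Real.pi := by
    have := hne (neg_ne_zero.2 ha0) hb0 hab
    rwa [angleFrom, neg_div_neg_eq] at this
  have h1' : -Real.pi < angleFrom l a := Complex.neg_pi_lt_arg _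
  have h2' : -Real.pi < angleFrom l b := Complex.neg_pi_lt_arg _
  have h3' : -Real.pi < Complex.arg (b / a) := Complex.neg_pi_lt_arg _
  obtain ⟨k, hk⟩ : ∃ k : ℤ,
      Complex.arg (b / a) - (angleFrom l b - angleFrom l a) = 2 * Real.pi * k := by
    rw [← Real.Angle.angle_eq_iff_two_pi_dvd_sub, Real.Angle.coe_sub, angleFrom, angleFrom,
      Complex.arg_div_coe_angle (neg_ne_zero.2 hb0) hl,
      Complex.arg_div_coe_angle (neg_ne_zero.2 ha0) hl, ← neg_div_neg_eq,
      Complex.arg_div_coe_angle (neg_ne_zero.2 hb0) (neg_ne_zero.2 ha0)]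
    abel
  have hk1 : k < 2 := by
    have : (k : ℝ) < 2 := by nlinarith
    exact_mod_cast this
  have hk2 : -2 < k := by
    have : (-2 : ℝ) < k := by nlinarith
    exact_mod_cast this
  have key : k = vecWind l a b := by
    have hna : 0 < Complex.normSq a := by simpa using ha0
    have hnl : 0 < Complex.normSq l := by simpa using hl
    have hneg {N : ℝ} (hN : 0 < N) (x : ℝ) : x / N < 0 ↔ x < 0 := by
      rw [div_lt_iff₀ hN, zero_mul]
    have s1 : 0 < cross a b ↔ 0 < Complex.arg (b / a) := by
      rw [arg_pos_iff_of_lt_pi h3, div_im_eq_cross, div_pos_iff_of_pos_right hna]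
    have s2 : cross a b < 0 ↔ Complex.arg (b / a) < 0 := by
      rw [Complex.arg_neg_iff, div_im_eq_cross, hneg hna]
    have hcn (v : ℂ) : cross l (-v) = cross v l := by simp [cross]; ring
    have t1 (v : ℂ) : cross v l < 0 ↔ angleFrom l v < 0 := by
      rw [angleFrom, Complex.arg_neg_iff, div_im_eq_cross, hneg hnl, hcn]
    have t2 {v : ℂ} (hv : angleFrom l v < Real.pi) : 0 < cross v l ↔ 0 < angleFrom l v := by
      rw [angleFrom, arg_pos_iff_of_lt_pi hv, div_im_eq_cross, div_pos_iff_of_pos_right hnl, hcn]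
    unfold vecWind
    simp only [orient_eq_one, orient_eq_neg_one, cross_swap b l, neg_pos, neg_lt_zero, s1, s2,
      t1, t2 h1, t2 h2]
    have hk3 : k = -1 ∨ k = 0 ∨ k = 1 := by omega
    split_ifs with c1 c2
    · have : (0 : ℝ) < k := by nlinarith [c1.1, c1.2.1, c1.2.2]
      have : 0 < k := by exact_mod_cast this
      omega
    · have : (k : ℝ) < 0 := by nlinarith [c2.1, c2.2.1, c2.2.2]
      have : k < 0 := by exact_mod_cast this
      omega
    · rcases hk3 with rfl | rfl | rfl
      · exfalso; apply c2; push_cast at hk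
        refine ⟨?_, ?_, ?_⟩ <;> by_contra! <;> linarith
      · rfl
      · exfalso; apply c1; push_cast at hk
        refine ⟨?_, ?_, ?_⟩ <;> by_contra! <;> linarith
  rw [← key]; linarith

/-- The total winding number of a list of vectors. -/
noncomputable def listWind (l : ℂ) : List ℂ → ℤ
  | [] => 0
  | [_] => 0
  | a :: b :: L => vecWind l a b + listWind l (b :: L)

theorem turning_eq {l : ℂ} (hl : l ≠ 0) : ∀ (a : ℂ) (L : List ℂ),
    (∀ v ∈ a :: L, v ≠ 0 ∧ NotAlong l v) → (a :: L).IsChain (fun v u => NotAlong (-v) u) →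
    turning (a :: L) = angleFrom l ((a :: L).getLast (List.cons_ne_nil _ _)) - angleFrom l a +
      2 * Real.pi * listWind l (a :: L)
  | a, [], _, _ => by simp [turning, listWind]
  | a, b :: L, h, hc => by
    rw [List.isChain_cons_cons] at hc
    have ih := turning_eq hl b L (fun v hv => h v (List.mem_cons_of_mem _ hv)) hc.2
    have ha := h a (by simp)
    have hb := h b (by simp)
    rw [turning, ih, arg_div_eq hl ha.1 hb.1 ha.2 hb.2 hc.1, listWind, List.getLast_cons_cons]
    push_cast
    ring

/-- The first and last directions agree, so the angle terms cancel and the rounded quotient is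
already an integer. -/
theorem round_turning_closed {l : ℂ} (hl : l ≠ 0) (a : ℂ) (L : List ℂ)
    (h : ∀ v ∈ a :: L, v ≠ 0 ∧ NotAlong l v)
    (hc : (a :: L ++ [a]).IsChain (fun v u => NotAlong (-v) u)) :
    round (turning (a :: L ++ [a]) / (2 * Real.pi)) = listWind l (a :: L ++ [a]) := by
  have h1 := turning_eq hl a (L ++ [a])
    (fun v hv => h v (by simpa [or_comm, or_left_comm] using hv)) hc
  rw [List.cons_append, h1]
  have h2 : (a :: (L ++ [a])).getLast (List.cons_ne_nil _ _) = a := by simp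
  rw [h2, sub_self, zero_add, mul_div_cancel_left₀ _ Real.two_pi_pos.ne', round_intCast]

end Winding
end PlanarPerfectGraph

namespace PlanarPerfectGraph

/-! ### Geometry of the edges -/

section Geometry

variable {n : ℕ} {V E : Type*} (G : PlanarPerfectGraph n V E)

theorem dir_ne_zero (e : E) : G.dir e ≠ 0 :=
  sub_ne_zero.2 fun h => G.src_ne_tgt e (G.pos_injective h).symm

/-- Otherwise the midpoint of the edge would lie on the real axis. -/
theorem not_both_boundary {e : E} {i j : Fin n} (hi : G.src e = Sum.inl i) :
    G.tgt e ≠ Sum.inl j := by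
  intro hj
  have h := G.edge_inside e _ (midpoint_mem_openSegment (𝕜 := ℝ) _ _)
  rw [hi, hj, midpoint_eq_smul_add] at h
  simp [G.boundary_im] at h

theorem exists_tgt_of_src {e : E} {i : Fin n} (hi : G.src e = Sum.inl i) :
    ∃ v, G.tgt e = Sum.inr v := by
  rcases h : G.tgt e with j | v
  · exact absurd h (G.not_both_boundary hi)
  · exact ⟨v, rfl⟩

theorem exists_src_of_tgt {e : E} {j : Fin n} (hj : G.tgt e = Sum.inl j) :
    ∃ v, G.src e = Sum.inr v := by
  rcases h : G.src e with i | v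
  · exact absurd hj (G.not_both_boundary h)
  · exact ⟨v, rfl⟩

theorem boundary_unique {e f : E} {i : Fin n} (he : G.src e = Sum.inl i ∨ G.tgt e = Sum.inl i)
    (hf : G.src f = Sum.inl i ∨ G.tgt f = Sum.inl i) : e = f :=
  (G.boundary_univalent i).unique he hf

theorem ne_of_consecutive {e f : E} (h : G.tgt e = G.src f) : e ≠ f := by
  rintro rfl
  exact G.src_ne_tgt e h.symm

theorem exists_internal_of_consecutive {e f : E} (h : G.tgt e = G.src f) :
    ∃ v, G.tgt e = Sum.inr v := by
  rcases h' : G.tgt e with j | v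
  · exact absurd (G.boundary_unique (Or.inr h') (Or.inl (h ▸ h'))) (G.ne_of_consecutive h)
  · exact ⟨v, rfl⟩

/-- If `f` ran back along `e`, then according to their lengths the end of `f` would lie inside `e`,
the two edges would overlap entirely, or the start of `e` would lie inside `f`. -/
theorem not_antiparallel {e f : E} (h : G.tgt e = G.src f) :
    NotAlong (-(G.dir e)) (G.dir f) := by
  intro c hc hcd
  have h1 : G.pos (G.tgt f) = G.pos (G.tgt e) + c * (G.pos (G.src e) - G.pos (G.tgt e)) := by
    unfold dir at hcd
    rw [← h] at hcd
    linear_combination hcd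
  rcases lt_trichotomy c 1 with hc1 | hc1 | hc1
  · refine G.edge_vertex e (G.tgt f) ⟨c, 1 - c, hc, by linarith, by ring, ?_⟩
    rw [h1]
    simp only [Complex.real_smul]
    push_cast; ring
  · subst hc1
    have h2 : G.pos (G.tgt f) = G.pos (G.src e) := by rw [h1]; push_cast; ring
    have hd := G.edge_edge e f (G.ne_of_consecutive h)
    rw [h2, ← h, openSegment_symm ℝ (G.pos (G.tgt e))] at hd
    exact Set.disjoint_left.1 hd (midpoint_mem_openSegment (𝕜 := ℝ) _ _)
      (midpoint_mem_openSegment (𝕜 := ℝ) _ _)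
  · refine G.edge_vertex f (G.src e) ⟨1 - c⁻¹, c⁻¹, ?_, by positivity, by ring, ?_⟩
    · have := inv_lt_one_of_one_lt₀ hc1
      linarith
    · rw [h1, ← h]
      have : (c : ℂ) ≠ 0 := by exact_mod_cast hc.ne'
      simp only [Complex.real_smul]
      push_cast
      field_simp
      ring

theorem disjoint_segment {e f : E} (hef : e ≠ f) (h1 : G.src e ≠ G.src f)
    (h2 : G.src e ≠ G.tgt f) (h3 : G.tgt e ≠ G.src f) (h4 : G.tgt e ≠ G.tgt f) :
    Disjoint (segment ℝ (G.pos (G.src e)) (G.pos (G.tgt e)))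
      (segment ℝ (G.pos (G.src f)) (G.pos (G.tgt f))) := by
  rw [← insert_endpoints_openSegment, ← insert_endpoints_openSegment ℝ (G.pos (G.src f))]
  have hd := G.edge_edge e f hef
  have hi := G.pos_injective
  simp only [Set.disjoint_insert_left, Set.disjoint_insert_right, Set.mem_insert_iff, not_or]
  exact ⟨⟨hi.ne h1.symm, hi.ne h3.symm, G.edge_vertex e _⟩,
    ⟨hi.ne h2.symm, hi.ne h4.symm, G.edge_vertex e _⟩, G.edge_vertex f _, G.edge_vertex f _, hd⟩

theorem wind_eq_vecWind (l : ℂ) (e f : E) : G.wind l e f = vecWind l (G.dir e) (G.dir f) := rfl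

variable {G} {l : ℂ}

theorem IsGaugeRay.ne_zero (hl : G.IsGaugeRay l) : l ≠ 0 := by
  rintro rfl
  simpa using hl.inside

/-- Edges leaving the boundary are covered by `avoids`, edges ending there point downwards, and
internal edges are covered by `not_parallel`. -/
theorem IsGaugeRay.notAlong (hl : G.IsGaugeRay l) (e : E) : NotAlong l (G.dir e) := by
  intro c hc h
  have him := hl.inside
  rcases hs : G.src e with i | u
  · obtain ⟨v, hv⟩ := G.exists_tgt_of_src hs
    refine hl.avoids i v c hc ?_
    rw [dir, hs, hv] at h
    linear_combination h
  · rcases ht : G.tgt e with j | v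
    · have h1 := congrArg Complex.im h
      simp only [dir, hs, ht, Complex.sub_im, G.boundary_im, Complex.mul_im, Complex.ofReal_re,
        Complex.ofReal_im] at h1
      have := G.internal_im u
      nlinarith [mul_pos hc him]
    · exact hl.not_parallel e u v hs ht c hc h

end Geometry

/-! ### Intersection numbers modulo two -/

section Intersections

variable {n : ℕ} {V E : Type*} (G : PlanarPerfectGraph n V E)

/-- The ray from `b_s` meets the edge `e`. -/
def RayMeets (l : ℂ) (s : Fin n) (e : E) : Prop :=
  ∃ t : ℝ, 0 < t ∧ G.pos (Sum.inl s) + t * l ∈ segment ℝ (G.pos (G.src e)) (G.pos (G.tgt e))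

open Classical in
/-- The side of the ray from `b_s` on which a vertex lies. -/
noncomputable def raySide (l : ℂ) (s : Fin n) (x : Fin n ⊕ V) : ZMod 2 :=
  if 0 < cross (G.pos x - G.pos (Sum.inl s)) l then 1 else 0

open Classical in
theorem intNum_eq_sum (l : ℂ) (e : E) : (G.intNum l e : ZMod 2) =
    ∑ s : Fin n with G.IsSource s, if G.RayMeets l s e then 1 else 0 := by
  rw [Finset.sum_boole, Finset.filter_filter, intNum, Set.ncard_eq_toFinset_card']
  congr 2
  ext s
  rw [Set.mem_toFinset, Finset.mem_filter, and_iff_right (Finset.mem_univ s)]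
  rfl

theorem cross_add_left (a b c : ℂ) : cross (a + b) c = cross a c + cross b c := by
  simp [cross]; ring

theorem cross_self (a : ℂ) : cross a a = 0 := by
  simp [cross]; ring

variable {G} {l : ℂ}

theorem IsGaugeRay.cross_internal_ne_zero (hl : G.IsGaugeRay l) (s : Fin n) (v : V) :
    cross (G.pos (Sum.inr v) - G.pos (Sum.inl s)) l ≠ 0 := by
  intro h
  obtain ⟨t, ht⟩ := exists_eq_mul_of_cross_eq_zero hl.ne_zero h
  have h1 := congrArg Complex.im ht
  simp only [Complex.sub_im, G.boundary_im, Complex.mul_im, Complex.ofReal_re,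
    Complex.ofReal_im] at h1
  have h2 := G.internal_im v
  have : 0 < t := by
    by_contra! h3
    nlinarith [hl.inside]
  exact hl.avoids s v t this (by linear_combination ht)

theorem cross_boundary (s k : Fin n) : cross (G.pos (Sum.inl k) - G.pos (Sum.inl s)) l =
    ((G.pos (Sum.inl k)).re - (G.pos (Sum.inl s)).re) * l.im := by
  simp [cross, G.boundary_im]

theorem IsGaugeRay.cross_ne_zero (hl : G.IsGaugeRay l) {s : Fin n} {x : Fin n ⊕ V}
    (hx : x ≠ Sum.inl s) : cross (G.pos x - G.pos (Sum.inl s)) l ≠ 0 := by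
  rcases x with k | v
  · rw [cross_boundary]
    refine mul_ne_zero (sub_ne_zero.2 fun h => hx ?_) hl.inside.ne'
    rw [G.boundary_clockwise.injective h]
  · exact hl.cross_internal_ne_zero s v

/-- The other end of `e` is off the line of the ray, so `e` meets this line only at `b_s`, which is
not counted. -/
theorem IsGaugeRay.not_rayMeets_of_adjacent (hl : G.IsGaugeRay l) {s : Fin n} {e : E}
    (h : G.src e = Sum.inl s ∨ G.tgt e = Sum.inl s) : ¬ G.RayMeets l s e := by
  obtain ⟨v, hv⟩ : ∃ v, segment ℝ (G.pos (G.src e)) (G.pos (G.tgt e)) =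
      segment ℝ (G.pos (Sum.inl s)) (G.pos (Sum.inr v)) := by
    rcases h with h | h
    · obtain ⟨v, hv⟩ := G.exists_tgt_of_src h
      exact ⟨v, by rw [h, hv]⟩
    · obtain ⟨v, hv⟩ := G.exists_src_of_tgt h
      exact ⟨v, by rw [h, hv, segment_symm]⟩
  rintro ⟨t, ht, hmem⟩
  rw [hv] at hmem
  obtain ⟨a, b, ha, hb, hab, h⟩ := hmem
  have ha' : (a : ℂ) = 1 - b := by
    rw [eq_sub_iff_add_eq]; exact_mod_cast hab
  simp only [Complex.real_smul, ha'] at h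
  have h1 : (b : ℂ) * (G.pos (Sum.inr v) - G.pos (Sum.inl s)) = t * l := by linear_combination h
  have h2 := congrArg (fun z => cross z l) h1
  simp only [cross_mul_left, cross_self, mul_zero, mul_eq_zero] at h2
  rcases h2 with rfl | h2
  · simp at h1
    rcases h1 with h1 | h1
    · exact ht.ne' h1
    · exact hl.ne_zero h1
  · exact hl.cross_internal_ne_zero s v h2

/-- No end of `e` is on the line of the ray, so `e` meets the line exactly when its ends are on
opposite sides. The meeting point is above the real axis, hence on the ray and not on its backward
extension. -/
theorem IsGaugeRay.rayMeets_iff (hl : G.IsGaugeRay l) {s : Fin n} {e : E}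
    (h1 : G.src e ≠ Sum.inl s) (h2 : G.tgt e ≠ Sum.inl s) :
    G.RayMeets l s e ↔ cross (G.pos (G.src e) - G.pos (Sum.inl s)) l *
      cross (G.pos (G.tgt e) - G.pos (Sum.inl s)) l < 0 := by
  set A := cross (G.pos (G.src e) - G.pos (Sum.inl s)) l with hA
  set B := cross (G.pos (G.tgt e) - G.pos (Sum.inl s)) l with hB
  have hA0 : A ≠ 0 := hl.cross_ne_zero h1
  have hB0 : B ≠ 0 := hl.cross_ne_zero h2
  have hcomb (a b : ℝ) (hab : a + b = 1) :
      cross (a • G.pos (G.src e) + b • G.pos (G.tgt e) - G.pos (Sum.inl s)) l = a * A + b * B := by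
    rw [hA, hB, ← cross_mul_left, ← cross_mul_left, ← cross_add_left]
    congr 1
    have : (a : ℂ) + b = 1 := by exact_mod_cast hab
    simp only [Complex.real_smul]
    linear_combination G.pos (Sum.inl s) * this
  constructor
  · rintro ⟨t, ht, a, b, ha, hb, hab, h⟩
    have h3 := hcomb a b hab
    rw [h, add_sub_cancel_left, cross_mul_left, cross_self, mul_zero] at h3
    by_contra! h4
    have h5 : 0 < A * B := lt_of_le_of_ne h4 (mul_ne_zero hA0 hB0).symm
    have h6 : a * (A * A) + b * (A * B) = 0 := by linear_combination -A * h3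
    have h7 : 0 < A * A := mul_self_pos.2 hA0
    rcases ha.lt_or_eq with h8 | h8
    · nlinarith [mul_pos h8 h7, mul_nonneg hb h5.le]
    · have : b = 1 := by linarith
      rw [← h8, this] at h6
      linarith
  · intro h
    have hAB : A - B ≠ 0 := fun h3 => by
      have : A = B := by linarith
      rw [this] at h
      nlinarith [mul_self_nonneg B]
    -- The convex weights at which the affine function with end values `A`, `B` vanishes.
    have ha : 0 < -B / (A - B) := by
      rw [show -B / (A - B) = -(A * B) / (A * A - A * B) by field_simp]
      exact div_pos (by linarith) (by nlinarith [mul_self_nonneg A])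
    have hb : 0 < A / (A - B) := by
      rw [show A / (A - B) = -(A * B) / (B * B - A * B) by
        rw [div_eq_div_iff hAB (by nlinarith [mul_self_nonneg B])]; ring]
      exact div_pos (by linarith) (by nlinarith [mul_self_nonneg B])
    have hab : -B / (A - B) + A / (A - B) = 1 := by field_simp; ring
    have hmem : (-B / (A - B)) • G.pos (G.src e) + (A / (A - B)) • G.pos (G.tgt e) ∈
        openSegment ℝ (G.pos (G.src e)) (G.pos (G.tgt e)) := ⟨_, _, ha, hb, hab, rfl⟩
    have h3 := hcomb _ _ hab
    rw [show -B / (A - B) * A + A / (A - B) * B = 0 by ring] at h3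
    obtain ⟨t, ht⟩ := exists_eq_mul_of_cross_eq_zero hl.ne_zero h3
    have h4 := G.edge_inside e _ hmem
    refine ⟨t, ?_, openSegment_subset_segment _ _ _ ?_⟩
    · have h5 := congrArg Complex.im ht
      rw [Complex.sub_im, G.boundary_im, sub_zero] at h5
      rw [h5] at h4
      simp only [Complex.mul_im, Complex.ofReal_re, Complex.ofReal_im] at h4
      by_contra! h6
      nlinarith [hl.inside]
    · rw [← ht, add_sub_cancel]
      exact hmem

open Classical in
-- In this form intersections telescope along walks and cancel around cycles.
theorem IsGaugeRay.rayMeets_eq (hl : G.IsGaugeRay l) {s : Fin n} {e : E}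
    (h1 : G.src e ≠ Sum.inl s) (h2 : G.tgt e ≠ Sum.inl s) :
    (if G.RayMeets l s e then 1 else 0 : ZMod 2) =
      G.raySide l s (G.src e) + G.raySide l s (G.tgt e) := by
  rw [hl.rayMeets_iff h1 h2, mul_neg_iff]
  unfold raySide
  rcases lt_or_gt_of_ne (hl.cross_ne_zero h1) with h | h <;>
    rcases lt_or_gt_of_ne (hl.cross_ne_zero h2) with h' | h' <;>
    simp [h, h', h.not_gt, h'.not_gt, zmod_two_add_self]

end Intersections
end PlanarPerfectGraph

namespace PlanarPerfectGraph

/-! ### Walks: sides, winding and intersections -/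

section Walks

variable {n : ℕ} {V E : Type*} {G : PlanarPerfectGraph n V E} {l : ℂ}

theorem isWalk_cons_cons {e f : E} {j : Fin n} {P : List E} :
    G.IsWalk e j (e :: f :: P) ↔ G.tgt e = G.src f ∧ G.IsWalk f j (f :: P) := by
  simp only [IsWalk, List.head?_cons, List.isChain_cons_cons, List.getLast?_cons_cons]
  tauto

theorem isWalk_singleton {e : E} {j : Fin n} : G.IsWalk e j [e] ↔ G.tgt e = Sum.inl j := by
  simp [IsWalk]

/-- Telescoping along a walk. -/
theorem IsWalk.sum_telescope {c : E → ZMod 2}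
    {r : Fin n ⊕ V → ZMod 2} {j : Fin n} : ∀ {e : E} {P : List E}, G.IsWalk e j (e :: P) →
    (∀ f ∈ e :: P, c f = r (G.src f) + r (G.tgt f)) →
    ((e :: P).map c).sum = r (G.src e) + r (Sum.inl j)
  | e, [], hP, hc => by simp [hc, isWalk_singleton.1 hP]
  | e, f :: P, hP, hc => by
    rw [isWalk_cons_cons] at hP
    rw [List.map_cons, List.sum_cons,
      IsWalk.sum_telescope hP.2 fun g hg => hc g (List.mem_cons_of_mem _ hg),
      hc e (by simp), hP.1]
    linear_combination zmod_two_add_self (r (G.src f))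

/-- All edges of a walk but the last end at internal vertices. -/
theorem IsWalk.tgt_boundary {j k : Fin n} : ∀ {e : E} {P : List E}, G.IsWalk e j (e :: P) →
    ∀ f ∈ e :: P, G.tgt f = Sum.inl k → k = j
  | e, [], hP, f, hf, hk => by
    rw [List.mem_singleton] at hf
    subst hf
    rw [isWalk_singleton.1 hP] at hk
    exact (Sum.inl_injective hk).symm
  | e, g :: P, hP, f, hf, hk => by
    rw [isWalk_cons_cons] at hP
    rcases List.mem_cons.1 hf with rfl | hf
    · obtain ⟨v, hv⟩ := G.exists_internal_of_consecutive hP.1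
      rw [hv] at hk
      cases hk
    · exact IsWalk.tgt_boundary hP.2 f hf hk

/-- All edges of a walk but the first start at internal vertices. -/
theorem IsWalk.src_boundary {j k : Fin n} : ∀ {e : E} {P : List E}, G.IsWalk e j (e :: P) →
    ∀ f ∈ e :: P, G.src f = Sum.inl k → G.src e = Sum.inl k
  | e, [], hP, f, hf, hk => by
    rw [List.mem_singleton] at hf
    rwa [← hf]
  | e, g :: P, hP, f, hf, hk => by
    rw [isWalk_cons_cons] at hP
    rcases List.mem_cons.1 hf with rfl | hf
    · exact hk
    · obtain ⟨v, hv⟩ := G.exists_internal_of_consecutive hP.1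
      have := IsWalk.src_boundary hP.2 f hf hk
      rw [← hP.1, hv] at this
      cases this

open Classical in
theorem walkInt_eq_sum (P : List E) : (G.walkInt l P : ZMod 2) = ∑ s : Fin n with G.IsSource s,
    (P.map fun e => if G.RayMeets l s e then (1 : ZMod 2) else 0).sum := by
  induction P with
  | nil => simp [walkInt]
  | cons e P ih =>
    have : G.walkInt l (e :: P) = G.intNum l e + G.walkInt l P := by simp [walkInt]
    rw [this, Nat.cast_add, ih, intNum_eq_sum, ← Finset.sum_add_distrib]
    simp

theorem raySide_inl (hl : G.IsGaugeRay l) (s k : Fin n) :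
    G.raySide l s (Sum.inl k) = if k < s then 1 else 0 := by
  classical
  unfold raySide
  rw [cross_boundary]
  have h1 : (0 < ((G.pos (Sum.inl k)).re - (G.pos (Sum.inl s)).re) * l.im) ↔ k < s := by
    rw [mul_pos_iff_of_pos_right hl.inside, sub_pos]
    exact G.boundary_clockwise.lt_iff_gt
  simp [h1]

theorem sideChange_eq_raySide (hl : G.IsGaugeRay l) {s : Fin n} {x y : Fin n ⊕ V}
    (hx : x ≠ Sum.inl s) (hy : y ≠ Sum.inl s) :
    sideChange (turnUp l (G.pos x - G.pos (Sum.inl s))) (turnUp l (G.pos y - G.pos (Sum.inl s))) =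
      G.raySide l s x + G.raySide l s y := by
  classical
  have h1 (z : Fin n ⊕ V) (hz : z ≠ Sum.inl s) : NotAlong l (G.pos z - G.pos (Sum.inl s)) := by
    intro c hc h
    refine hl.cross_ne_zero hz ?_
    rw [h, cross_mul_left, cross_self, mul_zero]
  unfold sideChange raySide
  rw [rightward_turnUp hl.ne_zero (h1 x hx), rightward_turnUp hl.ne_zero (h1 y hy)]
  by_cases h : 0 < cross (G.pos x - G.pos (Sum.inl s)) l <;>
    by_cases h' : 0 < cross (G.pos y - G.pos (Sum.inl s)) l <;> simp [h, h', zmod_two_add_self]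

/-- The intersection number of a walk from a boundary source to a boundary sink. -/
theorem walkInt_parity (hl : G.IsGaugeRay l) {i j : Fin n} {e : E} {P : List E}
    (hs : G.src e = Sum.inl i) (hj : ¬ G.IsSource j) (hP : G.IsWalk e j (e :: P)) :
    (G.walkInt l (e :: P) : ZMod 2) = G.sourcesBetween i j +
      sideChange (turnUp l (G.dir e))
        (turnUp l (G.pos (Sum.inl j) - G.pos (Sum.inl i))) := by
  classical
  have hi : G.IsSource i := ⟨e, hs⟩
  have hij : j ≠ i := fun h => hj (h ▸ hi)
  have hti : G.tgt e ≠ Sum.inl i := fun h => G.not_both_boundary hs h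
  -- The ray from `b_i` is split off, because the side of `b_i` with respect to it carries no
  -- information.
  rw [walkInt_eq_sum, ← Finset.add_sum_erase _ _ (Finset.mem_filter.2 ⟨Finset.mem_univ i, hi⟩),
    add_comm]
  congr 1
  · have : (G.sourcesBetween i j : ZMod 2) =
        ∑ s ∈ (Finset.univ.filter fun s => G.IsSource s).erase i,
          if min i j < s ∧ s < max i j then 1 else 0 := by
      rw [Finset.sum_boole, sourcesBetween, Set.ncard_eq_toFinset_card']
      congr 2
      ext s
      rw [Set.mem_toFinset, Finset.mem_filter, Finset.mem_erase, Finset.mem_filter,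
        and_iff_right (Finset.mem_univ s)]
      change (G.IsSource s ∧ min i j < s ∧ s < max i j) ↔ _
      constructor
      · rintro ⟨h1, h2⟩
        refine ⟨⟨?_, h1⟩, h2⟩
        rintro rfl
        rcases lt_or_gt_of_ne hij with h | h
        · simp [h.le] at h2
        · simp [h.le] at h2
      · tauto
    rw [this]
    refine Finset.sum_congr rfl fun s hs' => ?_
    rw [Finset.mem_erase, Finset.mem_filter] at hs'
    have hjs : j ≠ s := fun h => hj (h ▸ hs'.2.2)
    -- Only the sides of `b_i` and `b_j` remain; they differ exactly when `s` lies between `i` and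
    -- `j`.
    rw [hP.sum_telescope (r := G.raySide l s), hs, raySide_inl hl, raySide_inl hl]
    · rcases lt_or_gt_of_ne hs'.1 with h1 | h1 <;> rcases lt_or_gt_of_ne hjs with h2 | h2 <;>
        simp [h1, h2, h1.not_gt, h2.not_gt, zmod_two_add_self]
    · intro f hf
      refine hl.rayMeets_eq (fun h => ?_) fun h => hjs (hP.tgt_boundary f hf h).symm
      have := hP.src_boundary f hf h
      rw [hs] at this
      exact hs'.1 (Sum.inl_injective this).symm
  -- The first edge does not meet the ray from its own start. The rest telescopes from the end of
  -- the first edge to `b_j`, and the side of that end is the side of the direction of `e`.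
  · rw [List.map_cons, List.sum_cons, if_neg (hl.not_rayMeets_of_adjacent (Or.inl hs)), zero_add,
      dir, hs, sideChange_eq_raySide hl hti (fun h => hij (Sum.inl_injective h))]
    cases P with
    | nil => exact absurd (isWalk_singleton.1 hP) (G.not_both_boundary hs)
    | cons f P =>
      rw [isWalk_cons_cons] at hP
      rw [hP.2.sum_telescope (r := G.raySide l i), hP.1]
      intro g hg
      refine hl.rayMeets_eq (fun h => ?_) fun h => hij (hP.2.tgt_boundary g hg h).symm
      have := hP.2.src_boundary g hg h
      rw [← hP.1] at this
      exact hti this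

/-- Height is a linear functional of the turned vector, with vertical coefficient `l.im`, positive
for a gauge ray; this is the half-plane needed in the crossing lemmas. -/
theorem turnUp_height (hl : l ≠ 0) (v : ℂ) :
    -l.re * (turnUp l v).re + l.im * (turnUp l v).im = v.im := by
  rw [turnUp_re, turnUp_im, cross]
  have hn : Complex.normSq l ≠ 0 := by simpa using hl
  field_simp
  rw [Complex.normSq_apply]
  ring

theorem listWind_append_last (l : ℂ) : ∀ (L : List ℂ) (a b : ℂ),
    listWind l (L ++ [a] ++ [b]) = listWind l (L ++ [a]) + vecWind l a b
  | [], a, b => by simp [listWind]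
  | [c], a, b => by simp [listWind]
  | c :: d :: L, a, b => by
    have := listWind_append_last l (d :: L) a b
    simp only [List.cons_append] at this ⊢
    rw [listWind, listWind, this, add_assoc]

theorem walkWind_eq_listWind (l : ℂ) : ∀ P : List E, G.walkWind l P = listWind l (P.map G.dir)
  | [] => rfl
  | [_] => rfl
  | e :: f :: P => by
    have := walkWind_eq_listWind l (f :: P)
    simp only [List.map_cons] at this ⊢
    rw [walkWind, listWind, this, wind_eq_vecWind]

/-- The topological winding index of a walk between boundary vertices, modulo two. -/
theorem windingIndex_parity (hl : G.IsGaugeRay l) {i j : Fin n} {e : E} {P : List E}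
    (hs : G.src e = Sum.inl i) (hij : j ≠ i) (hP : G.IsWalk e j (e :: P)) :
    (G.windingIndex i j (e :: P) : ZMod 2) = G.walkWind l (e :: P) +
      sideChange (turnUp l (G.dir e))
        (turnUp l (G.pos (Sum.inl j) - G.pos (Sum.inl i))) := by
  have hl0 := hl.ne_zero
  set d := G.pos (Sum.inl j) - G.pos (Sum.inl i) with hd
  have hdim : d.im = 0 := by simp [hd, G.boundary_im]
  have hd0 : d ≠ 0 := sub_ne_zero.2 (G.pos_injective.ne fun h => hij (Sum.inl_injective h))
  have hdl : NotAlong l d := by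
    intro c hc h
    have := congrArg Complex.im h
    rw [hdim] at this
    simp only [Complex.mul_im, Complex.ofReal_re, Complex.ofReal_im] at this
    nlinarith [mul_pos hc hl.inside]
  obtain ⟨v, hv⟩ := G.exists_tgt_of_src hs
  have heim : 0 < (G.dir e).im := by
    simp only [dir, hs, hv, Complex.sub_im, G.boundary_im, sub_zero]
    exact G.internal_im v
  obtain ⟨Q, f, hQ⟩ : ∃ Q f, e :: P = Q ++ [f] :=
    ⟨_, _, (List.dropLast_append_getLast (List.cons_ne_nil e P)).symm⟩
  have hfj : G.tgt f = Sum.inl j := by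
    obtain ⟨g, hg, hgj⟩ := hP.2.2
    rw [hQ] at hg
    simp at hg
    rwa [hg]
  obtain ⟨u, hu⟩ := G.exists_src_of_tgt hfj
  have hfim : (G.dir f).im < 0 := by
    simp only [dir, hu, hfj, Complex.sub_im, G.boundary_im, zero_sub]
    linarith [G.internal_im u]
  have hanti {a b : ℂ} (ha : a.im ≠ 0) (hb : b.im = 0) : NotAlong (-a) b ∧ NotAlong (-b) a := by
    constructor <;> intro c hc h <;> have := congrArg Complex.im h <;>
      simp [hb, hc.ne', ha] at this
  have key := round_turning_closed hl0 d ((e :: P).map G.dir) (by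
      intro x hx
      rcases List.mem_cons.1 hx with rfl | hx
      · exact ⟨hd0, hdl⟩
      · obtain ⟨g, -, rfl⟩ := List.mem_map.1 hx
        exact ⟨G.dir_ne_zero g, hl.notAlong g⟩) (by
      rw [List.cons_append, List.map_cons, List.cons_append, List.isChain_cons_cons]
      refine ⟨(hanti heim.ne' hdim).2, ?_⟩
      rw [← List.cons_append, ← List.map_cons, List.isChain_append]
      refine ⟨?_, by simp, ?_⟩
      · rw [List.isChain_map]
        exact hP.2.1.imp fun a b hab => G.not_antiparallel hab
      · rw [hQ]
        simp only [List.map_append, List.map_cons, List.map_nil, List.getLast?_append,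
          List.getLast?_singleton, List.head?_cons, Option.mem_def, Option.some_or,
          Option.some.injEq, forall_eq']
        exact (hanti hfim.ne hdim).1)
  rw [windingIndex, ← hd, key, hQ, List.map_append, List.map_cons, List.map_nil, ← List.cons_append,
    listWind_append_last, List.cons_append, ← List.map_nil (f := G.dir), ← List.map_cons,
    ← List.map_append, ← hQ, List.map_cons, listWind, ← List.map_cons, ← walkWind_eq_listWind,
    Int.cast_add, Int.cast_add, ← crossing_turnUp hl0 hdl (hl.notAlong e),
    ← crossing_turnUp hl0 (hl.notAlong f) hdl]
  have him := hl.inside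
  have hne := turnUp_ne_zero hl0 hd0
  have hlow (v : ℂ) : l.re * (turnUp l v).re + -l.im * (turnUp l v).im = -v.im := by
    rw [← turnUp_height hl0 v]; ring
  -- Of the two added bends, the one from `d` to the first edge lies in the upper half-plane and is
  -- a side change; the one from the last edge to `d` lies in the lower half-plane and is not
  -- counted.
  rw [crossing_of_upper him (α := -l.re), crossing_of_lower (neg_lt_zero.2 him) (α := l.re),
    sideChange_comm]
  · ring
  all_goals first
    | exact hne
    | exact turnUp_ne_zero hl0 (G.dir_ne_zero _)
    | simp only [turnUp_height hl0, hlow, hdim]; linarith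

/-! ### Simple walks and cycles -/

theorem black_unique {v : V} (hv : ¬ G.White v) {e f : E} (he : G.src e = Sum.inr v)
    (hf : G.src f = Sum.inr v) : e = f := (G.black_out v hv).unique he hf

theorem white_unique {v : V} (hv : G.White v) {e f : E} (he : G.tgt e = Sum.inr v)
    (hf : G.tgt f = Sum.inr v) : e = f := (G.white_in v hv).unique he hf

/-- Two edges with the same initial vertex coincide if their predecessors do. -/
theorem eq_of_src_eq {e f e' f' : E} (he : G.tgt e' = G.src e) (hf : G.tgt f' = G.src f)
    (h : G.src e = G.src f) : e = f ∨ e' = f' := by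
  obtain ⟨v, hv⟩ := G.exists_internal_of_consecutive he
  by_cases hw : G.White v
  · exact Or.inr (white_unique hw hv (hf.trans (h.symm.trans (he.symm.trans hv))))
  · exact Or.inl (black_unique hw (he ▸ hv) (h ▸ he ▸ hv))

theorem turnUp_disjoint (hl : l ≠ 0) {a b c d : ℂ} (h : Disjoint (segment ℝ a b) (segment ℝ c d)) :
    Disjoint (segment ℝ (turnUp l a) (turnUp l b)) (segment ℝ (turnUp l c) (turnUp l d)) := by
  have hf (x : ℂ) : LinearMap.mulLeft ℝ (Complex.I / l) x = turnUp l x := by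
    simp [turnUp]; ring
  have him (x y : ℂ) : segment ℝ (turnUp l x) (turnUp l y) = turnUp l '' segment ℝ x y := by
    have := image_segment ℝ (LinearMap.mulLeft ℝ (Complex.I / l)).toAffineMap x y
    simp only [LinearMap.coe_toAffineMap, hf] at this
    rw [← this]
  rw [him, him]
  refine (Set.disjoint_image_iff fun x y hxy => ?_).2 h
  by_contra hne
  refine turnUp_ne_zero hl (sub_ne_zero.2 hne) ?_
  rw [turnUp_sub, hxy, sub_self]

theorem walkWind_eq_sum_crossing (hl : G.IsGaugeRay l) : ∀ (e : E) (P : List E),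
    (G.walkWind l (e :: P) : ZMod 2) = ∑ k ∈ Finset.range P.length,
      crossing (turnUp l (G.dir ((e :: P).getD k e))) (turnUp l (G.dir (P.getD k e)))
  | e, [] => by simp [walkWind]
  | e, f :: P => by
    rw [walkWind, Int.cast_add, walkWind_eq_sum_crossing hl f P, List.length_cons,
      Finset.sum_range_succ', add_comm, wind_eq_vecWind,
      ← crossing_turnUp hl.ne_zero (hl.notAlong e) (hl.notAlong f)]
    congr 1
    refine Finset.sum_congr rfl fun k hk => ?_
    rw [Finset.mem_range] at hk
    simp only [List.getD_cons_succ]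
    -- All indices are in range, so the different default values do not matter.
    rw [List.getD_eq_getElem _ _ hk, List.getD_eq_getElem _ _ hk,
      List.getD_eq_getElem _ _ (show k < (f :: P).length by simp; omega),
      List.getD_eq_getElem _ _ (show k < (f :: P).length by simp; omega)]

/-- The winding number of a walk without repetition from a boundary source to a boundary sink. -/
theorem walkWind_parity_of_nodup (hl : G.IsGaugeRay l) {i j : Fin n} {e : E} {P : List E}
    (hs : G.src e = Sum.inl i) (hP : G.IsWalk e j (e :: P)) (hnd : (e :: P).Nodup) :
    (G.walkWind l (e :: P) : ZMod 2) = sideChange (turnUp l (G.dir e))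
        (turnUp l (G.pos (Sum.inl j) - G.pos (Sum.inl i))) := by
  have hl0 := hl.ne_zero
  set L := e :: P with hL
  set m := P.length with hm
  have hlen : L.length = m + 1 := by simp [hL, hm]
  -- The vertices of the walk: `m + 1` initial vertices of edges, and `b_j` with index `m + 1`.
  let x : ℕ → Fin n ⊕ V := fun k => if k < m + 1 then G.src (L.getD k e) else Sum.inl j
  have hx (k) (hk : k < m + 1) : x k = G.src (L.getD k e) := if_pos hk
  have hxe : x (m + 1) = Sum.inl j := by simp [x]
  have hx0 : x 0 = Sum.inl i := by rw [hx 0 (by omega), hL, List.getD_cons_zero, hs]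
  have hchain (k) (hk : k < m) : G.tgt (L.getD k e) = G.src (L.getD (k + 1) e) := by
    rw [List.getD_eq_getElem _ _ (by omega), List.getD_eq_getElem _ _ (by omega)]
    exact List.isChain_iff_getElem.1 hP.2.1 k (by omega)
  have hlast : G.tgt (L.getD m e) = Sum.inl j := by
    obtain ⟨f, hf, hfj⟩ := hP.2.2
    rw [List.getLast?_eq_getElem?, hlen, Nat.add_sub_cancel] at hf
    rw [List.getD_eq_getElem?_getD, hf, Option.getD_some, hfj]
  have hx' (k) (hk : k < m + 1) : x (k + 1) = G.tgt (L.getD k e) := by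
    rcases (show k ≤ m by omega).lt_or_eq with h | h
    · rw [hx (k + 1) (by omega), hchain k h]
    · rw [h, hxe, hlast]
  have hLinj (a b) (hab : a < b) (hb : b < m + 1) : L.getD a e ≠ L.getD b e := by
    rw [List.getD_eq_getElem _ _ (by omega), List.getD_eq_getElem _ _ (by omega)]
    intro h
    have := (List.Nodup.getElem_inj_iff hnd).1 h
    omega
  -- Here perfectness enters: two passages through a vertex share the incoming edge if it is white
  -- and the outgoing edge if it is black, so without repeated edges no vertex is repeated. The
  -- boundary ends are univalent.
  have hxinj : ∀ a b, a < b → b ≤ m + 1 → x a ≠ x b := by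
    intro a b hab hb h
    obtain ⟨b, rfl⟩ : ∃ b', b = b' + 1 := ⟨b - 1, by omega⟩
    rw [hx a (by omega), hx' b (by omega)] at h
    have hne : L.getD a e ≠ L.getD b e := by
      intro h'
      rw [h'] at h
      exact G.src_ne_tgt _ h
    rcases a with _ | a
    · have h0 := hx 0 (by omega)
      rw [hx0] at h0
      exact hne (G.boundary_unique (Or.inl h0.symm) (Or.inr (h ▸ h0.symm)))
    · rcases (show b ≤ m by omega).lt_or_eq with hb' | hb'
      · rcases eq_of_src_eq (hchain a (by omega)) (hchain b hb')
            (h.trans (hchain b hb')) with h1 | h1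
        · exact hLinj (a + 1) (b + 1) (by omega) (by omega) h1
        · exact hLinj a b (by omega) (by omega) h1
      · subst hb'
        exact hne (G.boundary_unique (Or.inl (h.trans hlast)) (Or.inr hlast))
  let p : ℕ → ℂ := fun k => turnUp l (G.pos (x k))
  have hp (k) (hk : k < m + 1) : p (k + 1) - p k = turnUp l (G.dir (L.getD k e)) := by
    simp only [p]
    rw [← turnUp_sub, hx' k hk, hx k hk, dir]
  have hpim (k) : -l.re * (p k - p 0).re + l.im * (p k - p 0).im = (G.pos (x k)).im := by
    simp only [p]
    rw [← turnUp_sub, turnUp_height hl0, Complex.sub_im, hx0, G.boundary_im, sub_zero]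
  have key := crossing_arc_upper p (α := -l.re) hl.inside m (by
      intro a b hab hb
      refine turnUp_disjoint hl0 ?_
      rw [hx a (by omega), hx b (by omega), hx' a (by omega), hx' b (by omega)]
      refine G.disjoint_segment (hLinj a b (by omega) (by omega)) ?_ ?_ ?_ ?_
      · rw [← hx a (by omega), ← hx b (by omega)]; exact hxinj _ _ (by omega) (by omega)
      · rw [← hx a (by omega), ← hx' b (by omega)]; exact hxinj _ _ (by omega) (by omega)
      · rw [← hx' a (by omega), ← hx b (by omega)]; exact hxinj _ _ (by omega) (by omega)
      · rw [← hx' a (by omega), ← hx' b (by omega)]; exact hxinj _ _ (by omega) (by omega)) (by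
      intro k hk hk'
      rw [hpim]
      obtain ⟨k, rfl⟩ : ∃ k', k = k' + 1 := ⟨k - 1, by omega⟩
      obtain ⟨v, hv⟩ := G.exists_internal_of_consecutive (hchain k (by omega))
      rw [hx' k (by omega), hv]
      exact G.internal_im v) (by rw [hpim, hxe, G.boundary_im]) (by
      rw [← sub_ne_zero, ← turnUp_sub]
      exact turnUp_ne_zero hl0
        (sub_ne_zero.2 (G.pos_injective.ne (hxinj _ _ (by omega) le_rfl).symm)))
  have h1 := hp 0 (by omega)
  rw [zero_add] at h1
  rw [h1, ← turnUp_sub, hx0, hxe, hL, List.getD_cons_zero] at key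
  rw [hL, walkWind_eq_sum_crossing hl, ← key]
  refine Finset.sum_congr rfl fun k hk => ?_
  rw [Finset.mem_range] at hk
  rw [hp k (by omega), hp (k + 1) (by omega), hL, List.getD_cons_succ]

/-- The sign of a walk from a boundary source to a boundary sink. -/
theorem walk_parity (hl : G.IsGaugeRay l) {i j : Fin n} {e : E} {P : List E}
    (hs : G.src e = Sum.inl i) (hj : ¬ G.IsSource j) (hP : G.IsWalk e j P) :
    ((G.walkWind l P + (G.walkInt l P : ℤ) : ℤ) : ZMod 2) =
      ((G.sourcesBetween i j + G.windingIndex i j P : ℤ) : ZMod 2) := by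
  obtain ⟨P, rfl⟩ := List.head?_eq_some_iff.1 hP.1
  have hij : j ≠ i := fun h => hj (h ▸ ⟨e, hs⟩)
  push_cast
  rw [walkInt_parity hl hs hj hP, windingIndex_parity hl hs hij hP]
  ring

/-- The sign of a walk without repetition from a boundary source to a boundary sink. -/
theorem walk_parity_of_nodup (hl : G.IsGaugeRay l) {i j : Fin n} {e : E} {P : List E}
    (hs : G.src e = Sum.inl i) (hj : ¬ G.IsSource j) (hP : G.IsWalk e j P) (hnd : P.Nodup) :
    ((G.walkWind l P + (G.walkInt l P : ℤ) : ℤ) : ZMod 2) =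
      ((G.sourcesBetween i j : ℤ) : ZMod 2) := by
  obtain ⟨P, rfl⟩ := List.head?_eq_some_iff.1 hP.1
  push_cast
  rw [walkInt_parity hl hs hj hP, walkWind_parity_of_nodup hl hs hP hnd, add_left_comm,
    zmod_two_add_self, add_zero]

end Walks
end PlanarPerfectGraph

namespace PlanarPerfectGraph

/-! ### Cycles and conservative flows -/

section Flows

variable {n : ℕ} {V E : Type*} {G : PlanarPerfectGraph n V E} {l : ℂ}

/-- The permutation `σ` moves every edge that it does not fix to a consecutive edge. -/
def IsFlowPerm (G : PlanarPerfectGraph n V E) (σ : Equiv.Perm E) : Prop :=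
  ∀ e, σ e ≠ e → G.tgt e = G.src (σ e)

theorem IsFlowPerm.prev {σ : Equiv.Perm E} (hσ : G.IsFlowPerm σ) {e : E} (he : σ e ≠ e) :
    G.tgt (σ.symm e) = G.src e := by
  have := hσ (σ.symm e) (by
    rw [Equiv.apply_symm_apply]
    exact fun h => he (by conv_lhs => rw [h, Equiv.apply_symm_apply]))
  rwa [Equiv.apply_symm_apply] at this

theorem IsFlowPerm.src_inj {σ : Equiv.Perm E} (hσ : G.IsFlowPerm σ) {e f : E} (he : σ e ≠ e)
    (hf : σ f ≠ f) (h : G.src e = G.src f) : e = f := by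
  rcases eq_of_src_eq (hσ.prev he) (hσ.prev hf) h with h | h
  · exact h
  · exact σ.symm.injective h

theorem Upward.pos_of_mul {a : ℂ} (ha : Upward a) {t : ℝ} (h : Upward (t * a)) : 0 < t := by
  unfold Upward at *
  simp only [Complex.mul_re, Complex.mul_im, Complex.ofReal_re, Complex.ofReal_im, zero_mul,
    sub_zero, add_zero] at h
  by_contra! ht
  rcases ha with ha | ⟨ha, ha'⟩
  · rcases h with h | ⟨h, h'⟩
    · nlinarith
    · rcases mul_eq_zero.1 h with rfl | h
      · simp at h'
      · exact ha.ne' h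
  · rcases h with h | ⟨h, h'⟩
    · rw [ha] at h; simp at h
    · nlinarith

/-- The winding number of a simple directed cycle is odd. -/
theorem IsFlowPerm.sum_wind_of_isCycle [Fintype E] [DecidableEq E] (hl : G.IsGaugeRay l)
    {σ : Equiv.Perm E} (hσ : G.IsFlowPerm σ) (hc : σ.IsCycle) :
    ∑ e ∈ σ.support, (G.wind l e (σ e) : ZMod 2) = 1 := by
  have hl0 := hl.ne_zero
  -- The base vertex is the lowest in the turned picture, and the leftmost among those.
  let key : E → ℝ ×ₗ ℝ := fun e =>
    toLex ((turnUp l (G.pos (G.src e))).im, (turnUp l (G.pos (G.src e))).re)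
  obtain ⟨e₀, he₀, hmin⟩ := σ.support.exists_min_image key
    ⟨hc.choose, Equiv.Perm.mem_support.2 hc.choose_spec.1⟩
  have hM : orderOf σ = σ.support.card := hc.orderOf
  have hmem (k : ℕ) : (σ ^ k) e₀ ∈ σ.support := Equiv.Perm.pow_apply_mem_support.2 he₀
  have hfix (k : ℕ) : σ ((σ ^ k) e₀) ≠ (σ ^ k) e₀ := Equiv.Perm.mem_support.1 (hmem k)
  have hne : ∀ a b, a < b → b < a + orderOf σ → (σ ^ a) e₀ ≠ (σ ^ b) e₀ := by
    intro a b hab hb h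
    obtain ⟨d, rfl⟩ : ∃ d, b = a + d := ⟨b - a, by omega⟩
    rw [pow_add, Equiv.Perm.mul_apply] at h
    have h1 : σ ^ d = 1 := hc.pow_eq_one_iff.2
      ⟨e₀, Equiv.Perm.mem_support.1 he₀, ((σ ^ a).injective h).symm⟩
    have := Nat.le_of_dvd (by omega) (orderOf_dvd_of_pow_eq_one h1)
    omega
  have hsucc (k : ℕ) : σ ((σ ^ k) e₀) = (σ ^ (k + 1)) e₀ := by
    rw [pow_succ', Equiv.Perm.mul_apply]
  have hnext (k : ℕ) : G.tgt ((σ ^ k) e₀) = G.src ((σ ^ (k + 1)) e₀) := by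
    rw [← hsucc]; exact hσ _ (hfix k)
  have hsrc : ∀ a b, a < b → b < a + orderOf σ → G.src ((σ ^ a) e₀) ≠ G.src ((σ ^ b) e₀) :=
    fun a b hab hb h => hne a b hab hb (hσ.src_inj (hfix a) (hfix b) h)
  have himage : (Finset.range (orderOf σ)).image (fun k => (σ ^ k) e₀) = σ.support := by
    refine Finset.eq_of_subset_of_card_le (fun e he => ?_) ?_
    · obtain ⟨k, -, rfl⟩ := Finset.mem_image.1 he
      exact hmem k
    · rw [Finset.card_image_of_injOn, Finset.card_range, hM]
      intro a ha b hb hab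
      simp only [Finset.coe_range, Set.mem_Iio] at ha hb
      by_contra hne'
      rcases lt_or_gt_of_ne hne' with h | h
      · exact hne a b h (by omega) hab
      · exact hne b a h (by omega) hab.symm
  have hinj : Set.InjOn (fun k => (σ ^ k) e₀) (Finset.range (orderOf σ)) := by
    rw [← Finset.card_image_iff, himage, Finset.card_range, hM]
  -- A cycle of two edges would be a pair of antiparallel consecutive edges.
  have hM3 : 3 ≤ orderOf σ := by
    have h2 : 2 ≤ orderOf σ := hM ▸ hc.two_le_card_support
    by_contra h3
    have h2 : orderOf σ = 2 := by omega
    have h4 : (σ ^ 2) e₀ = e₀ := by rw [← h2, pow_orderOf_eq_one]; rfl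
    have h0 := hnext 0
    have h1 := hnext 1
    rw [show 1 + 1 = 2 from rfl, h4] at h1
    simp only [zero_add, pow_zero, Equiv.Perm.one_apply] at h0
    refine G.not_antiparallel h0 1 one_pos ?_
    rw [dir, dir, ← h0, h1]
    push_cast; ring
  obtain ⟨m, hm⟩ : ∃ m, orderOf σ = m + 3 := ⟨orderOf σ - 3, by omega⟩
  have hper (k : ℕ) : (σ ^ (k + (m + 3))) e₀ = (σ ^ k) e₀ := by
    rw [pow_add, ← hm, pow_orderOf_eq_one, mul_one]
  let p : ℕ → ℂ := fun k => turnUp l (G.pos (G.src ((σ ^ k) e₀)))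
  have hp (k : ℕ) : p (k + 1) - p k = turnUp l (G.dir ((σ ^ k) e₀)) := by
    simp only [p]
    rw [← turnUp_sub, ← hnext, dir]
  have hpm : p (m + 3) = p 0 := by
    have := hper 0
    rw [zero_add] at this
    simp only [p, this]
  have hpm' : p (m + 4) = p 1 := by
    have := hper 1
    rw [show 1 + (m + 3) = m + 4 by omega] at this
    simp only [p, this]
  have hup : ∀ k, 0 < k → k < m + 3 → Upward (p k - p 0) := by
    intro k hk hk'
    have h1 : p k - p 0 ≠ 0 := by
      simp only [p]
      rw [← turnUp_sub]
      exact turnUp_ne_zero hl0 (sub_ne_zero.2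
        (G.pos_injective.ne (hsrc 0 k hk (by omega)).symm))
    have h2 := hmin _ (hmem k)
    simp only [key, Prod.Lex.toLex_le_toLex] at h2
    unfold Upward
    simp only [Complex.sub_im, Complex.sub_re, p, pow_zero, Equiv.Perm.one_apply] at h1 ⊢
    rcases h2 with h2 | ⟨h2, h3⟩
    · left; linarith
    · right
      refine ⟨by linarith, ?_⟩
      rcases h3.lt_or_eq with h4 | h4
      · linarith
      · exact absurd (sub_eq_zero.2 (Complex.ext h4.symm h2.symm)) h1
  have hclose : p 0 - p (m + 2) = turnUp l (G.dir ((σ ^ (m + 2)) e₀)) := by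
    rw [← hp, hpm]
  have hfirst : p 1 - p 0 = turnUp l (G.dir e₀) := hp 0
  -- Both neighbours of the base vertex are `Upward` from it. If collinear, they are positive
  -- multiples of each other, so the last and the first edge would be antiparallel.
  have hcross : cross (p (m + 2) - p 0) (p 1 - p 0) ≠ 0 := by
    intro h
    rw [cross_swap, neg_eq_zero] at h
    obtain ⟨t, ht⟩ := exists_eq_mul_of_cross_eq_zero (hup (m + 2) (by omega) (by omega)).ne_zero h
    have h1 := hup 1 (by omega) (by omega)
    rw [ht] at h1
    have ht0 := (hup (m + 2) (by omega) (by omega)).pos_of_mul h1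
    have hn := hnext (m + 2)
    have := hper 0
    rw [zero_add] at this
    rw [show m + 2 + 1 = m + 3 from rfl, this, pow_zero, Equiv.Perm.one_apply] at hn
    refine G.not_antiparallel hn t ht0 ?_
    rw [← neg_sub (p 0) (p (m + 2)), hclose, hfirst] at ht
    have h2 : turnUp l (G.dir e₀ - t * -G.dir ((σ ^ (m + 2)) e₀)) = 0 := by
      rw [turnUp_sub, ht]
      simp only [turnUp]; ring
    by_contra h3
    exact turnUp_ne_zero hl0 (sub_ne_zero.2 h3) h2
  have key := crossing_polygon p m (by
    intro i j hij hj hne'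
    refine turnUp_disjoint hl0 ?_
    rw [← hnext, ← hnext]
    refine G.disjoint_segment (hne i j (by omega) (by omega)) (hsrc _ _ (by omega) (by omega))
      ?_ ?_ ?_
    · rw [hnext]; exact hsrc _ _ (by omega) (by omega)
    · rw [hnext]; exact hsrc _ _ (by omega) (by omega)
    · rw [hnext, hnext]; exact hsrc _ _ (by omega) (by omega)) hpm hpm' hup hcross
  rw [← key, ← himage, Finset.sum_image hinj, hm]
  refine Finset.sum_congr rfl fun k _ => ?_
  rw [hp, hp (k + 1), crossing_turnUp hl0 (hl.notAlong _) (hl.notAlong _), hsucc, wind_eq_vecWind]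

/-- The rays meet the cycles of a permutation an even number of times. -/
theorem IsFlowPerm.sum_intNum [Fintype E] [DecidableEq E] (hl : G.IsGaugeRay l)
    {σ : Equiv.Perm E} (hσ : G.IsFlowPerm σ) :
    ∑ e ∈ σ.support, (G.intNum l e : ZMod 2) = 0 := by
  classical
  simp only [intNum_eq_sum]
  rw [Finset.sum_comm]
  refine Finset.sum_eq_zero fun s _ => ?_
  have h1 : ∀ e ∈ σ.support, (if G.RayMeets l s e then 1 else 0 : ZMod 2) =
      G.raySide l s (G.src e) + G.raySide l s (G.src (σ e)) := by
    intro e he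
    rw [Equiv.Perm.mem_support] at he
    obtain ⟨v, hv⟩ := G.exists_internal_of_consecutive (hσ e he)
    obtain ⟨u, hu⟩ := G.exists_internal_of_consecutive (hσ.prev he)
    rw [hσ.prev he] at hu
    rw [hl.rayMeets_eq (by simp [hu]) (by simp [hv]), hσ e he]
  -- Reindexing by `σ` makes the two sums of sides equal, so they cancel modulo two.
  rw [Finset.sum_congr rfl h1, Finset.sum_add_distrib,
    Equiv.Perm.sum_comp σ σ.support (fun e => G.raySide l s (G.src e)) (by
      intro e he; simpa using he), zmod_two_add_self]

/-! ### Signs of permutations and the determinant as a sum over flows -/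

theorem negOnePow_eq_of_cast_eq {a b : ℤ} (h : (a : ZMod 2) = b) :
    a.negOnePow = b.negOnePow := by
  rw [Int.negOnePow_eq_iff, ← ZMod.intCast_eq_zero_iff_even, Int.cast_sub, h, sub_self]

theorem negOnePow_sum {ι : Type*} (s : Finset ι) (f : ι → ℤ) :
    (∑ i ∈ s, f i).negOnePow = ∏ i ∈ s, (f i).negOnePow := by
  classical
  induction s using Finset.induction_on with
  | empty => simp
  | insert i s hi ih => rw [Finset.sum_insert hi, Finset.prod_insert hi, Int.negOnePow_add, ih]

/-- A cycle of length `c` has sign `-(-1) ^ c`. The factors `-1` give `(-1) ^ c`, and the odd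
winding with even intersection number gives one more `-1`. Disjoint cycles multiply. -/
theorem IsFlowPerm.sign_mul_prod [Fintype E] [DecidableEq E] (hl : G.IsGaugeRay l)
    (σ : Equiv.Perm E) : G.IsFlowPerm σ → Equiv.Perm.sign σ *
      ∏ e ∈ σ.support, -((G.intNum l e : ℤ) + G.wind l e (σ e)).negOnePow = 1 := by
  induction σ using Equiv.Perm.cycle_induction_on with
  | base_one => simp
  | base_cycles σ hc =>
    intro hσ
    rw [hc.sign, Finset.prod_neg, ← negOnePow_sum,
      negOnePow_eq_of_cast_eq (b := 1) (by
        push_cast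
        rw [Finset.sum_add_distrib, hσ.sum_intNum hl, hσ.sum_wind_of_isCycle hl hc, zero_add]),
      Int.negOnePow_one]
    rcases neg_one_pow_eq_or ℤˣ σ.support.card with h | h <;> rw [h] <;> rfl
  | induction_disjoint σ τ hd hc hσ hτ =>
    intro h
    have h1 : ∀ e, σ e ≠ e → (σ * τ) e = σ e := fun e he => by
      rw [Equiv.Perm.mul_apply, (hd e).resolve_left he]
    have h2 : ∀ e, τ e ≠ e → (σ * τ) e = τ e := fun e he => by
      rw [Equiv.Perm.mul_apply]
      exact (hd (τ e)).resolve_right fun h' => he (τ.injective h')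
    have hσ' := hσ fun e he => by
      have := h e (by rw [h1 e he]; exact he)
      rwa [h1 e he] at this
    have hτ' := hτ fun e he => by
      have := h e (by rw [h2 e he]; exact he)
      rwa [h2 e he] at this
    rw [hd.support_mul, Finset.prod_union hd.disjoint_support, Equiv.Perm.sign_mul,
      mul_mul_mul_comm]
    rw [Finset.prod_congr rfl fun e he => by rw [h1 e (Equiv.Perm.mem_support.1 he)], hσ',
      Finset.prod_congr rfl fun e he => by rw [h2 e (Equiv.Perm.mem_support.1 he)], hτ', one_mul]

/-- The sign `(-1) ^ z` in a ring. -/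
def ringSign (R : Type*) [Ring R] (z : ℤ) : R := ((z.negOnePow : ℤ) : R)

open Classical in
/-- The matrix of the linear relations for edge vectors. -/
noncomputable def flowMatrix {R : Type*} [CommRing R] (G : PlanarPerfectGraph n V E) (l : ℂ)
    (w : E → R) : Matrix E E R :=
  Matrix.of fun e f => if G.tgt e = G.src f then
    ringSign R ((G.intNum l e : ℤ) + G.wind l e f) * w e else 0

open Classical in
-- A Leibniz term: fixed edges contribute 1, as no edge is a loop, and moved edges contribute `-N`,
-- which vanishes unless the step is consecutive and the row is kept. The remaining sign is 1 by
-- `IsFlowPerm.sign_mul_prod`.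
theorem prod_one_sub_zeroRows [Fintype E] {R : Type*} [CommRing R] (hl : G.IsGaugeRay l)
    (w : E → R) (S : Finset E) (σ : Equiv.Perm E) :
    ((Equiv.Perm.sign σ : ℤ) : R) * ∏ e, (1 - zeroRows (G.flowMatrix l w) S) e (σ e) =
      if G.IsFlowPerm σ ∧ ∀ e ∈ σ.support, e ∉ S then ∏ e ∈ σ.support, w e else 0 := by
  have h0 : ∀ e ∈ Finset.univ, e ∉ σ.support →
      (1 - zeroRows (G.flowMatrix l w) S) e (σ e) = 1 := by
    intro e _ he
    rw [Equiv.Perm.notMem_support] at he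
    simp [he, zeroRows, flowMatrix, (G.src_ne_tgt e).symm]
  have h1 : ∀ e ∈ σ.support, (1 - zeroRows (G.flowMatrix l w) S) e (σ e) =
      if G.tgt e = G.src (σ e) ∧ e ∉ S then
        ((-((G.intNum l e : ℤ) + G.wind l e (σ e)).negOnePow : ℤˣ) : ℤ) * w e else 0 := by
    intro e he
    rw [Equiv.Perm.mem_support] at he
    rw [Matrix.sub_apply, Matrix.one_apply_ne he.symm]
    by_cases hS : e ∈ S <;> by_cases ht : G.tgt e = G.src (σ e) <;>
      simp [zeroRows, flowMatrix, hS, ht, ringSign]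
  rw [← Finset.prod_subset (Finset.subset_univ _) h0, Finset.prod_congr rfl h1]
  by_cases h : G.IsFlowPerm σ ∧ ∀ e ∈ σ.support, e ∉ S
  · rw [if_pos h, Finset.prod_congr rfl fun e he => if_pos
      ⟨h.1 e (Equiv.Perm.mem_support.1 he), h.2 e he⟩, Finset.prod_mul_distrib, ← mul_assoc]
    have h2 := congrArg (fun u : ℤˣ => ((u : ℤ) : R)) (IsFlowPerm.sign_mul_prod hl σ h.1)
    simp only [Units.val_mul, Units.coe_prod, Int.cast_mul, Int.cast_prod, Units.val_one,
      Int.cast_one] at h2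
    rw [h2, one_mul]
  · rw [if_neg h]
    obtain ⟨e, he, he'⟩ : ∃ e ∈ σ.support, ¬ (G.tgt e = G.src (σ e) ∧ e ∉ S) := by
      by_contra! h'
      exact h ⟨fun e he => (h' e (Equiv.Perm.mem_support.2 he)).1, fun e he => (h' e he).2⟩
    rw [Finset.prod_eq_zero he (if_neg he'), mul_zero]

open Classical in
theorem IsFlowPerm.isConservativeFlow [Fintype E] {σ : Equiv.Perm E} (hσ : G.IsFlowPerm σ) :
    G.IsConservativeFlow σ.support := by
  refine ⟨fun v => ?_, fun e he i => ?_⟩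
  · refine Finset.card_bij (fun e _ => σ e) ?_ (fun _ _ _ _ h => σ.injective h) ?_
    · intro e he
      simp only [Finset.mem_filter] at he ⊢
      exact ⟨Equiv.Perm.apply_mem_support.2 he.1,
        (hσ e (Equiv.Perm.mem_support.1 he.1)) ▸ he.2⟩
    · intro e he
      simp only [Finset.mem_filter] at he
      have he' := Equiv.Perm.mem_support.1 he.1
      refine ⟨σ.symm e, ?_, σ.apply_symm_apply e⟩
      simp only [Finset.mem_filter]
      refine ⟨?_, (hσ.prev he').trans he.2⟩
      rw [← Equiv.Perm.apply_mem_support, Equiv.apply_symm_apply]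
      exact he.1
  · rw [Equiv.Perm.mem_support] at he
    obtain ⟨v, hv⟩ := G.exists_internal_of_consecutive (hσ e he)
    obtain ⟨u, hu⟩ := G.exists_internal_of_consecutive (hσ.prev he)
    rw [hσ.prev he] at hu
    simp [hu, hv]

open Classical in
-- A white vertex admits one incoming edge, hence by conservation at most one outgoing edge of `C`;
-- a black vertex has only one outgoing edge at all.
theorem IsConservativeFlow.src_inj {C : Finset E} (hC : G.IsConservativeFlow C) {e f : E}
    (he : e ∈ C) (hf : f ∈ C) (h : G.src e = G.src f) : e = f := by
  rcases hv : G.src e with i | v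
  · exact absurd hv (hC.2 e he i).1
  · by_cases hw : G.White v
    · have h1 : (C.filter fun e => G.src e = Sum.inr v).card ≤ 1 := by
        rw [← hC.1 v, Finset.card_le_one]
        intro a ha b hb
        exact white_unique hw (Finset.mem_filter.1 ha).2 (Finset.mem_filter.1 hb).2
      exact Finset.card_le_one.1 h1 _ (Finset.mem_filter.2 ⟨he, hv⟩) _
        (Finset.mem_filter.2 ⟨hf, h ▸ hv⟩)
    · exact black_unique hw hv (h ▸ hv)

open Classical in
theorem IsConservativeFlow.tgt_inj {C : Finset E} (hC : G.IsConservativeFlow C) {e f : E}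
    (he : e ∈ C) (hf : f ∈ C) (h : G.tgt e = G.tgt f) : e = f := by
  rcases hv : G.tgt e with i | v
  · exact absurd hv (hC.2 e he i).2
  · by_cases hw : G.White v
    · exact white_unique hw hv (h ▸ hv)
    · have h1 : (C.filter fun e => G.tgt e = Sum.inr v).card ≤ 1 := by
        rw [hC.1 v, Finset.card_le_one]
        intro a ha b hb
        exact black_unique hw (Finset.mem_filter.1 ha).2 (Finset.mem_filter.1 hb).2
      exact Finset.card_le_one.1 h1 _ (Finset.mem_filter.2 ⟨he, hv⟩) _
        (Finset.mem_filter.2 ⟨hf, h ▸ hv⟩)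

open Classical in
theorem IsConservativeFlow.exists_next {C : Finset E} (hC : G.IsConservativeFlow C) {e : E}
    (he : e ∈ C) : ∃ f ∈ C, G.tgt e = G.src f := by
  rcases hv : G.tgt e with i | v
  · exact absurd hv (hC.2 e he i).2
  · have h1 : 0 < (C.filter fun e => G.src e = Sum.inr v).card := by
      rw [← hC.1 v, Finset.card_pos]
      exact ⟨e, Finset.mem_filter.2 ⟨he, hv⟩⟩
    obtain ⟨f, hf⟩ := Finset.card_pos.1 h1
    exact ⟨f, (Finset.mem_filter.1 hf).1, (Finset.mem_filter.1 hf).2.symm⟩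

open Classical in
-- Following the flow to the next edge is injective on `C` by `tgt_inj`, hence a permutation of `C`;
-- it has no fixed edges because there are no loops.
theorem IsConservativeFlow.exists_perm [Fintype E] {C : Finset E} (hC : G.IsConservativeFlow C) :
    ∃ σ : Equiv.Perm E, G.IsFlowPerm σ ∧ σ.support = C := by
  choose! next hnext hsrc using fun e (he : e ∈ C) => hC.exists_next he
  let s : C → C := fun e => ⟨next e, hnext e e.2⟩
  have hs : Function.Injective s := by
    intro e f hef
    have h1 : next e = next f := congrArg Subtype.val hef
    exact Subtype.ext (hC.tgt_inj e.2 f.2 (by rw [hsrc e e.2, hsrc f f.2, h1]))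
  let τ : Equiv.Perm C := Equiv.ofBijective s (Finite.injective_iff_bijective.1 hs)
  have hτ : ∀ (e : E) (he : e ∈ C), Equiv.Perm.ofSubtype τ e = next e := fun e he => by
    rw [Equiv.Perm.ofSubtype_apply_of_mem τ he]; rfl
  refine ⟨Equiv.Perm.ofSubtype τ, fun e he => ?_, ?_⟩
  · have : e ∈ C := by
      by_contra h
      exact he (Equiv.Perm.ofSubtype_apply_of_not_mem τ h)
    rw [hτ e this]
    exact hsrc e this
  · ext e
    rw [Equiv.Perm.mem_support]
    constructor
    · intro he
      by_contra h
      exact he (Equiv.Perm.ofSubtype_apply_of_not_mem τ h)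
    · intro he
      rw [hτ e he]
      exact (G.ne_of_consecutive (hsrc e he)).symm

open Classical in
/-- The determinant of the relations for edge vectors is the sum over the conservative flows. -/
theorem det_one_sub_zeroRows [Fintype E] {R : Type*} [CommRing R] (hl : G.IsGaugeRay l)
    (w : E → R) (S : Finset E) : (1 - zeroRows (G.flowMatrix l w) S).det =
      ∑ C : Finset E with G.IsConservativeFlow C ∧ ∀ f ∈ C, f ∉ S, ∏ e ∈ C, w e := by
  -- Transposing puts `σ` on the column index, so that `σ` runs forward along the edges.
  rw [← Matrix.det_transpose, Matrix.det_apply']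
  simp only [Matrix.transpose_apply]
  rw [Finset.sum_congr rfl fun σ _ => prod_one_sub_zeroRows hl w S σ, ← Finset.sum_filter]
  refine Finset.sum_bij (fun σ _ => σ.support) ?_ ?_ ?_ fun _ _ => rfl
  · intro σ hσ
    simp only [Finset.mem_filter, Finset.mem_univ, true_and] at hσ ⊢
    exact ⟨hσ.1.isConservativeFlow, hσ.2⟩
  -- The support determines the permutation: the next edge is the only edge of the flow with the
  -- required initial vertex.
  · intro σ hσ τ hτ h
    simp only [Finset.mem_filter, Finset.mem_univ, true_and] at hσ hτ
    ext1 e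
    by_cases he : e ∈ σ.support
    · refine hσ.1.isConservativeFlow.src_inj (Equiv.Perm.apply_mem_support.2 he) ?_ ?_
      · rw [h]; exact Equiv.Perm.apply_mem_support.2 (h ▸ he)
      · rw [← hσ.1 e (Equiv.Perm.mem_support.1 he), ← hτ.1 e (Equiv.Perm.mem_support.1 (h ▸ he))]
    · rw [Equiv.Perm.notMem_support.1 he, Equiv.Perm.notMem_support.1 (h ▸ he)]
  · intro C hC
    simp only [Finset.mem_filter, Finset.mem_univ, true_and] at hC
    obtain ⟨σ, hσ, rfl⟩ := hC.1.exists_perm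
    exact ⟨σ, by simpa using ⟨hσ, by simpa using hC.2⟩, rfl⟩

end Flows
end PlanarPerfectGraph

namespace PlanarPerfectGraph

/-! ### Half-edge vectors in terms of edge vectors -/

section HalfEdges

variable {n : ℕ} {V E W : Type*} [AddCommGroup W] [Module ℝ W]
  {G : PlanarPerfectGraph n V E} {l : ℂ} {w : E → ℝ}

theorem neg_one_zpow_mul_self (z : ℤ) : (-1 : ℝ) ^ z * (-1) ^ z = 1 := by
  rw [← mul_zpow]; simp

open Classical in
/-- The coefficient of `X e` in the half-edge vector at the initial vertex of `e`. -/
noncomputable def srcCoeff (G : PlanarPerfectGraph n V E) (l : ℂ) (e : E) : ℝ :=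
  match G.src e with
  | Sum.inl _ => 1
  | Sum.inr u => if hu : G.White u then (-1) ^ (1 + G.wind l (G.inEdge u hu) e) else 1

open Classical in
/-- The coefficient of `X e` in the half-edge vector at the final vertex of `e`. -/
noncomputable def tgtCoeff (G : PlanarPerfectGraph n V E) (l : ℂ) (w : E → ℝ) (e : E) : ℝ :=
  match G.tgt e with
  | Sum.inl _ => (w e)⁻¹
  | Sum.inr v =>
      if hv : G.White v then (-1) ^ (G.intNum l e : ℤ) * (w e)⁻¹
      else (-1) ^ ((G.intNum l e : ℤ) + G.wind l e (G.outEdge v hv)) * (w e)⁻¹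

theorem toHalfEdge_srcHalf (X : E → W) (e : E) :
    G.toHalfEdge l w X (G.srcHalf e) = G.srcCoeff l e • X e := by
  simp only [toHalfEdge, srcHalf, HalfEdge.edge, HalfEdge.vertex, if_true, srcCoeff]
  cases G.src e with
  | inl i => simp
  | inr v => by_cases hv : G.White v <;> simp [hv]

theorem toHalfEdge_tgtHalf (X : E → W) (e : E) :
    G.toHalfEdge l w X (G.tgtHalf e) = G.tgtCoeff l w e • X e := by
  have h : ¬ G.src (G.tgtHalf e).edge = (G.tgtHalf e).vertex := G.src_ne_tgt e
  rw [toHalfEdge, if_neg h]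
  simp only [tgtHalf, HalfEdge.edge, HalfEdge.vertex, tgtCoeff]
  cases G.tgt e with
  | inl i => simp
  | inr v => by_cases hv : G.White v <;> simp [hv]

theorem srcCoeff_ne_zero (e : E) : G.srcCoeff l e ≠ 0 := by
  unfold srcCoeff
  split
  · exact one_ne_zero
  · split_ifs
    · exact zpow_ne_zero _ (by norm_num)
    · exact one_ne_zero

theorem tgtCoeff_ne_zero (hw : ∀ e, 0 < w e) (e : E) : G.tgtCoeff l w e ≠ 0 := by
  have h := inv_ne_zero (hw e).ne'
  have h1 : (-1 : ℝ) ≠ 0 := by norm_num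
  unfold tgtCoeff
  split
  · exact h
  · split_ifs
    · exact mul_ne_zero (zpow_ne_zero _ h1) h
    · exact mul_ne_zero (zpow_ne_zero _ h1) h

/-- The geometric signature compares the two coefficients of an edge. -/
theorem srcCoeff_eq (hw : ∀ e, 0 < w e) (e : E) :
    G.srcCoeff l e = (-1) ^ G.signature l e * w e * G.tgtCoeff l w e := by
  have hwe := (hw e).ne'
  have h1 : (-1 : ℝ) ≠ 0 := by norm_num
  have hcancel (z : ℤ) : (-1 : ℝ) ^ z * w e * ((-1) ^ z * (w e)⁻¹) = 1 := by
    rw [mul_mul_mul_comm, neg_one_zpow_mul_self, mul_inv_cancel₀ hwe, one_mul]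
  unfold srcCoeff signature tgtCoeff
  rcases hs : G.src e with i | u <;> rcases ht : G.tgt e with j | v
  · exact absurd ht (G.not_both_boundary hs)
  · by_cases hv : G.White v
    · simp only [hv, dif_pos, hcancel]
    · simp only [hv, dif_neg, not_false_eq_true, hcancel]
  · by_cases hu : G.White u
    · simp [hu, hwe]
    · simp [hu, hwe]
  · by_cases hu : G.White u <;> by_cases hv : G.White v
    · simp only [hu, hv, dif_pos]
      rw [add_right_comm, zpow_add₀ h1 _ (G.intNum l e : ℤ), mul_assoc, mul_assoc, ← mul_assoc,
        mul_assoc, ← mul_assoc _ (w e), hcancel, mul_one]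
    · simp only [hu, hv, dif_pos, dif_neg, not_false_eq_true]
      rw [show 1 + (G.intNum l e : ℤ) + G.wind l (G.inEdge u hu) e + G.wind l e (G.outEdge v hv) =
        (1 + G.wind l (G.inEdge u hu) e) + (G.intNum l e + G.wind l e (G.outEdge v hv)) by ring,
        zpow_add₀ h1 _ ((G.intNum l e : ℤ) + _), mul_assoc, mul_assoc, ← mul_assoc _ (w e),
        hcancel, mul_one]
    · simp only [hu, hv, dif_pos, dif_neg, not_false_eq_true, hcancel]
    · simp only [hu, hv, dif_neg, not_false_eq_true, hcancel]

theorem halfEdge_cases (h : G.HalfEdge) : (∃ e, h = G.srcHalf e) ∨ ∃ e, h = G.tgtHalf e := by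
  obtain ⟨⟨x, e⟩, h | h⟩ := h
  · exact Or.inl ⟨e, Subtype.ext (Prod.ext h.symm rfl)⟩
  · exact Or.inr ⟨e, Subtype.ext (Prod.ext h.symm rfl)⟩

theorem sum_halfEdge {W : Type*} [AddCommMonoid W] [Fintype V] [Fintype E] (φ : G.HalfEdge → W) :
    ∑ h, φ h = ∑ e, φ (G.srcHalf e) + ∑ e, φ (G.tgtHalf e) := by
  have hbij : Function.Bijective (Sum.elim G.srcHalf G.tgtHalf) := by
    constructor
    · have h1 (e f : E) : G.srcHalf e ≠ G.tgtHalf f := fun h => by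
        have h2 := congrArg Subtype.val h
        simp only [srcHalf, tgtHalf, Prod.mk.injEq] at h2
        obtain ⟨h2, rfl⟩ := h2
        exact G.src_ne_tgt e h2
      rintro (e | e) (f | f) h
      · exact congrArg Sum.inl (congrArg (fun h : G.HalfEdge => h.1.2) h)
      · exact absurd h (h1 e f)
      · exact absurd h.symm (h1 f e)
      · exact congrArg Sum.inr (congrArg (fun h : G.HalfEdge => h.1.2) h)
    · intro h
      rcases halfEdge_cases h with ⟨e, rfl⟩ | ⟨e, rfl⟩
      · exact ⟨Sum.inl e, rfl⟩
      · exact ⟨Sum.inr e, rfl⟩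
  rw [← hbij.sum_comp, Fintype.sum_sum_type]
  rfl

theorem ringSign_real (z : ℤ) : ringSign ℝ z = (-1) ^ z := Int.cast_negOnePow ℝ z

theorem inEdge_eq {v : V} (hv : G.White v) {e : E} (he : G.tgt e = Sum.inr v) :
    G.inEdge v hv = e := white_unique hv (G.white_in v hv).choose_spec.1 he

theorem outEdge_eq {v : V} (hv : ¬ G.White v) {e : E} (he : G.src e = Sum.inr v) :
    G.outEdge v hv = e := black_unique hv (G.black_out v hv).choose_spec.1 he

open Classical in
theorem flowMatrix_real (e f : E) : G.flowMatrix l w e f = if G.tgt e = G.src f then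
    (-1) ^ ((G.intNum l e : ℤ) + G.wind l e f) * w e else 0 := by
  simp [flowMatrix, ringSign_real]

open Classical in
theorem sum_flowMatrix_smul [Fintype E] {e : E} {x : Fin n ⊕ V} (he : G.tgt e = x) (X : E → W) :
    ∑ f, G.flowMatrix l w e f • X f = ∑ f with G.src f = x,
      ((-1 : ℝ) ^ ((G.intNum l e : ℤ) + G.wind l e f) * w e) • X f := by
  subst he
  rw [Finset.sum_filter]
  refine Finset.sum_congr rfl fun f _ => ?_
  rw [flowMatrix_real, ite_smul, zero_smul]
  simp only [eq_comm]

open Classical in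
theorem card_out_add_card_in [Fintype E] (v : V) :
    (Finset.univ.filter fun e => G.src e = Sum.inr v).card +
      (Finset.univ.filter fun e => G.tgt e = Sum.inr v).card = G.valency v := by
  rw [valency, Set.ncard_eq_toFinset_card', ← Finset.card_union_of_disjoint]
  · congr 1
    ext e
    simp
  · rw [Finset.disjoint_filter]
    intro e _ h1 h2
    exact G.src_ne_tgt e (h1.trans h2.symm)

open Classical in
theorem card_in_white [Fintype E] {v : V} (hv : G.White v) :
    (Finset.univ.filter fun e => G.tgt e = Sum.inr v).card = 1 := by
  rw [Finset.card_eq_one]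
  refine ⟨G.inEdge v hv, ?_⟩
  ext e
  simp only [Finset.mem_filter, Finset.mem_univ, true_and, Finset.mem_singleton]
  exact ⟨fun h => (inEdge_eq hv h).symm, fun h => h ▸ (G.white_in v hv).choose_spec.1⟩

open Classical in
theorem card_out_black [Fintype E] {v : V} (hv : ¬ G.White v) :
    (Finset.univ.filter fun e => G.src e = Sum.inr v).card = 1 := by
  rw [Finset.card_eq_one]
  refine ⟨G.outEdge v hv, ?_⟩
  ext e
  simp only [Finset.mem_filter, Finset.mem_univ, true_and, Finset.mem_singleton]
  exact ⟨fun h => (outEdge_eq hv h).symm, fun h => h ▸ (G.black_out v hv).choose_spec.1⟩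

open Classical in
-- A bivalent white vertex has one incoming edge, which leaves one outgoing edge.
theorem filter_out_eq_singleton [Fintype E] {v : V} (hv : G.valency v = 2 ∨ ¬ G.White v) {f : E}
    (hf : G.src f = Sum.inr v) : (Finset.univ.filter fun e => G.src e = Sum.inr v) = {f} := by
  have h1 : (Finset.univ.filter fun e => G.src e = Sum.inr v).card = 1 := by
    by_cases hw : G.White v
    · have := card_out_add_card_in (G := G) v
      rw [card_in_white hw] at this
      have := hv.resolve_right (not_not.2 hw)
      omega
    · exact card_out_black hw
  obtain ⟨g, hg⟩ := Finset.card_eq_one.1 h1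
  have : f ∈ Finset.univ.filter fun e => G.src e = Sum.inr v := by simp [hf]
  rw [hg, Finset.mem_singleton] at this
  rw [hg, this]

open Classical in
theorem filter_out_eq_pair [Fintype E] {v : V} (hv : G.valency v = 3) (hw : G.White v) {f g : E}
    (hf : G.src f = Sum.inr v) (hg : G.src g = Sum.inr v) (hfg : f ≠ g) :
    (Finset.univ.filter fun e => G.src e = Sum.inr v) = {f, g} := by
  have := card_out_add_card_in (G := G) v
  rw [card_in_white hw] at this
  symm
  refine Finset.eq_of_subset_of_card_le ?_ ?_
  · intro e he
    simp only [Finset.mem_insert, Finset.mem_singleton] at he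
    rcases he with rfl | rfl <;> simp [hf, hg]
  · rw [Finset.card_pair hfg]; omega

/-- The relations for edge vectors in matrix form. -/
theorem isEdgeSystem_iff [Fintype E] (X : E → W) : G.IsEdgeSystem l w X ↔
    ∀ e v, G.tgt e = Sum.inr v → X e = ∑ f, G.flowMatrix l w e f • X f := by
  classical
  constructor
  · intro h e v he
    rw [sum_flowMatrix_smul he]
    have hcard := card_out_add_card_in (G := G) v
    have hout (h' : G.valency v = 2 ∨ ¬ G.White v) : ∃ f, G.src f = Sum.inr v := by
      by_cases hw : G.White v
      · rw [card_in_white hw, h'.resolve_right (not_not.2 hw)] at hcard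
        have : 0 < (Finset.univ.filter fun e => G.src e = Sum.inr v).card := by omega
        obtain ⟨f, hf⟩ := Finset.card_pos.1 this
        exact ⟨f, by simpa using hf⟩
      · exact ⟨G.outEdge v hw, (G.black_out v hw).choose_spec.1⟩
    rcases G.internal_valency v with h2 | h3
    · obtain ⟨f, hf⟩ := hout (Or.inl h2)
      rw [filter_out_eq_singleton (Or.inl h2) hf, Finset.sum_singleton]
      exact h.bivalent v h2 e f he hf
    · by_cases hw : G.White v
      · rw [card_in_white hw, show G.valency v = 3 from h3] at hcard
        obtain ⟨f, g, hfg, heq⟩ := Finset.card_eq_two.1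
          (show (Finset.univ.filter fun e => G.src e = Sum.inr v).card = 2 by omega)
        have hf : f ∈ Finset.univ.filter fun e => G.src e = Sum.inr v := by simp [heq]
        have hg : g ∈ Finset.univ.filter fun e => G.src e = Sum.inr v := by simp [heq]
        rw [heq, Finset.sum_pair hfg]
        exact h.white v h3 hw e f g he (by simpa using hf) (by simpa using hg) hfg
      · obtain ⟨f, hf⟩ := hout (Or.inr hw)
        rw [filter_out_eq_singleton (Or.inr hw) hf, Finset.sum_singleton]
        exact h.black v h3 hw e f he hf
  · intro h
    refine ⟨fun v h2 e f he hf => ?_, fun v h3 hw e f he hf => ?_,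
      fun v h3 hw e f g he hf hg hfg => ?_⟩
    · rw [h e v he, sum_flowMatrix_smul he, filter_out_eq_singleton (Or.inl h2) hf,
        Finset.sum_singleton]
    · rw [h e v he, sum_flowMatrix_smul he, filter_out_eq_singleton (Or.inr hw) hf,
        Finset.sum_singleton]
    · rw [h e v he, sum_flowMatrix_smul he, filter_out_eq_pair h3 hw hf hg hfg,
        Finset.sum_pair hfg]

open Classical in
theorem sum_halfEdge_at {W : Type*} [AddCommMonoid W] [Fintype V] [Fintype E]
    (φ : G.HalfEdge → W) (x : Fin n ⊕ V) :
    ∑ h : G.HalfEdge with h.vertex = x, φ h =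
      ∑ e with G.src e = x, φ (G.srcHalf e) + ∑ e with G.tgt e = x, φ (G.tgtHalf e) := by
  rw [Finset.sum_filter, sum_halfEdge, Finset.sum_filter, Finset.sum_filter]
  rfl

theorem tgtCoeff_white {v : V} (hv : G.White v) {e : E} (he : G.tgt e = Sum.inr v) :
    G.tgtCoeff l w e = (-1) ^ (G.intNum l e : ℤ) * (w e)⁻¹ := by
  unfold tgtCoeff
  rw [he]
  simp [hv]

theorem tgtCoeff_black {v : V} (hv : ¬ G.White v) {e : E} (he : G.tgt e = Sum.inr v) {f : E}
    (hf : G.src f = Sum.inr v) :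
    G.tgtCoeff l w e = (-1) ^ ((G.intNum l e : ℤ) + G.wind l e f) * (w e)⁻¹ := by
  unfold tgtCoeff
  rw [he]
  simp [hv, outEdge_eq hv hf]

theorem srcCoeff_white {v : V} (hv : G.White v) {e f : E} (he : G.tgt e = Sum.inr v)
    (hf : G.src f = Sum.inr v) : G.srcCoeff l f = (-1) ^ (1 + G.wind l e f) := by
  unfold srcCoeff
  rw [hf]
  simp [hv, inEdge_eq hv he]

theorem srcCoeff_black {v : V} (hv : ¬ G.White v) {f : E}
    (hf : G.src f = Sum.inr v) : G.srcCoeff l f = 1 := by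
  unfold srcCoeff
  rw [hf]
  simp [hv]

/-- The relations for half-edge vectors are equivalent to the relations for edge vectors. -/
theorem isHalfEdgeSystem_toHalfEdge_iff [Fintype V] [Fintype E] (hw : ∀ e, 0 < w e) (X : E → W) :
    G.IsHalfEdgeSystem l w (G.toHalfEdge l w X) ↔ G.IsEdgeSystem l w X := by
  classical
  have h1 : (-1 : ℝ) ≠ 0 := by norm_num
  have hblack : ∀ v, ¬ G.White v → ∀ e f, G.tgt e = Sum.inr v → G.src f = Sum.inr v →
      (G.toHalfEdge l w X (G.tgtHalf e) = G.toHalfEdge l w X (G.srcHalf f) ↔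
        X e = ∑ g, G.flowMatrix l w e g • X g) := by
    intro v hv e f he hf
    rw [toHalfEdge_srcHalf, toHalfEdge_tgtHalf, srcCoeff_black hv hf, tgtCoeff_black hv he hf,
      sum_flowMatrix_smul he, filter_out_eq_singleton (Or.inr hv) hf, Finset.sum_singleton,
      one_smul]
    set z := (G.intNum l e : ℤ) + G.wind l e f
    have h2 : (-1 : ℝ) ^ z * (w e)⁻¹ * ((-1) ^ z * w e) = 1 := by
      rw [mul_mul_mul_comm, neg_one_zpow_mul_self, inv_mul_cancel₀ (hw e).ne', one_mul]
    constructor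
    · intro h
      rw [← h, smul_smul, mul_comm, h2, one_smul]
    · intro h
      rw [h, smul_smul, h2, one_smul]
  have hwhite : ∀ v, G.White v → ∀ e, G.tgt e = Sum.inr v →
      (∑ h : G.HalfEdge with h.vertex = Sum.inr v, G.toHalfEdge l w X h = 0 ↔
        X e = ∑ g, G.flowMatrix l w e g • X g) := by
    intro v hv e he
    have hin : (Finset.univ.filter fun e => G.tgt e = Sum.inr v) = {e} := by
      obtain ⟨g, hg⟩ := Finset.card_eq_one.1 (card_in_white (G := G) hv)
      have : e ∈ Finset.univ.filter fun e => G.tgt e = Sum.inr v := by simp [he]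
      rw [hg, Finset.mem_singleton] at this
      rw [hg, this]
    -- The summand 1 in the exponents of outgoing edges is the minus sign here; the winding signs
    -- and the scaled incoming edge reproduce row `e` of the matrix.
    have h3 : ∑ f with G.src f = Sum.inr v, G.toHalfEdge l w X (G.srcHalf f) =
        -(G.tgtCoeff l w e • ∑ g, G.flowMatrix l w e g • X g) := by
      rw [sum_flowMatrix_smul he, Finset.smul_sum, ← Finset.sum_neg_distrib]
      refine Finset.sum_congr rfl fun f hf => ?_
      have hf' : G.src f = Sum.inr v := by simpa using hf
      rw [toHalfEdge_srcHalf, srcCoeff_white hv he hf', tgtCoeff_white hv he, smul_smul, ← neg_smul]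
      congr 1
      have hwe := (hw e).ne'
      rw [zpow_add₀ h1, zpow_add₀ h1, zpow_one]
      have := neg_one_zpow_mul_self (G.intNum l e : ℤ)
      linear_combination ((-1 : ℝ) ^ G.wind l e f) * this +
        ((-1 : ℝ) ^ (G.intNum l e : ℤ) * (-1) ^ (G.intNum l e : ℤ) * (-1) ^ G.wind l e f) *
          inv_mul_cancel₀ hwe
    rw [sum_halfEdge_at, hin, Finset.sum_singleton, h3, toHalfEdge_tgtHalf, neg_add_eq_zero]
    constructor
    · intro h
      exact (smul_right_injective W (tgtCoeff_ne_zero hw e) h).symm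
    · intro h
      rw [← h]
  rw [isEdgeSystem_iff]
  constructor
  · intro h e v he
    by_cases hv : G.White v
    · exact (hwhite v hv e he).1 (h.white v hv)
    · exact (hblack v hv e _ he (G.black_out v hv).choose_spec.1).1
        (h.black v hv _ _ he (G.black_out v hv).choose_spec.1)
  · intro h
    refine ⟨fun e => ?_, fun v hv => ?_, fun v hv => ?_⟩
    -- The relation along an edge holds for every `X`; only the vertex relations carry content.
    · rw [toHalfEdge_srcHalf, toHalfEdge_tgtHalf, srcCoeff_eq hw, smul_smul]
    · have hout := (G.black_out v hv).choose_spec.1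
      have key : ∀ h' : G.HalfEdge, h'.vertex = Sum.inr v →
          G.toHalfEdge l w X h' = G.toHalfEdge l w X (G.srcHalf (G.outEdge v hv)) := by
        intro h' hh'
        rcases halfEdge_cases h' with ⟨e, rfl⟩ | ⟨e, rfl⟩
        · rw [outEdge_eq hv hh']
        · exact (hblack v hv e _ hh' hout).2 (h e v hh')
      intro a b ha hb
      rw [key a ha, key b hb]
    · exact (hwhite v hv (G.inEdge v hv) (G.white_in v hv).choose_spec.1).2
        (h _ v (G.white_in v hv).choose_spec.1)

theorem toHalfEdge_injective : Function.Injective (G.toHalfEdge l w : (E → W) → _) := by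
  intro X Y h
  ext e
  have := congrFun h (G.srcHalf e)
  rw [toHalfEdge_srcHalf, toHalfEdge_srcHalf] at this
  exact smul_right_injective W (srcCoeff_ne_zero e) this

/-- `X` is read off at initial half-edges; the relation along each edge then forces the value at the
final one. -/
theorem exists_toHalfEdge_eq [Fintype V] [Fintype E] (hw : ∀ e, 0 < w e) {z : G.HalfEdge → W}
    (hz : G.IsHalfEdgeSystem l w z) : ∃ X, G.toHalfEdge l w X = z := by
  refine ⟨fun e => (G.srcCoeff l e)⁻¹ • z (G.srcHalf e), ?_⟩
  ext h
  rcases halfEdge_cases h with ⟨e, rfl⟩ | ⟨e, rfl⟩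
  · rw [toHalfEdge_srcHalf, smul_inv_smul₀ (srcCoeff_ne_zero e)]
  · rw [toHalfEdge_tgtHalf, hz.edge, smul_smul, smul_smul]
    have h1 := srcCoeff_ne_zero (G := G) (l := l) e
    rw [show G.tgtCoeff l w e * (G.srcCoeff l e)⁻¹ * ((-1) ^ G.signature l e * w e) = 1 by
      rw [mul_comm, ← mul_assoc, ← srcCoeff_eq hw, mul_inv_cancel₀ h1], one_smul]

/-- The correspondence between edge vectors and half-edge vectors. -/
theorem bijOn_toHalfEdge [Fintype V] [Fintype E] (hw : ∀ e, 0 < w e) :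
    Set.BijOn (G.toHalfEdge l w) {X : E → W | G.IsEdgeSystem l w X}
      {z : G.HalfEdge → W | G.IsHalfEdgeSystem l w z} := by
  refine ⟨fun X hX => (isHalfEdgeSystem_toHalfEdge_iff hw X).2 hX, toHalfEdge_injective.injOn,
    fun z hz => ?_⟩
  obtain ⟨X, rfl⟩ := exists_toHalfEdge_eq hw hz
  exact ⟨X, (isHalfEdgeSystem_toHalfEdge_iff hw X).1 hz, rfl⟩

theorem edgeBoundary_iff (hw : ∀ e, 0 < w e) (F : Fin n → W) (X : E → W) :
    G.EdgeBoundary l w F X ↔ G.HalfEdgeBoundary l F (G.toHalfEdge l w X) := by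
  refine forall_congr' fun e => forall_congr' fun j => forall_congr' fun he => ?_
  have hwe := (hw e).ne'
  have h1 : G.tgtCoeff l w e = (w e)⁻¹ := by
    unfold tgtCoeff
    rw [he]
  rw [toHalfEdge_tgtHalf, h1, mul_comm, mul_smul, inv_smul_eq_iff₀ hwe]

end HalfEdges
end PlanarPerfectGraph

namespace PlanarPerfectGraph

/-! ### The flow expression of the solution -/

section Solution

variable {n : ℕ} {V E : Type*} {G : PlanarPerfectGraph n V E} {l : ℂ}

theorem ringSign_add (R : Type*) [Ring R] (a b : ℤ) :
    ringSign R (a + b) = ringSign R a * ringSign R b := by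
  simp [ringSign, Int.negOnePow_add]

theorem ringSign_mul_self (R : Type*) [Ring R] (a : ℤ) : ringSign R a * ringSign R a = 1 := by
  rw [← ringSign_add, ringSign, Int.negOnePow_even _ ⟨a, rfl⟩]
  simp

theorem map_ringSign {R S : Type*} [Ring R] [Ring S] (f : R →+* S) (a : ℤ) :
    f (ringSign R a) = ringSign S a := by
  simp [ringSign]

open Classical in
/-- The coefficients of the boundary value at `b_j` in the relations for edge vectors. -/
noncomputable def sinkTerm {R : Type*} [CommRing R] (G : PlanarPerfectGraph n V E) (l : ℂ)
    (w : E → R) (j : Fin n) (e : E) : R :=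
  if G.tgt e = Sum.inl j then ringSign R (G.intNum l e) * w e else 0

open Classical in
-- The product has a zero factor unless the list is a walk ending at `b_j`; otherwise the signs add
-- up to the winding and intersection numbers of the walk.
theorem pathWeight_flowMatrix {R : Type*} [CommRing R] (w : E → R) (j : Fin n) :
    ∀ (e : E) (P : List E), pathWeight (G.flowMatrix l w) (G.sinkTerm l w j) (e :: P) =
      if G.IsWalk e j (e :: P) then
        ringSign R (G.walkWind l (e :: P) + (G.walkInt l (e :: P) : ℤ)) * ((e :: P).map w).prod
      else 0
  | e, [] => by
    rw [isWalk_singleton]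
    simp [pathWeight, sinkTerm, walkWind, walkInt]
  | e, f :: P => by
    rw [pathWeight, pathWeight_flowMatrix w j f P, isWalk_cons_cons]
    have hint : G.walkInt l (e :: f :: P) = G.intNum l e + G.walkInt l (f :: P) := by
      simp [walkInt]
    by_cases h1 : G.tgt e = G.src f <;> by_cases h2 : G.IsWalk f j (f :: P)
    · simp only [flowMatrix, Matrix.of_apply, h1, h2, if_true, and_self, walkWind, hint,
        List.map_cons, List.prod_cons, ringSign_add, Nat.cast_add]
      ring
    · simp [h2]
    · simp [flowMatrix, h1]
    · simp [h2]

open Classical in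
/-- The sum over the conservative flows. -/
noncomputable def flowSum [Fintype E] {R : Type*} [CommSemiring R] (G : PlanarPerfectGraph n V E)
    (w : E → R) : R := ∑ C : Finset E with G.IsConservativeFlow C, ∏ e ∈ C, w e

open Classical in
/-- The sum over the pairs of a walk without repetition and a disjoint conservative flow, with
signs `s`. -/
noncomputable def pathFlowSum [Fintype E] {R : Type*} [CommSemiring R]
    (G : PlanarPerfectGraph n V E) (s : List E → R) (w : E → R) (e : E) (j : Fin n) : R :=
  ∑ P : {P : List E // P.Nodup} with G.IsWalk e j P.1,
    ∑ C : Finset E with G.IsConservativeFlow C ∧ ∀ f ∈ C, f ∉ P.1,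
      s P.1 * ((P.1.map w).prod * ∏ f ∈ C, w f)

open Classical in
theorem det_one_sub_flowMatrix [Fintype E] {R : Type*} [CommRing R] (hl : G.IsGaugeRay l)
    (w : E → R) : (1 - G.flowMatrix l w).det = G.flowSum w := by
  have := det_one_sub_zeroRows hl w ∅
  rw [zeroRows_empty] at this
  rw [this, flowSum]
  simp

open Classical in
-- Stated over a general ring, because it is used both for real weights and for the variables of a
-- power series ring.
theorem flowSum_mul_solution [Fintype E] {R : Type*} [CommRing R] (hl : G.IsGaugeRay l)
    (w : E → R) (hD : ∀ S : Finset E, IsUnit (1 - zeroRows (G.flowMatrix l w) S).det) (j : Fin n)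
    (x : E → R) (hx : ∀ e, x e = ∑ g, G.flowMatrix l w e g * x g + G.sinkTerm l w j e) (e : E) :
    G.flowSum w * x e = G.pathFlowSum
      (fun P => ringSign R (G.walkWind l P + (G.walkInt l P : ℤ))) w e j := by
  have h := det_mul_solution (G.flowMatrix l w) (G.sinkTerm l w j) hD x hx e
  rw [zeroRows_empty, det_one_sub_flowMatrix hl] at h
  rw [h, pathFlowSum, Finset.sum_filter, Finset.sum_filter]
  refine Finset.sum_congr rfl fun P _ => ?_
  by_cases he : P.1.head? = some e
  · obtain ⟨Q, hQ⟩ := List.head?_eq_some_iff.1 he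
    rw [if_pos he, hQ, pathWeight_flowMatrix]
    by_cases hP : G.IsWalk e j (e :: Q)
    · rw [if_pos hP, if_pos hP, det_one_sub_zeroRows hl, Finset.mul_sum]
      simp only [List.mem_toFinset, mul_assoc]
    · rw [if_neg hP, if_neg hP, zero_mul]
  · rw [if_neg he, if_neg fun h => he h.1]

/-! ### Real weights -/

open Classical in
-- All flows have positive weight, and the empty flow is always present.
theorem det_pos [Fintype E] (hl : G.IsGaugeRay l) {w : E → ℝ} (hw : ∀ e, 0 < w e)
    (S : Finset E) : 0 < (1 - zeroRows (G.flowMatrix l w) S).det := by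
  rw [det_one_sub_zeroRows hl]
  exact Finset.sum_pos (fun C _ => Finset.prod_pos fun e _ => hw e)
    ⟨∅, Finset.mem_filter.2 ⟨Finset.mem_univ _, ⟨fun v => by simp, by simp⟩, by simp⟩⟩

theorem flowSum_pos [Fintype E] (hl : G.IsGaugeRay l) {w : E → ℝ} (hw : ∀ e, 0 < w e) :
    0 < G.flowSum w := by
  classical
  have := det_pos hl hw ∅
  rwa [zeroRows_empty, det_one_sub_flowMatrix hl] at this

theorem existsUnique_of_isUnit_det {W : Type*} [AddCommGroup W] [Module ℝ W] [Fintype E]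
    [DecidableEq E] (N : Matrix E E ℝ) (hN : IsUnit (1 - N).det) (c : E → W) :
    ∃! X : E → W, ∀ e, X e = ∑ f, N e f • X f + c e := by
  have hmul (A B : Matrix E E ℝ) (X : E → W) (e : E) :
      ∑ f, A e f • ∑ g, B f g • X g = ∑ g, (A * B) e g • X g := by
    simp only [Finset.smul_sum, smul_smul, Matrix.mul_apply, Finset.sum_smul]
    exact Finset.sum_comm
  have hone (X : E → W) (e : E) : ∑ g, (1 : Matrix E E ℝ) e g • X g = X e := by
    simp [Matrix.one_apply]
  have hsub (X : E → W) (e : E) : ∑ f, (1 - N) e f • X f = X e - ∑ f, N e f • X f := by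
    simp only [Matrix.sub_apply, sub_smul, Finset.sum_sub_distrib, hone]
  have h1 : (1 - N)⁻¹ * (1 - N) = 1 := Matrix.nonsing_inv_mul _ hN
  have h2 : (1 - N) * (1 - N)⁻¹ = 1 := Matrix.mul_nonsing_inv _ hN
  refine ⟨fun e => ∑ f, (1 - N)⁻¹ e f • c f, fun e => ?_, fun X hX => ?_⟩
  · have := hsub (fun e => ∑ f, (1 - N)⁻¹ e f • c f) e
    rw [hmul, h2, hone] at this
    rw [this, add_sub_cancel]
  · ext e
    have h3 : ∀ f, c f = ∑ g, (1 - N) f g • X g := fun f => by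
      rw [hsub, eq_sub_iff_add_eq, add_comm, ← hX f]
    simp only [h3, hmul, h1, hone]

/-- The two families of relations concern different edges: the matrix row of an edge into a sink
vanishes, and so does the sink term of an edge into an internal vertex. -/
theorem isEdgeSystem_and_boundary_iff {W : Type*} [AddCommGroup W] [Module ℝ W] [Fintype E]
    (w : E → ℝ) (F : Fin n → W) (X : E → W) :
    (G.IsEdgeSystem l w X ∧ G.EdgeBoundary l w F X) ↔
      ∀ e, X e = ∑ f, G.flowMatrix l w e f • X f + ∑ j, G.sinkTerm l w j e • F j := by
  classical
  have hsink {e : E} {j : Fin n} (he : G.tgt e = Sum.inl j) :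
      ∑ f, G.flowMatrix l w e f • X f + ∑ j, G.sinkTerm l w j e • F j =
        ((-1 : ℝ) ^ G.intNum l e * w e) • F j := by
    rw [Finset.sum_eq_zero, zero_add, Finset.sum_eq_single j]
    · rw [sinkTerm, if_pos he, ringSign_real, zpow_natCast]
    · intro k _ hk
      rw [sinkTerm, if_neg, zero_smul]
      rw [he]
      exact fun h => hk (Sum.inl_injective h).symm
    · simp
    · intro f _
      rw [flowMatrix_real, if_neg, zero_smul]
      intro h
      obtain ⟨v, hv⟩ := G.exists_internal_of_consecutive h
      rw [he] at hv
      cases hv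
  have hint {e : E} {v : V} (he : G.tgt e = Sum.inr v) : ∑ j, G.sinkTerm l w j e • F j = 0 :=
    Finset.sum_eq_zero fun j _ => by simp [sinkTerm, he]
  rw [isEdgeSystem_iff]
  constructor
  · rintro ⟨h1, h2⟩ e
    rcases he : G.tgt e with j | v
    · rw [hsink he, h2 e j he]
    · rw [hint he, add_zero]
      exact h1 e v he
  · intro h
    refine ⟨fun e v he => ?_, fun e j he => ?_⟩
    · have := h e
      rwa [hint he, add_zero] at this
    · have := h e
      rwa [hsink he] at this

theorem existsUnique_edgeSystem {W : Type*} [AddCommGroup W] [Module ℝ W] [Fintype E]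
    (hl : G.IsGaugeRay l) {w : E → ℝ} (hw : ∀ e, 0 < w e) (F : Fin n → W) :
    ∃! X : E → W, G.IsEdgeSystem l w X ∧ G.EdgeBoundary l w F X := by
  classical
  simp only [isEdgeSystem_and_boundary_iff]
  refine existsUnique_of_isUnit_det _ (isUnit_iff_ne_zero.2 ?_) _
  have := (det_pos hl hw ∅).ne'
  rwa [zeroRows_empty] at this

theorem existsUnique_halfEdgeSystem {W : Type*} [AddCommGroup W] [Module ℝ W] [Fintype V]
    [Fintype E] (hl : G.IsGaugeRay l) {w : E → ℝ} (hw : ∀ e, 0 < w e) (F : Fin n → W) :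
    ∃! z : G.HalfEdge → W, G.IsHalfEdgeSystem l w z ∧ G.HalfEdgeBoundary l F z := by
  obtain ⟨X, ⟨hX1, hX2⟩, huniq⟩ := existsUnique_edgeSystem hl hw F
  refine ⟨G.toHalfEdge l w X, ⟨(isHalfEdgeSystem_toHalfEdge_iff hw X).2 hX1,
    (edgeBoundary_iff hw F X).1 hX2⟩, ?_⟩
  rintro z ⟨hz1, hz2⟩
  obtain ⟨Y, rfl⟩ := exists_toHalfEdge_eq hw hz1
  rw [huniq Y ⟨(isHalfEdgeSystem_toHalfEdge_iff hw Y).1 hz1, (edgeBoundary_iff hw F Y).2 hz2⟩]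

theorem exists_sink_edge {j : Fin n} (hj : ¬ G.IsSource j) : ∃ e, G.tgt e = Sum.inl j := by
  obtain ⟨e, he, -⟩ := G.boundary_univalent j
  exact ⟨e, he.resolve_left fun h => hj ⟨e, h⟩⟩

theorem not_isSource_of_tgt {j : Fin n} {e : E} (he : G.tgt e = Sum.inl j) : ¬ G.IsSource j := by
  rintro ⟨f, hf⟩
  exact G.ne_of_consecutive (he.trans hf.symm) (G.boundary_unique (Or.inr he) (Or.inl hf))

/-- Signed evaluation at the sinks is an isomorphism, by existence and uniqueness for arbitrary
boundary data. -/
theorem finrank_solutionSpace [Fintype V] [Fintype E] (hl : G.IsGaugeRay l) {w : E → ℝ}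
    (hw : ∀ e, 0 < w e) :
    Module.finrank ℝ (G.solutionSpace l w) = {j : Fin n | ¬ G.IsSource j}.ncard := by
  classical
  let sink : {j : Fin n // ¬ G.IsSource j} → E := fun j => (exists_sink_edge j.2).choose
  have hsink (j) : G.tgt (sink j) = Sum.inl j.1 := (exists_sink_edge j.2).choose_spec
  let φ : G.solutionSpace l w →ₗ[ℝ] ({j : Fin n // ¬ G.IsSource j} → ℝ) :=
    { toFun := fun z j => (-1 : ℝ) ^ G.intNum l (sink j) • z.1 (G.tgtHalf (sink j))
      map_add' := fun a b => by ext j; simp [mul_add]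
      map_smul' := fun c a => by ext j; simp [mul_left_comm] }
  have hsq (k : ℕ) : (-1 : ℝ) ^ k * (-1) ^ k = 1 := by rw [← mul_pow]; simp
  have hφ_apply (z j) : φ z j = (-1 : ℝ) ^ G.intNum l (sink j) * z.1 (G.tgtHalf (sink j)) := rfl
  have hφ (z : G.solutionSpace l w) (F : Fin n → ℝ) : (∀ j, φ z j = F j.1) ↔
      G.HalfEdgeBoundary l F z.1 := by
    constructor
    · intro h e j he
      have h1 := h ⟨j, not_isSource_of_tgt he⟩
      have h2 : sink ⟨j, not_isSource_of_tgt he⟩ = e :=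
        G.boundary_unique (Or.inr (hsink _)) (Or.inr he)
      rw [← h1, hφ_apply, h2, smul_eq_mul, ← mul_assoc, hsq, one_mul]
    · intro h j
      rw [hφ_apply, h _ _ (hsink j), smul_eq_mul, ← mul_assoc, hsq, one_mul]
  have hbij : Function.Bijective φ := by
    constructor
    · rw [← LinearMap.ker_eq_bot, LinearMap.ker_eq_bot']
      intro z hz
      have h1 := (hφ z 0).1 fun j => by rw [hz]; rfl
      have h0 := (hφ 0 0).1 fun j => by rw [map_zero]; rfl
      exact Subtype.ext ((existsUnique_halfEdgeSystem hl hw (0 : Fin n → ℝ)).unique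
        ⟨z.2, h1⟩ ⟨(0 : G.solutionSpace l w).2, h0⟩)
    · intro f
      obtain ⟨z, ⟨hz1, hz2⟩, -⟩ := existsUnique_halfEdgeSystem hl hw
        (fun j => if hj : G.IsSource j then (0 : ℝ) else f ⟨j, hj⟩)
      refine ⟨⟨z, hz1⟩, funext fun j => ?_⟩
      rw [(hφ ⟨z, hz1⟩ _).2 hz2 j, dif_neg j.2]
  rw [(LinearEquiv.ofBijective φ hbij).finrank_eq, Module.finrank_fintype_fun_eq_card,
    ← Nat.card_eq_fintype_card]
  exact Nat.card_coe_set_eq _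

theorem flowNumerator_eq [Fintype E] (w : E → ℝ) (e : E) (j : Fin n) :
    G.flowNumerator l w e j = G.pathFlowSum
      (fun P => ringSign ℝ (G.walkWind l P + (G.walkInt l P : ℤ))) w e j := by
  simp only [flowNumerator, pathFlowSum, ringSign_real]

/-- The solution for the canonical boundary data is the flow expression. -/
theorem eq_flowVector [Fintype E] (hl : G.IsGaugeRay l) {w : E → ℝ} (hw : ∀ e, 0 < w e)
    {X : E → Fin n → ℝ} (hX : G.IsEdgeSystem l w X)
    (hb : G.EdgeBoundary l w (fun j => Pi.single j 1) X) : X = G.flowVector l w := by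
  classical
  have h := (isEdgeSystem_and_boundary_iff w _ X).1 ⟨hX, hb⟩
  ext e j
  have hx : ∀ e, X e j = ∑ g, G.flowMatrix l w e g * X g j + G.sinkTerm l w j e := by
    intro e
    conv_lhs => rw [h e]
    simp [Finset.sum_apply, Pi.single_apply]
  have key := flowSum_mul_solution hl w (fun S => isUnit_iff_ne_zero.2 (det_pos hl hw S).ne') j
    (fun e => X e j) hx e
  rw [← flowNumerator_eq] at key
  have hpos := flowSum_pos hl hw
  rw [flowVector]
  split_ifs with hj
  -- No walk ends at a source.
  · have h0 : G.flowNumerator l w e j = 0 := by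
      rw [flowNumerator, Finset.sum_filter, Finset.sum_eq_zero]
      intro P _
      rw [if_neg]
      rintro ⟨-, -, f, -, hf⟩
      exact not_isSource_of_tgt hf hj
    rw [h0] at key
    exact (mul_eq_zero.1 key).resolve_left hpos.ne'
  · rw [eq_div_iff (show G.flowDenominator w ≠ 0 from hpos.ne'), mul_comm]
    exact key

/-! ### The formal boundary measurements -/

open Classical in
/-- The signed generating function of the walks from `e` to `b_j`. -/
noncomputable def formalSolution (G : PlanarPerfectGraph n V E) (l : ℂ) (j : Fin n) (e : E) :
    MvPowerSeries E ℝ := fun d =>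
  ∑ P ∈ (Finsupp.toMultiset d).lists.toFinset with P.head? = some e,
    pathWeight (G.flowMatrix l 1) (G.sinkTerm l 1 j) P

open Classical in
theorem mem_lists_toFinset (d : E →₀ ℕ) (P : List E) :
    P ∈ (Finsupp.toMultiset d).lists.toFinset ↔ Finsupp.toMultiset d = (P : Multiset E) := by
  rw [Multiset.mem_toFinset, Multiset.mem_lists_iff]
  rfl

theorem ringSign_powerSeries (a : ℤ) :
    ringSign (MvPowerSeries E ℝ) a = MvPowerSeries.C (ringSign ℝ a) :=
  (map_ringSign (MvPowerSeries.C : ℝ →+* MvPowerSeries E ℝ) a).symm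

theorem flowMatrix_X (e f : E) : G.flowMatrix l (MvPowerSeries.X : E → MvPowerSeries E ℝ) e f =
    MvPowerSeries.C (G.flowMatrix l (1 : E → ℝ) e f) * MvPowerSeries.X e := by
  classical
  by_cases h : G.tgt e = G.src f <;> simp [flowMatrix, h, ringSign_powerSeries]

theorem sinkTerm_X (j : Fin n) (e : E) :
    G.sinkTerm l (MvPowerSeries.X : E → MvPowerSeries E ℝ) j e =
      MvPowerSeries.C (G.sinkTerm l (1 : E → ℝ) j e) * MvPowerSeries.X e := by
  classical
  by_cases h : G.tgt e = Sum.inl j <;> simp [sinkTerm, h, ringSign_powerSeries]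

/-- Removing the first edge `e` of a walk divides its monomial by the variable of `e`. What remains
starts with a consecutive edge, or is empty if `e` already ends at `b_j`. -/
theorem formalSolution_eq [Fintype E] (j : Fin n) (e : E) :
    G.formalSolution l j e = ∑ g, G.flowMatrix l MvPowerSeries.X e g * G.formalSolution l j g +
      G.sinkTerm l MvPowerSeries.X j e := by
  classical
  ext d
  simp only [flowMatrix_X, sinkTerm_X, map_add, map_sum, mul_assoc, MvPowerSeries.coeff_C_mul]
  simp only [MvPowerSeries.X_def, MvPowerSeries.coeff_monomial_mul, one_mul]
  change (∑ P ∈ (Finsupp.toMultiset d).lists.toFinset with P.head? = some e, _) = _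
  by_cases hd : Finsupp.single e 1 ≤ d
  · obtain ⟨d', rfl⟩ := exists_add_of_le hd
    have hmem : ∀ P : List E,
        (e :: P) ∈ (Finsupp.toMultiset (Finsupp.single e 1 + d')).lists.toFinset ↔
          P ∈ (Finsupp.toMultiset d').lists.toFinset := by
      intro P
      rw [mem_lists_toFinset, mem_lists_toFinset, map_add, Finsupp.toMultiset_single, one_smul,
        ← Multiset.cons_coe, Multiset.singleton_add, Multiset.cons_inj_right]
    have hset : ((Finsupp.toMultiset (Finsupp.single e 1 + d')).lists.toFinset.filter
        fun P => P.head? = some e) =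
        (Finsupp.toMultiset d').lists.toFinset.image (List.cons e) := by
      ext P
      rw [Finset.mem_filter, Finset.mem_image]
      constructor
      · rintro ⟨h1, h2⟩
        obtain ⟨Q, rfl⟩ := List.head?_eq_some_iff.1 h2
        exact ⟨Q, (hmem Q).1 h1, rfl⟩
      · rintro ⟨Q, hQ, rfl⟩
        exact ⟨(hmem Q).2 hQ, rfl⟩
    rw [hset, Finset.sum_image fun _ _ _ _ h => (List.cons.inj h).2, sum_head_option, add_comm]
    simp only [if_pos hd, add_tsub_cancel_left]
    congr 1
    · refine Finset.sum_congr rfl fun g _ => ?_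
      change _ = _ * ∑ P ∈ (Finsupp.toMultiset d').lists.toFinset with P.head? = some g, _
      rw [Finset.mul_sum]
      refine Finset.sum_congr rfl fun P hP => ?_
      obtain ⟨Q, rfl⟩ := List.head?_eq_some_iff.1 (Finset.mem_filter.1 hP).2
      rfl
    -- The empty remainder occurs exactly for `d' = 0` and yields the sink term.
    · rw [pathWeight, MvPowerSeries.coeff_monomial]
      have : Finsupp.toMultiset d' = (([] : List E) : Multiset E) ↔
          Finsupp.single e 1 + d' = Finsupp.single e 1 := by
        rw [Multiset.coe_nil, add_eq_left]
        exact ⟨fun h => by rw [← Finsupp.toMultiset_toFinsupp d', h, map_zero],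
          fun h => by rw [h, map_zero]⟩
      simp only [mem_lists_toFinset, this, mul_ite, mul_one, mul_zero]
  · have h1 : (Finsupp.single e 1 : E →₀ ℕ) ≠ d := fun h => hd h.le
    simp only [if_neg hd, mul_zero, Finset.sum_const_zero, zero_add,
      MvPowerSeries.coeff_monomial, if_neg h1.symm]
    refine Finset.sum_eq_zero fun P hP => absurd ?_ hd
    obtain ⟨h2, h3⟩ := Finset.mem_filter.1 hP
    rw [mem_lists_toFinset] at h2
    rw [Finsupp.single_le_iff, ← Finsupp.count_toMultiset, h2,
      Multiset.one_le_count_iff_mem]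
    exact List.mem_of_mem_head? h3

/-- By `walk_parity` the topological sign and the gauge sign of a walk differ by a factor that
depends only on `i` and `j`. -/
theorem formalMeasurement_eq (hl : G.IsGaugeRay l) {i j : Fin n} {e : E}
    (hs : G.src e = Sum.inl i) (hj : ¬ G.IsSource j) :
    G.formalMeasurement i j =
      ringSign (MvPowerSeries E ℝ) (G.sourcesBetween i j) * G.formalSolution l j e := by
  classical
  ext d
  rw [ringSign_powerSeries, MvPowerSeries.coeff_C_mul]
  change (∑ P ∈ (Finsupp.toMultiset d).lists.toFinset with _, _) = _ *
    ∑ P ∈ (Finsupp.toMultiset d).lists.toFinset with P.head? = some e, _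
  rw [Finset.mul_sum, Finset.sum_filter, Finset.sum_filter]
  refine Finset.sum_congr rfl fun P _ => ?_
  have hiff : (∃ f, G.src f = Sum.inl i ∧ G.IsWalk f j P) ↔ G.IsWalk e j P := by
    constructor
    · rintro ⟨f, hf, hP⟩
      rwa [G.boundary_unique (Or.inl hs) (Or.inl hf)]
    · exact fun h => ⟨e, hs, h⟩
  simp only [hiff]
  by_cases he : P.head? = some e
  · obtain ⟨Q, rfl⟩ := List.head?_eq_some_iff.1 he
    rw [if_pos he, pathWeight_flowMatrix]
    by_cases hP : G.IsWalk e j (e :: Q)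
    · rw [if_pos hP, if_pos hP, ringSign, ringSign,
        negOnePow_eq_of_cast_eq (walk_parity hl hs hj hP)]
      have h1 : ((e :: Q).map (1 : E → ℝ)).prod = 1 := List.prod_eq_one (by simp)
      rw [h1, mul_one, ← ringSign, ← ringSign, ringSign_add, ← mul_assoc, ringSign_mul_self,
        one_mul, ringSign_real]
    · rw [if_neg hP, if_neg hP, mul_zero]
  · rw [if_neg he, if_neg fun h => he h.1]

/-- Setting all variables to zero leaves the identity matrix, so the constant coefficient is 1. -/
theorem isUnit_det_X [Fintype E] [DecidableEq E] (S : Finset E) :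
    IsUnit (1 - zeroRows (G.flowMatrix l (MvPowerSeries.X : E → MvPowerSeries E ℝ)) S).det := by
  rw [MvPowerSeries.isUnit_iff_constantCoeff, RingHom.map_det]
  have : MvPowerSeries.constantCoeff.mapMatrix
      (1 - zeroRows (G.flowMatrix l (MvPowerSeries.X : E → MvPowerSeries E ℝ)) S) = 1 := by
    rw [map_sub, map_one, sub_eq_self]
    ext e f
    by_cases h : e ∈ S <;> simp [zeroRows, h, flowMatrix_X]
  rw [this, Matrix.det_one]
  exact isUnit_one

/-- The polynomials with nonnegative coefficients. -/
def nonnegPolynomials (E : Type*) : Subsemiring (MvPolynomial E ℝ) where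
  carrier := {p | ∀ d, 0 ≤ p.coeff d}
  mul_mem' := fun {a b} ha hb d => by
    classical
    rw [MvPolynomial.coeff_mul]
    exact Finset.sum_nonneg fun x _ => mul_nonneg (ha _) (hb _)
  one_mem' := fun d => by
    classical
    rw [MvPolynomial.coeff_one]
    split_ifs <;> norm_num
  add_mem' := fun {a b} ha hb d => by
    rw [MvPolynomial.coeff_add]
    exact add_nonneg (ha _) (hb _)
  zero_mem' := fun d => by simp

theorem X_mem_nonnegPolynomials (e : E) :
    (MvPolynomial.X e : MvPolynomial E ℝ) ∈ nonnegPolynomials E := fun d => by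
  classical
  rw [MvPolynomial.coeff_X]
  split_ifs <;> norm_num

theorem map_flowSum [Fintype E] {R S : Type*} [CommSemiring R] [CommSemiring S] (φ : R →+* S)
    (w : E → R) : φ (G.flowSum w) = G.flowSum fun e => φ (w e) := by
  simp [flowSum]

theorem map_pathFlowSum [Fintype E] {R S : Type*} [CommSemiring R] [CommSemiring S] (φ : R →+* S)
    (s : List E → R) (w : E → R) (e : E) (j : Fin n) :
    φ (G.pathFlowSum s w e j) = G.pathFlowSum (fun P => φ (s P)) (fun e => φ (w e)) e j := by
  simp [pathFlowSum, map_list_prod, List.map_map, Function.comp_def]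

/-- From a boundary source to a boundary sink, all signs are equal. -/
theorem pathFlowSum_sign [Fintype E] {R : Type*} [CommRing R] (hl : G.IsGaugeRay l) {i j : Fin n}
    {e : E} (hs : G.src e = Sum.inl i) (hj : ¬ G.IsSource j) (w : E → R) :
    G.pathFlowSum (fun P => ringSign R (G.walkWind l P + (G.walkInt l P : ℤ))) w e j =
      ringSign R (G.sourcesBetween i j) * G.pathFlowSum 1 w e j := by
  classical
  unfold pathFlowSum
  rw [Finset.mul_sum]
  refine Finset.sum_congr rfl fun P hP => ?_
  rw [Finset.mul_sum]
  refine Finset.sum_congr rfl fun C _ => ?_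
  beta_reduce
  rw [ringSign, negOnePow_eq_of_cast_eq
    (walk_parity_of_nodup hl hs hj (Finset.mem_filter.1 hP).2 P.2), ← ringSign, Pi.one_apply,
    one_mul]

/-- The boundary measurement is a quotient of sums over flows. -/
theorem isBoundaryMeasurement [Fintype E] (hl : G.IsGaugeRay l) {w : E → ℝ} (hw : ∀ e, 0 < w e)
    {i j : Fin n} {e : E} (hs : G.src e = Sum.inl i) (hj : ¬ G.IsSource j) :
    G.IsBoundaryMeasurement w i j (G.pathFlowSum 1 w e j / G.flowSum w) := by
  classical
  have hq : MvPolynomial.eval w (G.flowSum MvPolynomial.X) = G.flowSum w := by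
    rw [map_flowSum]; simp
  refine ⟨G.pathFlowSum 1 MvPolynomial.X e j, G.flowSum MvPolynomial.X, ?_, ?_, ?_, ?_, ?_⟩
  · refine Subsemiring.sum_mem (nonnegPolynomials E) fun P _ => Subsemiring.sum_mem _ fun C _ => ?_
    refine Subsemiring.mul_mem _ (Subsemiring.one_mem _) (Subsemiring.mul_mem _ ?_ ?_)
    · refine Subsemiring.list_prod_mem _ fun x hx => ?_
      obtain ⟨f, -, rfl⟩ := List.mem_map.1 hx
      exact X_mem_nonnegPolynomials f
    · exact Subsemiring.prod_mem _ fun f _ => X_mem_nonnegPolynomials f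
  · exact Subsemiring.sum_mem (nonnegPolynomials E) fun C _ =>
      Subsemiring.prod_mem _ fun f _ => X_mem_nonnegPolynomials f
  -- A vanishing denominator would contradict its positive value at `w`.
  · intro h
    rw [h, map_zero] at hq
    exact (flowSum_pos hl hw).ne hq
  · have h1 : ((G.flowSum MvPolynomial.X : MvPolynomial E ℝ) : MvPowerSeries E ℝ) =
        G.flowSum MvPowerSeries.X := by
      have := map_flowSum (G := G) (MvPolynomial.coeToMvPowerSeries.ringHom (R := ℝ))
        (MvPolynomial.X : E → _)
      simpa using this
    have h2 : ((G.pathFlowSum 1 MvPolynomial.X e j : MvPolynomial E ℝ) : MvPowerSeries E ℝ) =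
        G.pathFlowSum 1 MvPowerSeries.X e j := by
      have := map_pathFlowSum (G := G) (MvPolynomial.coeToMvPowerSeries.ringHom (R := ℝ)) 1
        (MvPolynomial.X : E → _) e j
      simpa [← Pi.one_def] using this
    -- The sign relating topological to gauge signs of all walks equals the common gauge sign of
    -- edge-simple walks, so the two cancel and the numerator is unsigned.
    rw [h1, h2, formalMeasurement_eq hl hs hj, mul_left_comm,
      flowSum_mul_solution hl _ (fun S => isUnit_det_X S) j _ (formalSolution_eq j) e,
      pathFlowSum_sign hl hs hj, ← mul_assoc, ringSign_mul_self, one_mul]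
  · rw [hq, map_pathFlowSum]
    simp [← Pi.one_def]

/-- At sink columns the common sign of edge-simple walks is the sign in the matrix. At source
columns the flow vector is 0, and subtracting the basis vector removes the identity block. -/
theorem exists_boundaryMeasurementMatrix [Fintype E] (hl : G.IsGaugeRay l) {w : E → ℝ}
    (hw : ∀ e, 0 < w e) : ∃ A : Matrix {i : Fin n // G.IsSource i} (Fin n) ℝ,
      G.IsBoundaryMeasurementMatrix w A ∧
        ∀ (r : {i : Fin n // G.IsSource i}) (e : E), G.src e = Sum.inl r.1 →
          G.flowVector l w e = A r - Pi.single r.1 1 := by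
  classical
  refine ⟨Matrix.of fun r j => if G.IsSource j then (if r.1 = j then 1 else 0) else
    (-1) ^ G.sourcesBetween r.1 j * (G.pathFlowSum 1 w r.2.choose j / G.flowSum w),
    ⟨fun r i hi => by simp [hi], fun r j hj => ⟨_, isBoundaryMeasurement hl hw r.2.choose_spec hj,
      by simp [hj]⟩⟩, fun r e he => ?_⟩
  have hre : r.2.choose = e := G.boundary_unique (Or.inl r.2.choose_spec) (Or.inl he)
  ext j
  rw [flowVector, Pi.sub_apply, Matrix.of_apply, hre]
  split_ifs with hj hrj
  · simp [hrj]
  · simp [Ne.symm hrj]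
  · have : j ≠ r.1 := fun h => hj (h ▸ r.2)
    rw [flowNumerator_eq, pathFlowSum_sign hl he hj, ringSign_real, zpow_natCast, Pi.single_apply,
      if_neg this, sub_zero, mul_div_assoc]
    rfl

end Solution
end PlanarPerfectGraph

theorem mainTheorem5 {n : ℕ} {V E : Type*} [Fintype V] [Fintype E]
    (G : PlanarPerfectGraph n V E) (l : ℂ) (hl : G.IsGaugeRay l)
    (w : E → ℝ) (hw : ∀ e, 0 < w e) :
    -- the edge vector relations are equivalent to the half-edge relations
    (Set.BijOn (G.toHalfEdge l w)
        {X : E → Fin n → ℝ | G.IsEdgeSystem l w X}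
        {z : G.HalfEdge → Fin n → ℝ | G.IsHalfEdgeSystem l w z} ∧
      ∀ (F : Fin n → Fin n → ℝ) (X : E → Fin n → ℝ),
        G.EdgeBoundary l w F X ↔ G.HalfEdgeBoundary l F (G.toHalfEdge l w X)) ∧
    -- the half-edge relations have full rank
    (Module.finrank ℝ (G.solutionSpace l w) = {j : Fin n | ¬ G.IsSource j}.ncard ∧
      ∀ F : Fin n → Fin n → ℝ, ∃! z : G.HalfEdge → Fin n → ℝ,
        G.IsHalfEdgeSystem l w z ∧ G.HalfEdgeBoundary l F z) ∧
    -- the solution gives the boundary measurement matrix and has the flow expression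
    (∀ z : G.HalfEdge → Fin n → ℝ, G.IsHalfEdgeSystem l w z →
      G.HalfEdgeBoundary l (fun j => Pi.single j 1) z →
      (∃ A : Matrix {i : Fin n // G.IsSource i} (Fin n) ℝ, G.IsBoundaryMeasurementMatrix w A ∧
        ∀ (r : {i : Fin n // G.IsSource i}) (e : E), G.src e = Sum.inl r.1 →
          z (G.srcHalf e) = A r - Pi.single r.1 1) ∧
      z = G.toHalfEdge l w (G.flowVector l w)) := by
  refine ⟨⟨PlanarPerfectGraph.bijOn_toHalfEdge hw, PlanarPerfectGraph.edgeBoundary_iff hw⟩,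
    ⟨PlanarPerfectGraph.finrank_solutionSpace hl hw,
      PlanarPerfectGraph.existsUnique_halfEdgeSystem hl hw⟩, fun z hz hzb => ?_⟩
  obtain ⟨X, rfl⟩ := PlanarPerfectGraph.exists_toHalfEdge_eq hw hz
  obtain rfl := PlanarPerfectGraph.eq_flowVector hl hw
    ((PlanarPerfectGraph.isHalfEdgeSystem_toHalfEdge_iff hw X).1 hz)
    ((PlanarPerfectGraph.edgeBoundary_iff hw _ X).2 hzb)
  refine ⟨?_, rfl⟩
  obtain ⟨A, hA, hrow⟩ := PlanarPerfectGraph.exists_boundaryMeasurementMatrix (G := G) hl hw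
  refine ⟨A, hA, fun r e he => ?_⟩
  -- At a boundary source the half-edge vector is the edge vector itself.
  have h1 : G.srcCoeff l e = 1 := by
    unfold PlanarPerfectGraph.srcCoeff
    rw [he]
  rw [PlanarPerfectGraph.toHalfEdge_srcHalf, h1, one_smul, hrow r e he]
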